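/- **Setting.** Let $\Sigma$ be an $n$-dimensional smooth surface immersed in $\mathbb{R}^N$ (a smooth $n$-manifold $M$ without boundary, with a smooth immersion $x:M\to\mathbb{R}^N$), complete in the induced metric, with induced volume measure $d\mu$. Write $v^\top$ and $v^\perp$ for the tangential and normal parts of a vector $v$. For a local orthonormal tangent frame $(e_i)$ let $h_{ij}=(D_{e_i}e_j)^\perp$ be the second fundamental form and $H=\sum_i h_{ii}$ the mean curvature vector. Let $\nabla_v X=(D_vX)^\perp$ be the connection of the normal bundle and $\Delta$ its Laplacian. Let $x_0\in\mathbb{R}^N$ and $t_0>0$. Assume that $\Sigma$ is a self-shrinker that becomes extinct at $(x_0,t_0)$, i.e. $H+\frac{(x-x_0)^\perp}{2t_0}=0$, and has polynomial volume growth, i.e. $\mathrm{Vol}(B_r(0)\cap\Sigma)\le C_1r^d+C_2$ for all $r>0$, with constants $C_1,C_2,d>0$. Put $$F_{x_0,t_0}(\Sigma)=\int_\Sigma G\,d\mu,\qquad G(x)=(4\pi t_0)^{-n/2}e^{-\frac{|x-x_0|^2}{4t_0}},$$ and, for a normal vector field $X$, $$LX=\Delta X+\sum_{i,j}\langle X,h_{ij}\rangle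 h_{ij}-\sum_i\Big\langle\frac{x-x_0}{2t_0},e_i\Big\rangle\nabla_{e_i}X+\frac1{2t_0}X .$$ **Deformations.** Let $\Phi_s:M\to\mathbb{R}^N$, $|s|<\varepsilon$, be a family of immersions, smooth in $(s,p)$, with $\Phi_0=x$ and with normal velocity $X=\partial_s\Phi_s|_{s=0}$; write $\Sigma_s$ for the surface $\Phi_s$ and $d\mu_s$ for its volume measure. Let $x_s\in\mathbb{R}^N$ and $t_s\in\mathbb{R}$ be $C^2$ in $s$, equal to the given $x_0$ and $t_0$ at $s=0$, with $\dot x_0=y$ and $\dot t_0=h$. Assume that one of the following holds: (a) there is a compact $K\subset M$ with $\Phi_s=x$ on $M\setminus K$ for all $|s|<\varepsilon$ (automatic if $\Sigma$ is closed); or (b) the first and second $s$-derivatives of the density $G_s(\Phi_s)\frac{d\mu_s}{d\mu}$, where $G_s(z)=(4\pi t_s)^{-n/2}e^{-|z-x_s|^2/(4t_s)}$, are bounded in absolute value, for all $s$ near $0$, by one $\mu$-integrable function on $M$; $|X|,|\nabla X|,|LX|\in L^2(G\,d\mu)$; and $(\partial_s^2\Phi_s|_{s=0})^\top\in L^1(G\,d\mu)$.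 **Theorem.** For $s$ near $0$ the integral defining $F_{x_s,t_s}(\Sigma_s)$ converges and $s\mapsto F_{x_s,t_s}(\Sigma_s)$ is differentiable. It is twice differentiable at $s=0$, the two integrals below converge absolutely, and $$\frac{d^2}{ds^2}\Big|_{s=0}F_{x_s,t_s}(\Sigma_s)=-\int_\Sigma\Big\langle X,\,LX-\frac1{t_0}y+\frac2{t_0}hH\Big\rangle G\,d\mu-\int_\Sigma\Big[\frac1{2t_0}|y^\perp|^2+\frac1{t_0}h^2|H|^2\Big]G\,d\mu .$$ -/

import Mathlib

open scoped Manifold ContDiff Topology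

noncomputable section

namespace ImmersedSurface

variable {n N : ℕ} {M : Type*} [TopologicalSpace M] [ChartedSpace (EuclideanSpace ℝ (Fin n)) M]

/-! ### First order geometry of a map `F : M → ℝ^N` from an `n`-manifold -/

/-- The differential `dF_p : T_pM → ℝ^N` (in Mathlib `T_pM` is a copy of `ℝ^n`, identified through
the preferred chart at `p`). -/
def diff (F : M → EuclideanSpace ℝ (Fin N)) (p : M) :
    EuclideanSpace ℝ (Fin n) →L[ℝ] EuclideanSpace ℝ (Fin N) :=
  mfderiv (𝓡 n) 𝓘(ℝ, EuclideanSpace ℝ (Fin N)) F p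

/-- `F` is a smooth immersion of the `n`-manifold `M` in `ℝ^N`. -/
structure IsSmoothImmersion (n : ℕ) [ChartedSpace (EuclideanSpace ℝ (Fin n)) M]
    (F : M → EuclideanSpace ℝ (Fin N)) : Prop where
  smooth : ContMDiff (𝓡 n) 𝓘(ℝ, EuclideanSpace ℝ (Fin N)) ∞ F
  injective : ∀ p, Function.Injective (diff (n := n) F p)

/-- The tangent plane `dF_p(T_pM) ⊆ ℝ^N`. -/
def tangentPlane (n : ℕ) [ChartedSpace (EuclideanSpace ℝ (Fin n)) M]
    (F : M → EuclideanSpace ℝ (Fin N)) (p : M) : Submodule ℝ (EuclideanSpace ℝ (Fin N)) :=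
  LinearMap.range (diff (n := n) F p).toLinearMap

/-- The tangential part `v^⊤` at `p` of a vector `v` of `ℝ^N`. -/
def tanPart (n : ℕ) [ChartedSpace (EuclideanSpace ℝ (Fin n)) M]
    (F : M → EuclideanSpace ℝ (Fin N)) (p : M) (v : EuclideanSpace ℝ (Fin N)) :
    EuclideanSpace ℝ (Fin N) :=
  (tangentPlane n F p).starProjection v

/-- The normal part `v^⊥` at `p` of a vector `v` of `ℝ^N`. -/
def norPart (n : ℕ) [ChartedSpace (EuclideanSpace ℝ (Fin n)) M]
    (F : M → EuclideanSpace ℝ (Fin N)) (p : M) (v : EuclideanSpace ℝ (Fin N)) :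
    EuclideanSpace ℝ (Fin N) :=
  (tangentPlane n F p)ᗮ.starProjection v

/-- `Σ_i B(e_i)` over an orthonormal basis `(e_i)` of the tangent plane at `p`. -/
def frameSum {V : Type*} [AddCommMonoid V] (n : ℕ) [ChartedSpace (EuclideanSpace ℝ (Fin n)) M]
    (F : M → EuclideanSpace ℝ (Fin N)) (p : M) (B : EuclideanSpace ℝ (Fin N) → V) : V :=
  ∑ i, B (stdOrthonormalBasis ℝ (tangentPlane n F p) i : EuclideanSpace ℝ (Fin N))

/-- The directional derivative `D_v u` at `p` of a map `u : M → ℝ^N` in the direction of a vector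
`v` of the tangent plane of the immersion `F`: this is `du_p(ξ)`, where `ξ ∈ T_pM` is the tangent
vector with `dF_p(ξ) = v`. -/
def dirDeriv (n : ℕ) [ChartedSpace (EuclideanSpace ℝ (Fin n)) M]
    (F u : M → EuclideanSpace ℝ (Fin N)) (p : M) (v : EuclideanSpace ℝ (Fin N)) :
    EuclideanSpace ℝ (Fin N) :=
  diff (n := n) u p (Function.invFun (diff (n := n) F p) v)

/-! ### Second order geometry -/

/-- The second fundamental form `h(v, w) = (D_v W)^⊥` at `p`, for `v, w` in the tangent plane at
`p`; here `W` is the tangent vector field `q ↦ w^⊤` extending `w`. -/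
def secondFF (n : ℕ) [ChartedSpace (EuclideanSpace ℝ (Fin n)) M]
    (F : M → EuclideanSpace ℝ (Fin N)) (p : M) (v w : EuclideanSpace ℝ (Fin N)) :
    EuclideanSpace ℝ (Fin N) :=
  norPart n F p (dirDeriv n F (fun q => tanPart n F q w) p v)

/-- The mean curvature vector `H = Σ_i h(e_i, e_i)`. -/
def meanCurv (n : ℕ) [ChartedSpace (EuclideanSpace ℝ (Fin n)) M]
    (F : M → EuclideanSpace ℝ (Fin N)) (p : M) : EuclideanSpace ℝ (Fin N) :=
  frameSum n F p fun e => secondFF n F p e e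

/-- The normal connection `∇_v X = (D_v X)^⊥`, for a normal field `X` and `v` in the tangent plane
at `p`. -/
def normalConn (n : ℕ) [ChartedSpace (EuclideanSpace ℝ (Fin n)) M]
    (F X : M → EuclideanSpace ℝ (Fin N)) (p : M) (v : EuclideanSpace ℝ (Fin N)) :
    EuclideanSpace ℝ (Fin N) :=
  norPart n F p (dirDeriv n F X p v)

/-- The second covariant derivative `∇²X(v, w) = ∇_v ∇_W X - ∇_{(D_v W)^⊤} X` in the normal bundle,
for `v, w` in the tangent plane at `p`; here `W` is the tangent vector field `q ↦ w^⊤` extending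
`w`, and `(D_v W)^⊤` is its Levi-Civita derivative. -/
def normalHess (n : ℕ) [ChartedSpace (EuclideanSpace ℝ (Fin n)) M]
    (F X : M → EuclideanSpace ℝ (Fin N)) (p : M) (v w : EuclideanSpace ℝ (Fin N)) :
    EuclideanSpace ℝ (Fin N) :=
  normalConn n F (fun q => normalConn n F X q (tanPart n F q w)) p v
    - normalConn n F X p (tanPart n F p (dirDeriv n F (fun q => tanPart n F q w) p v))

/-- The Laplacian `ΔX = Σ_i ∇²X(e_i, e_i)` of the normal bundle. -/
def normalLaplacian (n : ℕ) [ChartedSpace (EuclideanSpace ℝ (Fin n)) M]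
    (F X : M → EuclideanSpace ℝ (Fin N)) (p : M) : EuclideanSpace ℝ (Fin N) :=
  frameSum n F p fun e => normalHess n F X p e e

/-- `|∇X|² = Σ_i |∇_{e_i} X|²`. -/
def normSqNormalConn (n : ℕ) [ChartedSpace (EuclideanSpace ℝ (Fin n)) M]
    (F X : M → EuclideanSpace ℝ (Fin N)) (p : M) : ℝ :=
  frameSum n F p fun e => ‖normalConn n F X p e‖ ^ 2

/-- The Jacobi operator
`LX = ΔX + Σ_{i,j} ⟨X, h_ij⟩ h_ij - Σ_i ⟨(x - x₀)/(2t₀), e_i⟩ ∇_{e_i} X + X/(2t₀)`. -/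
def jacobiOp (n : ℕ) [ChartedSpace (EuclideanSpace ℝ (Fin n)) M]
    (F : M → EuclideanSpace ℝ (Fin N)) (x₀ : EuclideanSpace ℝ (Fin N)) (t₀ : ℝ)
    (X : M → EuclideanSpace ℝ (Fin N)) (p : M) : EuclideanSpace ℝ (Fin N) :=
  normalLaplacian n F X p
    + frameSum n F p (fun e => frameSum n F p fun e' =>
        inner ℝ (X p) (secondFF n F p e e') • secondFF n F p e e')
    - frameSum n F p (fun e =>
        inner ℝ ((1 / (2 * t₀)) • (F p - x₀)) e • normalConn n F X p e)
    + (1 / (2 * t₀)) • X p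

/-- The surface `F` is a self-shrinker that becomes extinct at `(x₀, t₀)`:
`H + (x - x₀)^⊥ / (2t₀) = 0`. -/
def IsSelfShrinker (n : ℕ) [ChartedSpace (EuclideanSpace ℝ (Fin n)) M]
    (F : M → EuclideanSpace ℝ (Fin N)) (x₀ : EuclideanSpace ℝ (Fin N)) (t₀ : ℝ) : Prop :=
  ∀ p, meanCurv n F p + (1 / (2 * t₀)) • norPart n F p (F p - x₀) = 0

/-! ### Induced distance and induced volume -/

/-- The distance of the metric induced by `F`: the infimum of the lengths of `F ∘ γ` over the `C¹`
curves `γ : [0,1] → M` from `p` to `q`. -/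
def inducedEDist (n : ℕ) [ChartedSpace (EuclideanSpace ℝ (Fin n)) M]
    (F : M → EuclideanSpace ℝ (Fin N)) (p q : M) : ENNReal :=
  ⨅ (γ : ℝ → M) (_ : ContMDiffOn 𝓘(ℝ, ℝ) (𝓡 n) 1 γ (Set.Icc 0 1)) (_ : γ 0 = p) (_ : γ 1 = q),
    ∫⁻ t in Set.Icc (0 : ℝ) 1, ‖derivWithin (F ∘ γ) (Set.Icc 0 1) t‖ₑ

/-- The induced metric is complete: every Cauchy sequence of the induced distance converges. -/
def IsCompleteSurface (n : ℕ) [ChartedSpace (EuclideanSpace ℝ (Fin n)) M]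
    (F : M → EuclideanSpace ℝ (Fin N)) : Prop :=
  ∀ u : ℕ → M,
    (∀ δ : ENNReal, 0 < δ → ∃ k, ∀ i ≥ k, ∀ j ≥ k, inducedEDist n F (u i) (u j) < δ) →
    ∃ p, Filter.Tendsto u Filter.atTop (𝓝 p)

/-- The factor `√(det (⟨A ε_i, A ε_j⟩)_{ij})` by which a linear map `A : ℝ^n → ℝ^N` multiplies
`n`-dimensional volumes. -/
def areaFactor (A : EuclideanSpace ℝ (Fin n) →L[ℝ] EuclideanSpace ℝ (Fin N)) : ℝ :=
  √(Matrix.gram ℝ fun i : Fin n => A (EuclideanSpace.single i 1)).det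

/-- The measure `√(det g_ij) du_1 … du_n` on the domain of the preferred chart at `c`, extended by
zero to `M`; here `g_ij` is the metric induced by `F` in this chart. -/
def chartVolume (n : ℕ) [ChartedSpace (EuclideanSpace ℝ (Fin n)) M] [MeasurableSpace M]
    (F : M → EuclideanSpace ℝ (Fin N)) (c : M) : MeasureTheory.Measure M :=
  ((MeasureTheory.volume.restrict (chartAt (EuclideanSpace ℝ (Fin n)) c).target).withDensity
    fun u => ENNReal.ofReal
      (areaFactor (fderiv ℝ (F ∘ (chartAt (EuclideanSpace ℝ (Fin n)) c).symm) u))).map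
    (chartAt (EuclideanSpace ℝ (Fin n)) c).symm

/-- The volume measure `dμ` of the metric induced by `F`. The measures `chartVolume n F c` agree on
the overlaps of the chart domains, by the change of variables formula, so that their supremum is
the measure on `M` that restricts to each of them. -/
def inducedVolume (n : ℕ) [ChartedSpace (EuclideanSpace ℝ (Fin n)) M] [MeasurableSpace M]
    (F : M → EuclideanSpace ℝ (Fin N)) : MeasureTheory.Measure M :=
  ⨆ c : M, chartVolume n F c

/-- Polynomial volume growth: `Vol(B_r(0) ∩ Σ) ≤ C₁ r^d + C₂`. -/
def HasPolynomialVolumeGrowth (n : ℕ) [ChartedSpace (EuclideanSpace ℝ (Fin n)) M]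
    [MeasurableSpace M] (F : M → EuclideanSpace ℝ (Fin N)) : Prop :=
  ∃ C₁ C₂ d : ℝ, 0 < C₁ ∧ 0 < C₂ ∧ 0 < d ∧ ∀ r : ℝ, 0 < r →
    inducedVolume n F {p | ‖F p‖ < r} ≤ ENNReal.ofReal (C₁ * r ^ d + C₂)

/-! ### The F-functional and deformations -/

/-- `G(z) = (4πt)^{-n/2} e^{-|z - x|²/(4t)}`. -/
def gaussWeight (n : ℕ) (x : EuclideanSpace ℝ (Fin N)) (t : ℝ) (z : EuclideanSpace ℝ (Fin N)) : ℝ :=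
  (4 * Real.pi * t) ^ (-(n : ℝ) / 2) * Real.exp (-‖z - x‖ ^ 2 / (4 * t))

/-- The F-functional `F_{x,t}` of the surface `F`. -/
def Ffunctional (n : ℕ) [ChartedSpace (EuclideanSpace ℝ (Fin n)) M] [MeasurableSpace M]
    (x : EuclideanSpace ℝ (Fin N)) (t : ℝ) (F : M → EuclideanSpace ℝ (Fin N)) : ℝ :=
  ∫ p, gaussWeight n x t (F p) ∂(inducedVolume n F)

/-- `Φ s`, `|s| < ε`, is a smooth one-parameter family of smooth immersions with `Φ 0 = F`. -/
structure IsDeformation (n : ℕ) [ChartedSpace (EuclideanSpace ℝ (Fin n)) M]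
    (F : M → EuclideanSpace ℝ (Fin N)) (Φ : ℝ → M → EuclideanSpace ℝ (Fin N)) (ε : ℝ) : Prop where
  pos : 0 < ε
  smooth : ContMDiffOn (𝓘(ℝ, ℝ).prod (𝓡 n)) 𝓘(ℝ, EuclideanSpace ℝ (Fin N)) ∞
    (fun q : ℝ × M => Φ q.1 q.2) (Set.Ioo (-ε) ε ×ˢ Set.univ)
  immersion : ∀ s ∈ Set.Ioo (-ε) ε, IsSmoothImmersion n (Φ s)
  initial : Φ 0 = F

/-- `Φ` moves only the points of a compact subset of `M`. -/
def IsCompactlySupported (F : M → EuclideanSpace ℝ (Fin N))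
    (Φ : ℝ → M → EuclideanSpace ℝ (Fin N)) (ε : ℝ) : Prop :=
  ∃ K : Set M, IsCompact K ∧ ∀ s ∈ Set.Ioo (-ε) ε, ∀ p ∉ K, Φ s p = F p

/-- The density `w_s(p) = G_s(Φ_s(p)) dμ_s/dμ_0 (p)`, so that `F_{x_s,t_s}(Σ_s) = ∫ w_s dμ_0`. -/
def weightedDensity (n : ℕ) [ChartedSpace (EuclideanSpace ℝ (Fin n)) M]
    (F : M → EuclideanSpace ℝ (Fin N)) (Φ : ℝ → M → EuclideanSpace ℝ (Fin N))
    (xs : ℝ → EuclideanSpace ℝ (Fin N)) (ts : ℝ → ℝ) (p : M) (s : ℝ) : ℝ :=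
  gaussWeight n (xs s) (ts s) (Φ s p) *
    (areaFactor (diff (n := n) (Φ s) p) / areaFactor (diff (n := n) F p))

/-- Conditions on a deformation which need not have compact support: near `s = 0` the first two
`s`-derivatives of `w_s` are dominated by an integrable function, the variation field satisfies
`|X|, |∇X|, |LX| ∈ L²(G dμ)`, and the tangential part of the acceleration `∂²Φ/∂s²` at `s = 0` is in
`L¹(G dμ)`. (If the velocity of `Φ_s` is normal to `Φ_s` for every `s`, that tangential part is
`-Σ_i ⟨X, ∇_{e_i} X⟩ e_i`, and the last condition follows from the one before.) -/
structure IsAdmissible (n : ℕ) [ChartedSpace (EuclideanSpace ℝ (Fin n)) M] [MeasurableSpace M]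
    (F : M → EuclideanSpace ℝ (Fin N)) (Φ : ℝ → M → EuclideanSpace ℝ (Fin N))
    (xs : ℝ → EuclideanSpace ℝ (Fin N)) (ts : ℝ → ℝ) (X : M → EuclideanSpace ℝ (Fin N)) : Prop where
  dominated : ∃ b : M → ℝ, MeasureTheory.Integrable b (inducedVolume n F) ∧
    ∀ᶠ s in 𝓝 (0 : ℝ), ∀ p,
      |deriv (weightedDensity n F Φ xs ts p) s| ≤ b p ∧
      |iteratedDeriv 2 (weightedDensity n F Φ xs ts p) s| ≤ b p
  sq_integrable : MeasureTheory.Integrable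
    (fun p => ‖X p‖ ^ 2 * gaussWeight n (xs 0) (ts 0) (F p)) (inducedVolume n F)
  grad_sq_integrable : MeasureTheory.Integrable
    (fun p => normSqNormalConn n F X p * gaussWeight n (xs 0) (ts 0) (F p)) (inducedVolume n F)
  jacobi_sq_integrable : MeasureTheory.Integrable
    (fun p => ‖jacobiOp n F (xs 0) (ts 0) X p‖ ^ 2 * gaussWeight n (xs 0) (ts 0) (F p))
    (inducedVolume n F)
  acceleration : MeasureTheory.Integrable
    (fun p => ‖tanPart n F p (iteratedDeriv 2 (fun s => Φ s p) 0)‖ *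
      gaussWeight n (xs 0) (ts 0) (F p)) (inducedVolume n F)

end ImmersedSurface

end

/-! All the integrals are pulled back to the fixed measure `dμ` of `F`: with `w_s` the weighted
density, `F_{x_s,t_s}(Σ_s) = ∫ w_s dμ` by `Ffunctional_eq_integral_weightedDensity`. Two
differentiations under the integral sign (`hasDerivAt_integral_of_dominated_twice`) reduce the claim
to computing `∫ w''_0 dμ`.

The density satisfies `w' = w r`, where `r` is the logarithmic derivative of the Gaussian plus that
of the area element, so `w'' = w (r² + r')`. At `s = 0` the shrinker equation removes `X` from `r`
(`normal_variation_rate`). In `r'` the area element contributes the divergence of the acceleration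
`Z`, plus `|∇X|²`, minus `Σ ⟨X, h_ij⟩²`. A Bochner identity (`inner_jacobiOp`) trades the last two
for `-⟨X, LX⟩` and a divergence.

Write `wdiv W = div W - ⟨x - x₀, W⟩/(2t₀)`. The pointwise identity `second_variation_pointwise` says
that `w''_0` equals `G` times the wanted integrand, plus `G · wdiv(Z + ½ grad |X|² + Q)`, where the
explicit polynomial field `Q` (`centreField`) accounts for the motion of centre and time.

It remains to see that `∫ G · wdiv W = 0`. On a self-shrinker normal fields have `wdiv = 0`
(`wdiv_tder_self`), and for tangent `W` one has `G · wdiv W = div(G W)`. So the divergence theorem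
on a complete surface is needed, for tangent fields integrable together with their divergence
(`integral_divergence_eq_zero`). Cutoffs with Lipschitz constant tending to `0` prove it. They are
built from a proper 1-Lipschitz function, which the Hopf-Rinow argument `isCompact_closedEBall`
provides, and a Lipschitz function can be integrated by parts in charts by Rademacher's theorem.

Integrability of `wdiv W · G` needs no separate estimate: it is the difference of `w''_0`, which is
dominated, and the integrand of the formula. Only the tangential part of `W` has to be estimated.
For compactly supported deformations the domination is proved in `exists_dominating_of_compact`,
using polynomial volume growth off the support. -/

noncomputable section

set_option linter.unusedSectionVars false

namespace ImmersedSurface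

local notation "𝔼" n:max => EuclideanSpace ℝ (Fin n)

/-! ### Traces, derivatives of determinants, and the Moore-Penrose inverse -/

section LinearAlgebra

variable {V W U : Type*} [NormedAddCommGroup V] [InnerProductSpace ℝ V] [FiniteDimensional ℝ V]
  [NormedAddCommGroup W] [InnerProductSpace ℝ W] [FiniteDimensional ℝ W]
  [NormedAddCommGroup U] [InnerProductSpace ℝ U] [FiniteDimensional ℝ U]

/-- The trace as a continuous linear functional. -/
def traceL (V : Type*) [NormedAddCommGroup V] [InnerProductSpace ℝ V] [FiniteDimensional ℝ V] :
    (V →L[ℝ] V) →L[ℝ] ℝ :=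
  LinearMap.toContinuousLinearMap ((LinearMap.trace ℝ V) ∘ₗ (ContinuousLinearMap.coeLM ℝ))

lemma traceL_apply (A : V →L[ℝ] V) : traceL V A = LinearMap.trace ℝ V A.toLinearMap := rfl

lemma traceL_comp_comm (A : V →L[ℝ] W) (B : W →L[ℝ] V) :
    traceL W (A ∘L B) = traceL V (B ∘L A) := by
  exact LinearMap.trace_comp_comm' _ _

lemma traceL_eq_sum {ι : Type*} [Fintype ι] (b : OrthonormalBasis ι ℝ V) (A : V →L[ℝ] V) :
    traceL V A = ∑ i, inner ℝ (b i) (A (b i)) := by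
  rw [traceL_apply, LinearMap.trace_eq_sum_inner _ b]; rfl

lemma traceL_adjoint (A : V →L[ℝ] V) : traceL V (ContinuousLinearMap.adjoint A) = traceL V A := by
  rw [traceL_eq_sum (stdOrthonormalBasis ℝ V), traceL_eq_sum (stdOrthonormalBasis ℝ V)]
  refine Finset.sum_congr rfl fun i _ => ?_
  rw [ContinuousLinearMap.adjoint_inner_right, real_inner_comm]

lemma traceL_smulRight (f : V →L[ℝ] ℝ) (v : V) : traceL V (f.smulRight v) = f v := by
  rw [traceL_eq_sum (stdOrthonormalBasis ℝ V)]
  conv_rhs => rw [← (stdOrthonormalBasis ℝ V).sum_repr' v]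
  rw [map_sum]
  refine Finset.sum_congr rfl fun i _ => ?_
  simp [inner_smul_right, mul_comm]

/-- The trace over an orthonormal basis of a subspace. -/
lemma sum_inner_subspace {ι : Type*} [Fintype ι] (K : Submodule ℝ V) (b : OrthonormalBasis ι ℝ K)
    (A : V →L[ℝ] V) :
    ∑ i, inner ℝ (b i : V) (A (b i)) = traceL V (A ∘L K.starProjection) := by
  -- The projection onto `K` is a sum of rank-one operators, and the trace of `v ↦ f v • w` is `f
  -- w`.
  have h : A ∘L K.starProjection = ∑ i, (innerSL ℝ (b i : V)).smulRight (A (b i)) := by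
    ext v
    have h1 : K.starProjection v = ∑ i, inner ℝ (b i : V) v • (b i : V) := by
      have h2 := b.sum_repr' (K.orthogonalProjectionOnto v)
      have h3 := congrArg (fun z : K => (z : V)) h2
      simp only [Submodule.coe_sum, Submodule.coe_smul] at h3
      rw [Submodule.starProjection_apply, ← h3]
      refine Finset.sum_congr rfl fun i _ => ?_
      congr 1
      exact Submodule.inner_orthogonalProjectionOnto_eq_of_mem_left (b i) v
    rw [ContinuousLinearMap.comp_apply, h1]
    simp
  rw [h, map_sum]
  refine Finset.sum_congr rfl fun i _ => ?_
  rw [traceL_smulRight]; rfl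

/-- The derivative of the determinant at the identity is the trace. -/
lemma contDiff_det {k : WithTop ℕ∞} : ContDiff ℝ k (fun A : V →L[ℝ] V => A.det) := by
  have h : (fun A : V →L[ℝ] V => A.det) = fun A =>
      ∑ σ : Equiv.Perm (Fin (Module.finrank ℝ V)), ((Equiv.Perm.sign σ : ℤ) : ℝ) *
        ∏ i, inner ℝ (stdOrthonormalBasis ℝ V (σ i)) (A (stdOrthonormalBasis ℝ V i)) := by
    ext A
    rw [ContinuousLinearMap.det, ← LinearMap.det_toMatrix (stdOrthonormalBasis ℝ V).toBasis,
      Matrix.det_apply']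
    simp [LinearMap.toMatrix_apply, OrthonormalBasis.repr_apply_apply]
  rw [h]
  refine ContDiff.sum fun σ _ => contDiff_const.mul (contDiff_prod fun i _ => ?_)
  exact contDiff_const.inner ℝ (ContinuousLinearMap.apply ℝ V (stdOrthonormalBasis ℝ V i)).contDiff

/-- Differentiability is already known, so only directional derivatives need to be identified, and
`det (1 + tM)` is a polynomial in `t` with linear coefficient `tr M`. -/
lemma hasFDerivAt_det_one :
    HasFDerivAt (fun A : V →L[ℝ] V => A.det) (traceL V) (ContinuousLinearMap.id ℝ V) := by
  have hd : DifferentiableAt ℝ (fun A : V →L[ℝ] V => A.det) (ContinuousLinearMap.id ℝ V) :=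
    (contDiff_det (k := 1)).contDiffAt.differentiableAt (by norm_num)
  convert! hd.hasFDerivAt using 1
  ext B
  have h1 : HasDerivAt (fun t : ℝ => (ContinuousLinearMap.id ℝ V + t • B).det)
      (fderiv ℝ (fun A : V →L[ℝ] V => A.det) (ContinuousLinearMap.id ℝ V) B) 0 := by
    have h2 : HasDerivAt (fun t : ℝ => ContinuousLinearMap.id ℝ V + t • B) B 0 := by
      simpa using ((hasDerivAt_id (0:ℝ)).smul_const B).const_add (ContinuousLinearMap.id ℝ V)
    have h3 : HasFDerivAt (fun A : V →L[ℝ] V => A.det)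
      (fderiv ℝ (fun A : V →L[ℝ] V => A.det) (ContinuousLinearMap.id ℝ V))
        (ContinuousLinearMap.id ℝ V + (0:ℝ) • B) := by simpa using hd.hasFDerivAt
    exact h3.comp_hasDerivAt (0:ℝ) h2
  set b := (stdOrthonormalBasis ℝ V).toBasis
  set M := LinearMap.toMatrix b b B.toLinearMap with hM
  obtain ⟨p, hp⟩ : ∃ p : Polynomial ℝ, ∀ t : ℝ, (ContinuousLinearMap.id ℝ V + t • B).det
      = 1 + M.trace * t + p.eval t * t ^ 2 := by
    -- The witness is what remains of the polynomial `det (1 + X M)` after its two lowest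
    -- coefficients are split off.
    refine ⟨(Matrix.det (1 + (Polynomial.X : Polynomial ℝ) • M.map Polynomial.C)).divX.divX, fun t => ?_⟩
    rw [← Matrix.det_one_add_smul t M, ContinuousLinearMap.det, ← LinearMap.det_toMatrix b]
    congr 1
    simp [hM, map_add, map_smul]
  have h4 : HasDerivAt (fun t : ℝ => (ContinuousLinearMap.id ℝ V + t • B).det) M.trace 0 := by
    simp_rw [hp]
    have h5 := (((hasDerivAt_id (0:ℝ)).const_mul M.trace).const_add 1).add
      ((p.hasDerivAt 0).mul ((hasDerivAt_id (0:ℝ)).pow 2))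
    exact h5.congr_deriv (by simp)
  rw [h1.unique h4, traceL_apply, hM, LinearMap.trace_eq_matrix_trace ℝ b]

/-- Jacobi's formula: `det B = det A · det (A⁻¹ B)` moves the question to the identity. -/
lemma hasFDerivAt_det {A : V →L[ℝ] V} (hA : A.IsInvertible) :
    HasFDerivAt (fun A : V →L[ℝ] V => A.det)
      (A.det • (traceL V ∘L (ContinuousLinearMap.compL ℝ V V V A.inverse))) A := by
  have h1 : HasFDerivAt (fun B : V →L[ℝ] V => A.inverse ∘L B)
      (ContinuousLinearMap.compL ℝ V V V A.inverse) A :=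
    (ContinuousLinearMap.compL ℝ V V V A.inverse).hasFDerivAt
  have h2 : A.inverse ∘L A = ContinuousLinearMap.id ℝ V := by
    obtain ⟨e, rfl⟩ := hA; ext; simp
  have h2' : A ∘L A.inverse = ContinuousLinearMap.id ℝ V := by
    obtain ⟨e, rfl⟩ := hA; ext; simp
  have h3 := HasFDerivAt.comp (f := fun B : V →L[ℝ] V => A.inverse ∘L B) A
    (g := fun A : V →L[ℝ] V => A.det) (by rw [h2]; exact hasFDerivAt_det_one) h1
  have h4 := h3.const_mul A.det
  refine h4.congr_of_eventuallyEq (Filter.Eventually.of_forall fun B => ?_)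
  have : B = A ∘L (A.inverse ∘L B) := by rw [← ContinuousLinearMap.comp_assoc, h2']; rfl
  conv_lhs => rw [this]
  exact LinearMap.det_comp _ _

/-- The Moore-Penrose inverse `(A†A)⁻¹A†` of an injective linear map. -/
def pinv (A : V →L[ℝ] W) : W →L[ℝ] V :=
  (ContinuousLinearMap.adjoint A ∘L A).inverse ∘L ContinuousLinearMap.adjoint A

lemma isInvertible_of_injective {A : V →L[ℝ] V} (hA : Function.Injective A) :
    A.IsInvertible := by
  refine ⟨(LinearEquiv.ofInjectiveEndo A.toLinearMap hA).toContinuousLinearEquiv, ?_⟩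
  ext v; rfl

lemma gram_isInvertible {A : V →L[ℝ] W} (hA : Function.Injective A) :
    (ContinuousLinearMap.adjoint A ∘L A).IsInvertible := by
  refine isInvertible_of_injective ((injective_iff_map_eq_zero _).2 fun v hv => ?_)
  have h : inner ℝ (A v) (A v) = 0 := by
    rw [← ContinuousLinearMap.adjoint_inner_right, ← ContinuousLinearMap.comp_apply, hv,
      inner_zero_right]
  exact hA (by rw [inner_self_eq_zero.1 h, map_zero])

lemma inverse_comp_self {A : V →L[ℝ] V} (hA : A.IsInvertible) :
    A.inverse ∘L A = ContinuousLinearMap.id ℝ V := by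
  obtain ⟨e, rfl⟩ := hA; ext; simp

lemma self_comp_inverse {A : V →L[ℝ] V} (hA : A.IsInvertible) :
    A ∘L A.inverse = ContinuousLinearMap.id ℝ V := by
  obtain ⟨e, rfl⟩ := hA; ext; simp

lemma pinv_comp_self {A : V →L[ℝ] W} (hA : Function.Injective A) :
    pinv A ∘L A = ContinuousLinearMap.id ℝ V := by
  rw [pinv, ContinuousLinearMap.comp_assoc, inverse_comp_self (gram_isInvertible hA)]

lemma pinv_apply_self {A : V →L[ℝ] W} (hA : Function.Injective A) (v : V) : pinv A (A v) = v := by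
  rw [← ContinuousLinearMap.comp_apply, pinv_comp_self hA]; rfl

/-- Since `A† A A⁺ = A†`, the residual `w - A A⁺ w` is orthogonal to the range. For `A = dF` this
yields the tangential projection. -/
lemma self_comp_pinv {A : V →L[ℝ] W} (hA : Function.Injective A) :
    A ∘L pinv A = (LinearMap.range A.toLinearMap).starProjection := by
  ext1 w
  refine (Submodule.eq_starProjection_of_mem_of_inner_eq_zero (LinearMap.mem_range.2 ⟨pinv A w, rfl⟩) ?_).symm
  rintro _ ⟨v, rfl⟩
  have h1 : ContinuousLinearMap.adjoint A (A (pinv A w)) = ContinuousLinearMap.adjoint A w := by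
    have := congrArg (fun B : V →L[ℝ] V => B (ContinuousLinearMap.adjoint A w))
      (self_comp_inverse (gram_isInvertible hA))
    simpa [pinv] using this
  change inner ℝ (w - A (pinv A w)) (A v) = 0
  rw [← ContinuousLinearMap.adjoint_inner_left, map_sub, h1, sub_self, inner_zero_left]

/-- After composition with the injective `A ∘ e`, both sides become the orthogonal projection onto
the same range. This rule makes tangential derivatives independent of the chart. -/
lemma pinv_comp {A : V →L[ℝ] W} (hA : Function.Injective A) (e : U ≃L[ℝ] V) :
    pinv (A ∘L (e : U →L[ℝ] V)) = (e.symm : V →L[ℝ] U) ∘L pinv A := by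
  have hAe : Function.Injective (A ∘L (e : U →L[ℝ] V)) := hA.comp e.injective
  have h1 := self_comp_pinv hAe
  have h2 : LinearMap.range (A ∘L (e : U →L[ℝ] V)).toLinearMap = LinearMap.range A.toLinearMap := by
    ext w; constructor
    · rintro ⟨u, rfl⟩; exact ⟨e u, rfl⟩
    · rintro ⟨v, rfl⟩; exact ⟨e.symm v, by simp⟩
  ext1 w
  apply hAe
  simp only [h2, ← self_comp_pinv hA] at h1
  have h3 := congrArg (fun B : W →L[ℝ] W => B w) h1
  simpa using h3

/-- The adjoint is linear and inversion is smooth at invertible maps; injectivity of `A` makes its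
Gram operator invertible. -/
lemma contDiffAt_pinv {k : WithTop ℕ∞} {A : V →L[ℝ] W} (hA : Function.Injective A) :
    ContDiffAt ℝ k (pinv : (V →L[ℝ] W) → (W →L[ℝ] V)) A := by
  have hadj : ContDiff ℝ k (fun B : V →L[ℝ] W => ContinuousLinearMap.adjoint B) :=
    (ContinuousLinearMap.adjoint (𝕜 := ℝ) (E := V) (F := W)).toContinuousLinearEquiv.contDiff
  refine ContDiffAt.clm_comp (ContDiffAt.comp A (g := ContinuousLinearMap.inverse)
    (gram_isInvertible hA).contDiffAt_map_inverse ?_) hadj.contDiffAt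
  exact (hadj.clm_comp contDiff_id).contDiffAt

end LinearAlgebra

/-! ### First and second derivative of the area factor -/

section LinearAlgebra

variable {V W U : Type*} [NormedAddCommGroup V] [InnerProductSpace ℝ V] [FiniteDimensional ℝ V]
  [NormedAddCommGroup W] [InnerProductSpace ℝ W] [FiniteDimensional ℝ W]
  [NormedAddCommGroup U] [InnerProductSpace ℝ U] [FiniteDimensional ℝ U]

/-- The adjoint as a linear map, on real spaces. -/
def adjL : (V →L[ℝ] W) →L[ℝ] (W →L[ℝ] V) :=
  LinearMap.toContinuousLinearMap
    { toFun := fun A => ContinuousLinearMap.adjoint A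
      map_add' := fun A B => map_add _ A B
      map_smul' := fun c A => by simp }

open ContinuousLinearMap in
lemma pinv_comp_adjoint_pinv {A : V →L[ℝ] W} (hA : Function.Injective A) :
    pinv A ∘L adjoint (pinv A) = (adjoint A ∘L A).inverse := by
  have h1 : (adjoint A ∘L A) ∘L pinv A = adjoint A := by
    rw [pinv, ← comp_assoc, self_comp_inverse (gram_isInvertible hA)]; rfl
  have h2 : (adjoint A ∘L A) ∘L (pinv A ∘L adjoint (pinv A)) = ContinuousLinearMap.id ℝ V := by
    rw [← comp_assoc, h1, ← adjoint_comp, pinv_comp_self hA, adjoint_id]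
  calc pinv A ∘L adjoint (pinv A)
      = ((adjoint A ∘L A).inverse ∘L (adjoint A ∘L A)) ∘L (pinv A ∘L adjoint (pinv A)) := by
        rw [inverse_comp_self (gram_isInvertible hA)]; rfl
    _ = _ := by rw [comp_assoc, h2]; rfl

open ContinuousLinearMap in
-- `tr (A⁺ A₁)` is the logarithmic derivative of the area factor along the curve `A`. The derivative
-- of `A⁺` comes from differentiating `A† A A⁺ = A†`. The traces are then moved to the target space,
-- where only `B = A₁ A⁺` and the projection `P = A A⁺` occur: for a normal variation field `tr BB†
-- - tr PBB†` will be `|∇X|²`, and `tr B²` will be the square of the second fundamental form paired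
-- with `X`.
lemma hasDerivAt_trace_pinv {A A₁ : ℝ → V →L[ℝ] W} {A₂ : V →L[ℝ] W} {s : ℝ}
    (hs : Function.Injective (A s)) (h1 : HasDerivAt A (A₁ s) s) (h2 : HasDerivAt A₁ A₂ s) :
    HasDerivAt (fun r => traceL V (pinv (A r) ∘L A₁ r))
      (traceL W (A₂ ∘L pinv (A s))
        + traceL W ((A₁ s ∘L pinv (A s)) ∘L adjoint (A₁ s ∘L pinv (A s)))
        - traceL W ((A s ∘L pinv (A s)) ∘L
            ((A₁ s ∘L pinv (A s)) ∘L adjoint (A₁ s ∘L pinv (A s))))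
        - traceL W ((A₁ s ∘L pinv (A s)) ∘L (A₁ s ∘L pinv (A s)))) s := by
  set G := adjoint (A s) ∘L A s with hG
  have hGi : G.IsInvertible := gram_isInvertible hs
  obtain ⟨p', hp'⟩ : ∃ p', HasDerivAt (fun r => pinv (A r)) p' s :=
    ⟨_, ((contDiffAt_pinv (k := 1) hs).differentiableAt (by norm_num)).hasFDerivAt.comp_hasDerivAt s h1⟩
  have hadj : HasDerivAt (fun r => adjoint (A r)) (adjoint (A₁ s)) s :=
    (adjL (V := V) (W := W)).hasFDerivAt.comp_hasDerivAt s h1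
  -- To be differentiated, the identity `A† = A† A A⁺` must hold for all nearby parameters; it does
  -- because invertibility of the Gram operator is an open condition.
  have hev : (fun r => adjoint (A r)) =ᶠ[𝓝 s] fun r => (adjoint (A r) ∘L A r) ∘L pinv (A r) := by
    have : ∀ᶠ r in 𝓝 s, (adjoint (A r) ∘L A r).IsInvertible := by
      have hc : ContinuousAt (fun r => adjoint (A r) ∘L A r) s :=
        (hadj.clm_comp h1).continuousAt
      obtain ⟨e, he⟩ := hGi
      have := hc.eventually (show ∀ᶠ B in 𝓝 (adjoint (A s) ∘L A s), B ∈
        Set.range ((↑) : (V ≃L[ℝ] V) → V →L[ℝ] V) from by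
          rw [← hG, ← he]; exact ContinuousLinearEquiv.nhds e)
      exact this
    filter_upwards [this] with r hr
    rw [pinv, ← comp_assoc, self_comp_inverse hr]; rfl
  have key : adjoint (A₁ s) = (adjoint (A₁ s) ∘L A s + adjoint (A s) ∘L A₁ s) ∘L pinv (A s)
      + G ∘L p' := by
    have h3 := ((hadj.clm_comp h1).clm_comp hp').congr_of_eventuallyEq hev
    exact hadj.unique h3
  have hp : p' = G.inverse ∘L (adjoint (A₁ s) -
      (adjoint (A₁ s) ∘L A s + adjoint (A s) ∘L A₁ s) ∘L pinv (A s)) := by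
    rw [sub_eq_of_eq_add' key, ← comp_assoc, inverse_comp_self hGi]; rfl
  have hder := (traceL V).hasFDerivAt.comp_hasDerivAt s (hp'.clm_comp h2)
  refine hder.congr_deriv ?_
  have e1 : G.inverse = pinv (A s) ∘L adjoint (pinv (A s)) := (pinv_comp_adjoint_pinv hs).symm
  have e2 : traceL V (p' ∘L A₁ s) = traceL W (A₁ s ∘L p') := traceL_comp_comm _ _
  have e4 : adjoint (A s ∘L pinv (A s)) = A s ∘L pinv (A s) := by
    rw [self_comp_pinv hs]
    exact (isSelfAdjoint_starProjection _)
  rw [map_add, e2, traceL_comp_comm (pinv (A s)) A₂]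
  have e3 : A₁ s ∘L p' = (A₁ s ∘L pinv (A s)) ∘L adjoint (A₁ s ∘L pinv (A s))
      - ((A₁ s ∘L pinv (A s)) ∘L adjoint (A₁ s ∘L pinv (A s))) ∘L (A s ∘L pinv (A s))
      - ((A₁ s ∘L pinv (A s)) ∘L (A₁ s ∘L pinv (A s))) := by
    rw [hp, comp_sub, comp_sub, add_comp, comp_add, comp_add]
    have e5 : G.inverse ∘L (adjoint (A s) ∘L A₁ s) ∘L pinv (A s)
        = pinv (A s) ∘L A₁ s ∘L pinv (A s) := by
      simp only [pinv, hG, comp_assoc]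
    rw [e5, e1, adjoint_comp]
    simp only [comp_assoc, sub_sub]
  rw [e3, map_sub, map_sub, traceL_comp_comm _ (A s ∘L pinv (A s))]
  ring

variable {n N : ℕ}

open ContinuousLinearMap in
lemma det_gram_eq {ι : Type*} [Fintype ι] [DecidableEq ι] (b : OrthonormalBasis ι ℝ V)
    (A : V →L[ℝ] W) : (adjoint A ∘L A).det = (Matrix.gram ℝ fun i => A (b i)).det := by
  rw [ContinuousLinearMap.det, ← LinearMap.det_toMatrix b.toBasis]
  congr 1
  ext i j
  rw [LinearMap.toMatrix_apply]
  simp only [Matrix.gram_apply, OrthonormalBasis.coe_toBasis_repr_apply,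
    OrthonormalBasis.repr_apply_apply, OrthonormalBasis.coe_toBasis]
  change inner ℝ (b i) (adjoint A (A (b j))) = inner ℝ (A (b i)) (A (b j))
  rw [adjoint_inner_right]

open ContinuousLinearMap in
lemma areaFactor_eq (A : EuclideanSpace ℝ (Fin n) →L[ℝ] EuclideanSpace ℝ (Fin N)) :
    areaFactor A = √ (adjoint A ∘L A).det := by
  rw [areaFactor, det_gram_eq (EuclideanSpace.basisFun (Fin n) ℝ)]
  simp

open ContinuousLinearMap in
lemma det_adjoint (B : V →L[ℝ] V) : (adjoint B).det = B.det := by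
  have h := LinearMap.toMatrix_adjoint (stdOrthonormalBasis ℝ V) (stdOrthonormalBasis ℝ V)
    B.toLinearMap
  rw [ContinuousLinearMap.det, ContinuousLinearMap.det,
    ← LinearMap.det_toMatrix (stdOrthonormalBasis ℝ V).toBasis,
    ← LinearMap.det_toMatrix (stdOrthonormalBasis ℝ V).toBasis]
  rw [← star_trivial (Matrix.det (LinearMap.toMatrix _ _ B.toLinearMap)),
    ← Matrix.det_conjTranspose, ← h]
  rfl

open ContinuousLinearMap in
lemma gram_det_pos {A : V →L[ℝ] W} (hA : Function.Injective A) : 0 < (adjoint A ∘L A).det := by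
  have h1 : 0 ≤ (adjoint A ∘L A).det := by
    rw [det_gram_eq (stdOrthonormalBasis ℝ V)]
    exact (Matrix.posSemidef_gram ℝ _).det_nonneg
  refine lt_of_le_of_ne h1 (Ne.symm ?_)
  obtain ⟨e, he⟩ := gram_isInvertible hA
  rw [← he]
  exact (LinearEquiv.isUnit_det' e.toLinearEquiv).ne_zero

lemma areaFactor_pos {A : EuclideanSpace ℝ (Fin n) →L[ℝ] EuclideanSpace ℝ (Fin N)}
    (hA : Function.Injective A) : 0 < areaFactor A := by
  rw [areaFactor_eq]; exact Real.sqrt_pos.2 (gram_det_pos hA)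

open ContinuousLinearMap in
-- `det ((AB)† AB) = det (A† A) · (det B)²`: the transformation rule of the volume density under a
-- change of chart.
lemma areaFactor_comp (A : EuclideanSpace ℝ (Fin n) →L[ℝ] EuclideanSpace ℝ (Fin N))
    (B : EuclideanSpace ℝ (Fin n) →L[ℝ] EuclideanSpace ℝ (Fin n)) :
    areaFactor (A ∘L B) = areaFactor A * |B.det| := by
  have h : (adjoint (A ∘L B) ∘L (A ∘L B)).det = (adjoint A ∘L A).det * B.det ^ 2 := by
    have h1 : adjoint (A ∘L B) ∘L (A ∘L B) = adjoint B ∘L ((adjoint A ∘L A) ∘L B) := by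
      rw [adjoint_comp]; simp only [comp_assoc]
    rw [h1]
    have h2 : ∀ C D : EuclideanSpace ℝ (Fin n) →L[ℝ] EuclideanSpace ℝ (Fin n),
      (C ∘L D).det = C.det * D.det := fun C D => LinearMap.det_comp _ _
    rw [h2, h2, det_adjoint]; ring
  rw [areaFactor_eq, areaFactor_eq, h, Real.sqrt_mul' _ (sq_nonneg _), Real.sqrt_sq_eq_abs]

open ContinuousLinearMap in
lemma contDiffAt_areaFactor {k : WithTop ℕ∞}
    {A : EuclideanSpace ℝ (Fin n) →L[ℝ] EuclideanSpace ℝ (Fin N)} (hA : Function.Injective A) :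
    ContDiffAt ℝ k areaFactor A := by
  have hadj : ContDiff ℝ k (fun B : EuclideanSpace ℝ (Fin n) →L[ℝ] EuclideanSpace ℝ (Fin N) =>
      adjoint B) :=
    (adjL (V := EuclideanSpace ℝ (Fin n)) (W := EuclideanSpace ℝ (Fin N))).contDiff
  have h : areaFactor (n := n) (N := N) = fun A => √ (adjoint A ∘L A).det :=
    funext areaFactor_eq
  rw [h]
  exact ((contDiff_det.comp (hadj.clm_comp contDiff_id)).contDiffAt).sqrt (gram_det_pos hA).ne'

/-- Unlike smoothness, continuity also holds at degenerate maps, because the square root is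
continuous at `0`. -/
lemma continuous_areaFactor : Continuous (areaFactor (n := n) (N := N)) := by
  have h : areaFactor (n := n) (N := N) =
      fun A => √ (ContinuousLinearMap.adjoint A ∘L A).det := funext areaFactor_eq
  rw [h]
  refine Real.continuous_sqrt.comp ((contDiff_det (k := 0)).continuous.comp ?_)
  exact (adjL.continuous).clm_comp continuous_id

open ContinuousLinearMap in
-- Along `A + tB` the logarithmic derivative of `√det (A† A)` is `½ tr (g⁻¹ (B† A + A† B))` with `g
-- = A† A`. The two summands are adjoint up to cyclic permutation, hence have the same trace `tr (A⁺
-- B)`.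
lemma hasFDerivAt_areaFactor
    {A : EuclideanSpace ℝ (Fin n) →L[ℝ] EuclideanSpace ℝ (Fin N)} (hA : Function.Injective A) :
    HasFDerivAt areaFactor (areaFactor A •
      (traceL (EuclideanSpace ℝ (Fin n)) ∘L compL ℝ _ _ _ (pinv A))) A := by
  have hd := ((contDiffAt_areaFactor (k := 1) hA).differentiableAt (by norm_num)).hasFDerivAt
  refine hd.congr_fderiv (ContinuousLinearMap.ext (fun B => ?_))
  have hpos := gram_det_pos hA
  have hl : HasDerivAt (fun t : ℝ => A + t • B) B 0 := by
    simpa using ((hasDerivAt_id (0:ℝ)).smul_const B).const_add A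
  have h0 : A + (0:ℝ) • B = A := by rw [_root_.zero_smul ℝ B, _root_.add_zero]
  have hadj : HasDerivAt (fun r : ℝ => adjoint (A + r • B)) (adjoint B) 0 :=
    (adjL (V := EuclideanSpace ℝ (Fin n)) (W := EuclideanSpace ℝ (Fin N))).hasFDerivAt.comp_hasDerivAt
      0 hl
  have hd' : HasFDerivAt areaFactor (fderiv ℝ areaFactor A) (A + (0:ℝ) • B) := by
    rw [h0]; exact hd
  have h1 : HasDerivAt (fun t : ℝ => areaFactor (A + t • B)) (fderiv ℝ areaFactor A B) 0 :=
    hd'.comp_hasDerivAt (f := fun t : ℝ => A + t • B) (0:ℝ) hl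
  have hg := hadj.clm_comp hl
  simp only [h0] at hg
  have hd2 := hasFDerivAt_det (gram_isInvertible hA)
  have hg0 : adjoint A ∘L A = adjoint (A + (0:ℝ) • B) ∘L (A + (0:ℝ) • B) := by rw [h0]
  rw [hg0] at hd2
  have h2 := hd2.comp_hasDerivAt (f := fun r : ℝ => adjoint (A + r • B) ∘L (A + r • B)) (0:ℝ) hg
  simp only [h0] at h2
  have h3 := h2.sqrt (by simp only [Function.comp, h0]; exact hpos.ne')
  have h4 : HasDerivAt (fun t : ℝ => areaFactor (A + t • B)) _ 0 :=
    h3.congr_of_eventuallyEq (Filter.Eventually.of_forall fun t => areaFactor_eq _)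
  rw [h1.unique h4]
  simp only [Function.comp, h0]
  have e1 : traceL _ ((adjoint A ∘L A).inverse ∘L (adjoint B ∘L A)) = traceL _ (pinv A ∘L B) := by
    rw [← traceL_adjoint, ← pinv_comp_adjoint_pinv hA]
    simp only [adjoint_comp, adjoint_adjoint]
    rw [traceL_comp_comm, pinv_comp_adjoint_pinv hA]
    simp only [pinv, comp_assoc]
  have e3 : traceL _ ((adjoint A ∘L A).inverse ∘L (adjoint A ∘L B)) = traceL _ (pinv A ∘L B) := by
    simp only [pinv, comp_assoc]
  simp only [smul_apply, comp_apply, compL_apply, map_add, e1, e3, areaFactor_eq, smul_eq_mul]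
  rw [← two_mul]
  have := Real.sq_sqrt hpos.le
  have h5 := (Real.sqrt_pos.2 hpos).ne'
  field_simp
  rw [this, mul_comm]

end LinearAlgebra

/-! ### Calculus on the manifold, read in charts -/

section Charts

variable {n N : ℕ} {M : Type*} [TopologicalSpace M] [ChartedSpace (𝔼 n) M]
  [IsManifold (𝓡 n) ∞ M]
  {E E₁ E₂ E₃ : Type*} [NormedAddCommGroup E] [NormedSpace ℝ E]
  [NormedAddCommGroup E₁] [NormedSpace ℝ E₁] [NormedAddCommGroup E₂] [NormedSpace ℝ E₂]
  [NormedAddCommGroup E₃] [NormedSpace ℝ E₃]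

/-- Smooth maps from an `n`-manifold to a normed space. -/
abbrev Smooth (n : ℕ) {M : Type*} [TopologicalSpace M] [ChartedSpace (𝔼 n) M]
    (u : M → E) : Prop := ContMDiff (𝓡 n) 𝓘(ℝ, E) ∞ u

lemma Smooth.contDiffOn_chart {u : M → E} (hu : Smooth n u) (c : M) :
    ContDiffOn ℝ ∞ (u ∘ (chartAt (𝔼 n) c).symm) (chartAt (𝔼 n) c).target := by
  rw [← contMDiffOn_iff_contDiffOn]
  exact hu.comp_contMDiffOn (contMDiffOn_chart_symm (I := 𝓡 n))

lemma smooth_of_chart {u : M → E}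
    (h : ∀ c : M, ContDiffOn ℝ ∞ (u ∘ (chartAt (𝔼 n) c).symm) (chartAt (𝔼 n) c).target) :
    Smooth n u := by
  intro p
  have h1 : ContMDiffOn (𝓡 n) 𝓘(ℝ, E) ∞ ((u ∘ (chartAt (𝔼 n) p).symm) ∘ (chartAt (𝔼 n) p))
      (chartAt (𝔼 n) p).source :=
    (contMDiffOn_iff_contDiffOn.2 (h p)).comp (contMDiffOn_chart (I := 𝓡 n))
      (chartAt (𝔼 n) p).mapsTo
  refine ((h1.congr fun q hq => ?_).contMDiffAt ((chartAt (𝔼 n) p).open_source.mem_nhds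
    (mem_chart_source _ p)))
  simp [(chartAt (𝔼 n) p).left_inv hq]

lemma Smooth.differentiableAt_chart {u : M → E} (hu : Smooth n u) {c q : M}
    (hq : q ∈ (chartAt (𝔼 n) c).source) :
    DifferentiableAt ℝ (u ∘ (chartAt (𝔼 n) c).symm) (chartAt (𝔼 n) c q) :=
  ((hu.contDiffOn_chart c).contDiffAt ((chartAt (𝔼 n) c).open_target.mem_nhds
    ((chartAt (𝔼 n) c).map_source hq))).differentiableAt (by simp)

/-- The differential of `u` at `p`, read in the preferred chart at `p`. -/
def mder (n : ℕ) {M : Type*} [TopologicalSpace M] [ChartedSpace (𝔼 n) M]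
    (u : M → E) (p : M) : 𝔼 n →L[ℝ] E :=
  fderiv ℝ (u ∘ (chartAt (𝔼 n) p).symm) (chartAt (𝔼 n) p p)

lemma diff_eq_mder {F : M → 𝔼 N} (hF : Smooth n F) (p : M) : diff (n := n) F p = mder n F p := by
  have h := (hF p).mdifferentiableAt (by simp)
  refine h.mfderiv.trans ?_
  rw [mder]
  simp [writtenInExtChartAt, extChartAt, fderivWithin_univ, Function.comp_def, chartAt_self_eq]
  rfl

lemma differentiableAt_transition {c c' q : M} (hc : q ∈ (chartAt (𝔼 n) c).source)
    (hc' : q ∈ (chartAt (𝔼 n) c').source) :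
    DifferentiableAt ℝ (chartAt (𝔼 n) c ∘ (chartAt (𝔼 n) c').symm) (chartAt (𝔼 n) c' q) := by
  have h1 : ContMDiffAt (𝓡 n) 𝓘(ℝ, 𝔼 n) ∞ (chartAt (𝔼 n) c) q :=
    contMDiffAt_of_mem_maximalAtlas (I := 𝓡 n) (IsManifold.chart_mem_maximalAtlas c) hc
  have h2 : ContMDiffAt 𝓘(ℝ, 𝔼 n) (𝓡 n) ∞ (chartAt (𝔼 n) c').symm (chartAt (𝔼 n) c' q) :=
    (contMDiffOn_chart_symm (I := 𝓡 n)).contMDiffAt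
      ((chartAt (𝔼 n) c').open_target.mem_nhds ((chartAt (𝔼 n) c').map_source hc'))
  have h3 : ContMDiffAt 𝓘(ℝ, 𝔼 n) 𝓘(ℝ, 𝔼 n) ∞
      (chartAt (𝔼 n) c ∘ (chartAt (𝔼 n) c').symm) (chartAt (𝔼 n) c' q) :=
    ContMDiffAt.comp (I' := 𝓡 n) _ (by rwa [(chartAt (𝔼 n) c').left_inv hc']) h2
  exact (contMDiffAt_iff_contDiffAt.1 h3).differentiableAt (by simp)

/-- The transition between the chart at `c` and the preferred chart at `q`. -/
lemma exists_mder_eq {c q : M} (hq : q ∈ (chartAt (𝔼 n) c).source) :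
    ∃ e : 𝔼 n ≃L[ℝ] 𝔼 n, HasFDerivAt (chartAt (𝔼 n) c ∘ (chartAt (𝔼 n) q).symm)
        (e : 𝔼 n →L[ℝ] 𝔼 n) (chartAt (𝔼 n) q q) ∧
      HasFDerivAt (chartAt (𝔼 n) q ∘ (chartAt (𝔼 n) c).symm)
        (e.symm : 𝔼 n →L[ℝ] 𝔼 n) (chartAt (𝔼 n) c q) := by
  have hqq := mem_chart_source (𝔼 n) q
  have d1 := (differentiableAt_transition hq hqq).hasFDerivAt
  have d2 := (differentiableAt_transition hqq hq).hasFDerivAt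
  set B := fderiv ℝ (chartAt (𝔼 n) c ∘ (chartAt (𝔼 n) q).symm) (chartAt (𝔼 n) q q)
  set C := fderiv ℝ (chartAt (𝔼 n) q ∘ (chartAt (𝔼 n) c).symm) (chartAt (𝔼 n) c q)
  -- The two transition maps are mutually inverse near the point, hence so are their derivatives.
  have comp : ∀ c c' : M, q ∈ (chartAt (𝔼 n) c).source → q ∈ (chartAt (𝔼 n) c').source →
      (chartAt (𝔼 n) c ∘ (chartAt (𝔼 n) c').symm) ∘ (chartAt (𝔼 n) c' ∘ (chartAt (𝔼 n) c).symm)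
        =ᶠ[𝓝 (chartAt (𝔼 n) c q)] id := by
    intro c c' hc hc'
    have h1 := (chartAt (𝔼 n) c).continuousAt_symm ((chartAt (𝔼 n) c).map_source hc)
    have h2 := h1.eventually (by
      rw [(chartAt (𝔼 n) c).left_inv hc]; exact (chartAt (𝔼 n) c').open_source.mem_nhds hc')
    filter_upwards [h2, (chartAt (𝔼 n) c).open_target.mem_nhds ((chartAt (𝔼 n) c).map_source hc)]
      with v hv hv'
    simp only [Function.comp, id]
    rw [(chartAt (𝔼 n) c').left_inv hv, (chartAt (𝔼 n) c).right_inv hv']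
  have hBC : B ∘L C = ContinuousLinearMap.id ℝ _ := by
    have := HasFDerivAt.comp (chartAt (𝔼 n) c q) (g := chartAt (𝔼 n) c ∘ (chartAt (𝔼 n) q).symm)
      (by simpa [(chartAt (𝔼 n) c).left_inv hq] using d1) d2
    exact (this.congr_of_eventuallyEq (comp c q hq hqq).symm).unique (hasFDerivAt_id _)
  have hCB : C ∘L B = ContinuousLinearMap.id ℝ _ := by
    have := HasFDerivAt.comp (chartAt (𝔼 n) q q) (g := chartAt (𝔼 n) q ∘ (chartAt (𝔼 n) c).symm)
      (by simpa [(chartAt (𝔼 n) q).left_inv hqq] using d2) d1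
    exact (this.congr_of_eventuallyEq (comp q c hqq hq).symm).unique (hasFDerivAt_id _)
  refine ⟨ContinuousLinearEquiv.equivOfInverse B C (fun x => ?_) (fun x => ?_), d1, d2⟩
  · exact congrArg (fun L : 𝔼 n →L[ℝ] 𝔼 n => L x) hCB
  · exact congrArg (fun L : 𝔼 n →L[ℝ] 𝔼 n => L x) hBC

lemma mder_eq_chart {c q : M} (hq : q ∈ (chartAt (𝔼 n) c).source) {e : 𝔼 n ≃L[ℝ] 𝔼 n}
    (he : HasFDerivAt (chartAt (𝔼 n) c ∘ (chartAt (𝔼 n) q).symm)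
        (e : 𝔼 n →L[ℝ] 𝔼 n) (chartAt (𝔼 n) q q)) {u : M → E}
    (hu : DifferentiableAt ℝ (u ∘ (chartAt (𝔼 n) c).symm) (chartAt (𝔼 n) c q)) :
    mder n u q = fderiv ℝ (u ∘ (chartAt (𝔼 n) c).symm) (chartAt (𝔼 n) c q) ∘L (e : 𝔼 n →L[ℝ] 𝔼 n) := by
  have hqq := mem_chart_source (𝔼 n) q
  have h := HasFDerivAt.comp (chartAt (𝔼 n) q q) (g := u ∘ (chartAt (𝔼 n) c).symm)
    (by simpa [(chartAt (𝔼 n) q).left_inv hqq] using hu.hasFDerivAt) he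
  refine (h.congr_of_eventuallyEq ?_).fderiv
  have h1 := (chartAt (𝔼 n) q).continuousAt_symm ((chartAt (𝔼 n) q).map_source hqq)
  have h2 := h1.eventually (by
      rw [(chartAt (𝔼 n) q).left_inv hqq]; exact (chartAt (𝔼 n) c).open_source.mem_nhds hq)
  filter_upwards [h2] with v hv
  simp only [Function.comp]
  rw [(chartAt (𝔼 n) c).left_inv hv]

/-- The tangential derivative of `u` along the immersion `F`: it sends `v` to the derivative of `u`
in the direction of the tangential part of `v`. -/
def tder (n : ℕ) {M : Type*} [TopologicalSpace M] [ChartedSpace (𝔼 n) M]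
    (F : M → 𝔼 N) (u : M → E) (p : M) : 𝔼 N →L[ℝ] E :=
  mder n u p ∘L pinv (mder n F p)

lemma IsSmoothImmersion.sm {F : M → 𝔼 N} (hF : IsSmoothImmersion n F) : Smooth n F := hF.smooth

lemma IsSmoothImmersion.mder_injective {F : M → 𝔼 N} (hF : IsSmoothImmersion n F) (p : M) :
    Function.Injective (mder n F p) := by
  rw [← diff_eq_mder hF.smooth]; exact hF.injective p

lemma IsSmoothImmersion.fderiv_injective {F : M → 𝔼 N} (hF : IsSmoothImmersion n F) {c q : M}
    (hq : q ∈ (chartAt (𝔼 n) c).source) :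
    Function.Injective (fderiv ℝ (F ∘ (chartAt (𝔼 n) c).symm) (chartAt (𝔼 n) c q)) := by
  obtain ⟨e, he, -⟩ := exists_mder_eq hq
  have h := hF.mder_injective q
  rw [mder_eq_chart hq he (hF.sm.differentiableAt_chart hq)] at h
  intro v w hvw
  have := @h (e.symm v) (e.symm w) (by simpa using hvw)
  simpa using this

/-- A change of chart multiplies `du` by `e` on the right and `dF⁺` by `e⁻¹` on the left, and the
two factors cancel. -/
lemma tder_eq_chart {F : M → 𝔼 N} (hF : IsSmoothImmersion n F) {u : M → E} (hu : Smooth n u)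
    {c q : M} (hq : q ∈ (chartAt (𝔼 n) c).source) :
    tder n F u q = fderiv ℝ (u ∘ (chartAt (𝔼 n) c).symm) (chartAt (𝔼 n) c q) ∘L
      pinv (fderiv ℝ (F ∘ (chartAt (𝔼 n) c).symm) (chartAt (𝔼 n) c q)) := by
  obtain ⟨e, he, -⟩ := exists_mder_eq hq
  rw [tder, mder_eq_chart hq he (hF.sm.differentiableAt_chart hq),
    mder_eq_chart hq he (hu.differentiableAt_chart hq), pinv_comp (hF.fderiv_injective hq)]
  ext v
  simp

/-- `mder` alone need not be continuous, since the preferred chart may jump from point to point. The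
tangential derivative can be read in one fixed chart near each point. -/
lemma smooth_tder {F : M → 𝔼 N} (hF : IsSmoothImmersion n F) {u : M → E} (hu : Smooth n u) :
    Smooth n (tder n F u) := by
  refine smooth_of_chart fun c => ?_
  have ho := (chartAt (𝔼 n) c).open_target
  have h1 : ContDiffOn ℝ ∞ (fun v => fderiv ℝ (u ∘ (chartAt (𝔼 n) c).symm) v ∘L
      pinv (fderiv ℝ (F ∘ (chartAt (𝔼 n) c).symm) v)) (chartAt (𝔼 n) c).target := by
    refine ((hu.contDiffOn_chart c).fderiv_of_isOpen ho (by simp)).clm_comp ?_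
    intro v hv
    have h2 := ((hF.sm.contDiffOn_chart c).fderiv_of_isOpen (m := ∞) ho (by simp)) v hv
    have h3 := hF.fderiv_injective ((chartAt (𝔼 n) c).map_target hv)
    rw [(chartAt (𝔼 n) c).right_inv hv] at h3
    exact (contDiffAt_pinv h3).comp_contDiffWithinAt v h2
  refine h1.congr fun v hv => ?_
  simp only [Function.comp_apply]
  rw [tder_eq_chart hF hu ((chartAt (𝔼 n) c).map_target hv), (chartAt (𝔼 n) c).right_inv hv]

lemma Smooth.hasFDerivAt {u : M → E} (hu : Smooth n u) (p : M) :
    HasFDerivAt (u ∘ (chartAt (𝔼 n) p).symm) (mder n u p) (chartAt (𝔼 n) p p) :=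
  (hu.differentiableAt_chart (mem_chart_source _ p)).hasFDerivAt

lemma chart_symm_self (p : M) : (chartAt (𝔼 n) p).symm (chartAt (𝔼 n) p p) = p :=
  (chartAt (𝔼 n) p).left_inv (mem_chart_source _ p)

lemma mder_const (a : E) (p : M) : mder n (fun _ : M => a) p = 0 := by
  exact (hasFDerivAt_const a _).fderiv

/-- This Leibniz rule is the source of the rules for inner products, scalar multiples, and the
evaluation and composition of operator fields. -/
lemma Smooth.mder_bilin {u : M → E₁} {v : M → E₂} (hu : Smooth n u) (hv : Smooth n v)
    (B : E₁ →L[ℝ] E₂ →L[ℝ] E₃) (p : M) (ξ : 𝔼 n) :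
    mder n (fun q => B (u q) (v q)) p ξ = B (u p) (mder n v p ξ) + B (mder n u p ξ) (v p) := by
  have h := (B.hasFDerivAt_of_bilinear (hu.hasFDerivAt p) (hv.hasFDerivAt p)).fderiv
  have h2 := congrArg (fun L : 𝔼 n →L[ℝ] E₃ => L ξ) h
  simpa [mder, Function.comp_def, chart_symm_self] using h2

lemma Smooth.mder_comp {u : M → E₁} (hu : Smooth n u) {g : E₁ → E₂} {g' : E₁ →L[ℝ] E₂} {p : M}
    (hg : HasFDerivAt g g' (u p)) : mder n (fun q => g (u q)) p = g' ∘L mder n u p := by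
  refine (HasFDerivAt.comp (chartAt (𝔼 n) p p) (g := g) (f := u ∘ (chartAt (𝔼 n) p).symm) ?_
    (hu.hasFDerivAt p)).fderiv
  simpa [chart_symm_self] using hg

lemma Smooth.mder_add {u v : M → E} (hu : Smooth n u) (hv : Smooth n v) (p : M) :
    mder n (fun q => u q + v q) p = mder n u p + mder n v p :=
  ((hu.hasFDerivAt p).add (hv.hasFDerivAt p)).fderiv

lemma Smooth.mder_sub {u v : M → E} (hu : Smooth n u) (hv : Smooth n v) (p : M) :
    mder n (fun q => u q - v q) p = mder n u p - mder n v p :=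
  ((hu.hasFDerivAt p).sub (hv.hasFDerivAt p)).fderiv

variable {F : M → 𝔼 N}

lemma tder_const (a : E) (p : M) : tder n F (fun _ : M => a) p = 0 := by
  rw [tder, mder_const, ContinuousLinearMap.zero_comp]

lemma Smooth.tder_bilin {u : M → E₁} {v : M → E₂} (hu : Smooth n u) (hv : Smooth n v)
    (B : E₁ →L[ℝ] E₂ →L[ℝ] E₃) (p : M) (ξ : 𝔼 N) :
    tder n F (fun q => B (u q) (v q)) p ξ = B (u p) (tder n F v p ξ) + B (tder n F u p ξ) (v p) :=
  hu.mder_bilin hv B p _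

lemma Smooth.tder_comp {u : M → E₁} (hu : Smooth n u) {g : E₁ → E₂} {g' : E₁ →L[ℝ] E₂} {p : M}
    (hg : HasFDerivAt g g' (u p)) : tder n F (fun q => g (u q)) p = g' ∘L tder n F u p := by
  rw [tder, hu.mder_comp hg]; rfl

lemma Smooth.tder_add {u v : M → E} (hu : Smooth n u) (hv : Smooth n v) (p : M) :
    tder n F (fun q => u q + v q) p = tder n F u p + tder n F v p := by
  rw [tder, hu.mder_add hv, ContinuousLinearMap.add_comp]; rfl

lemma Smooth.tder_sub {u v : M → E} (hu : Smooth n u) (hv : Smooth n v) (p : M) :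
    tder n F (fun q => u q - v q) p = tder n F u p - tder n F v p := by
  rw [tder, hu.mder_sub hv, ContinuousLinearMap.sub_comp]; rfl

lemma Smooth.tder_inner {u v : M → 𝔼 N} (hu : Smooth n u) (hv : Smooth n v) (p : M) (ξ : 𝔼 N) :
    tder n F (fun q => inner ℝ (u q) (v q)) p ξ =
      inner ℝ (u p) (tder n F v p ξ) + inner ℝ (tder n F u p ξ) (v p) :=
  hu.tder_bilin hv (innerSL ℝ) p ξ

lemma Smooth.tder_smul {u : M → ℝ} {v : M → E} (hu : Smooth n u) (hv : Smooth n v) (p : M)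
    (ξ : 𝔼 N) : tder n F (fun q => u q • v q) p ξ =
      u p • tder n F v p ξ + tder n F u p ξ • v p :=
  hu.tder_bilin hv (ContinuousLinearMap.lsmul ℝ ℝ) p ξ

lemma Smooth.tder_clm_apply {u : M → E₁ →L[ℝ] E₂} {v : M → E₁} (hu : Smooth n u) (hv : Smooth n v)
    (p : M) (ξ : 𝔼 N) : tder n F (fun q => u q (v q)) p ξ =
      u p (tder n F v p ξ) + tder n F u p ξ (v p) :=
  hu.tder_bilin hv (ContinuousLinearMap.id ℝ (E₁ →L[ℝ] E₂)) p ξ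

lemma Smooth.tder_clm_comp {u : M → E₁ →L[ℝ] E₂} {v : M → E₃ →L[ℝ] E₁} (hu : Smooth n u)
    (hv : Smooth n v) (p : M) (ξ : 𝔼 N) : tder n F (fun q => u q ∘L v q) p ξ =
      u p ∘L (tder n F v p ξ) + tder n F u p ξ ∘L v p :=
  hu.tder_bilin hv (ContinuousLinearMap.compL ℝ E₃ E₁ E₂) p ξ

end Charts

/-! ### Tangential projection, second fundamental form, normal fields -/

section Geometry

variable {n N : ℕ} {M : Type*} [TopologicalSpace M] [ChartedSpace (𝔼 n) M]
  [IsManifold (𝓡 n) ∞ M]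
  {E : Type*} [NormedAddCommGroup E] [NormedSpace ℝ E]
  {F : M → 𝔼 N}

lemma tangentPlane_eq (hF : IsSmoothImmersion n F) (p : M) :
    tangentPlane n F p = LinearMap.range (mder n F p).toLinearMap := by
  rw [tangentPlane, diff_eq_mder hF.smooth]

/-- The projection `P` onto the tangent planes thus becomes a smooth field of operators, and its
derivative `DP` carries the second fundamental form. -/
lemma tder_self (hF : IsSmoothImmersion n F) (p : M) :
    tder n F F p = (tangentPlane n F p).starProjection := by
  rw [tder, self_comp_pinv (hF.mder_injective p)]
  simp only [tangentPlane_eq hF]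

lemma tanPart_eq (hF : IsSmoothImmersion n F) (p : M) (v : 𝔼 N) :
    tanPart n F p v = tder n F F p v := by
  rw [tanPart, tder_self hF]

lemma norPart_eq (hF : IsSmoothImmersion n F) (p : M) (v : 𝔼 N) :
    norPart n F p v = v - tder n F F p v := by
  rw [norPart, tder_self hF, Submodule.starProjection_orthogonal']
  rfl

lemma tder_self_of_mem (hF : IsSmoothImmersion n F) {p : M} {v : 𝔼 N}
    (hv : v ∈ tangentPlane n F p) : tder n F F p v = v := by
  rw [tder_self hF]; exact Submodule.starProjection_eq_self_iff.2 hv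

lemma tder_self_mem (hF : IsSmoothImmersion n F) (p : M) (v : 𝔼 N) :
    tder n F F p v ∈ tangentPlane n F p := by
  rw [tder_self hF]; exact Submodule.starProjection_apply_mem _ _

lemma tder_comp_tder_self (hF : IsSmoothImmersion n F) (u : M → E) (p : M) :
    tder n F u p ∘L tder n F F p = tder n F u p := by
  rw [tder, tder, ContinuousLinearMap.comp_assoc, ← ContinuousLinearMap.comp_assoc (pinv _),
    pinv_comp_self (hF.mder_injective p)]; rfl

lemma tder_tder_self (hF : IsSmoothImmersion n F) (u : M → E) (p : M) (v : 𝔼 N) :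
    tder n F u p (tder n F F p v) = tder n F u p v := by
  rw [← ContinuousLinearMap.comp_apply, tder_comp_tder_self hF]

lemma inner_tder_self (hF : IsSmoothImmersion n F) (p : M) (v w : 𝔼 N) :
    inner ℝ (tder n F F p v) w = inner ℝ v (tder n F F p w) := by
  rw [tder_self hF]; exact Submodule.inner_starProjection_left_eq_right _ _ _

lemma adjoint_tder_self (hF : IsSmoothImmersion n F) (p : M) :
    ContinuousLinearMap.adjoint (tder n F F p) = tder n F F p := by
  rw [tder_self hF]; exact isSelfAdjoint_starProjection _

lemma traceL_tder_self (hF : IsSmoothImmersion n F) (p : M) :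
    traceL _ (tder n F F p) = n := by
  rw [tder, traceL_comp_comm, pinv_comp_self (hF.mder_injective p), traceL_apply]
  simp

lemma dirDeriv_eq (hF : IsSmoothImmersion n F) {u : M → 𝔼 N} (hu : Smooth n u) {p : M} {v : 𝔼 N}
    (hv : v ∈ tangentPlane n F p) : dirDeriv n F u p v = tder n F u p v := by
  obtain ⟨ξ, rfl⟩ := hv
  rw [dirDeriv, diff_eq_mder hu, diff_eq_mder hF.smooth]
  have h1 : Function.invFun (mder n F p) (mder n F p ξ) = ξ :=
    Function.leftInverse_invFun (hF.mder_injective p) ξ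
  change mder n u p (Function.invFun (mder n F p) (mder n F p ξ)) =
    mder n u p (pinv (mder n F p) (mder n F p ξ))
  rw [h1, pinv_apply_self (hF.mder_injective p)]

/-! ### The derivative of the tangential projection -/

lemma smooth_tder_self (hF : IsSmoothImmersion n F) : Smooth n (tder n F F) := smooth_tder hF hF.sm

/-- This is the derivative of `P² = P`. -/
lemma tder_proj_add (hF : IsSmoothImmersion n F) (p : M) (v w : 𝔼 N) :
    tder n F F p (tder n F (tder n F F) p v w) + tder n F (tder n F F) p v (tder n F F p w)
      = tder n F (tder n F F) p v w := by
  have hP := smooth_tder_self hF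
  have h1 : (fun q => tder n F F q ∘L tder n F F q) = tder n F F :=
    funext fun q => tder_comp_tder_self hF F q
  have h2 := hP.tder_clm_comp (F := F) hP p v
  rw [h1] at h2
  have h3 := congrArg (fun L : 𝔼 N →L[ℝ] 𝔼 N => L w) h2
  exact h3.symm

/-- On a tangent vector, the differentiated `P² = P` leaves no tangential part: `DP` sends tangent
vectors to normal ones. -/
lemma tder_self_tder_proj (hF : IsSmoothImmersion n F) (p : M) (v w : 𝔼 N) :
    tder n F F p (tder n F (tder n F F) p v (tder n F F p w)) = 0 := by
  have h := tder_proj_add hF p v (tder n F F p w)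
  rwa [tder_tder_self hF F, add_eq_right] at h

lemma smooth_clm_const {E₁ E₂ : Type*} [NormedAddCommGroup E₁] [NormedSpace ℝ E₁]
    [NormedAddCommGroup E₂] [NormedSpace ℝ E₂] {u : M → E₁ →L[ℝ] E₂} (hu : Smooth n u) (a : E₁) :
    Smooth n fun q => u q a :=
  ContMDiff.clm_apply hu contMDiff_const

lemma Smooth.tder_apply_const {E₁ E₂ : Type*} [NormedAddCommGroup E₁] [NormedSpace ℝ E₁]
    [NormedAddCommGroup E₂] [NormedSpace ℝ E₂] {u : M → E₁ →L[ℝ] E₂} (hu : Smooth n u) (a : E₁)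
    (p : M) (ξ : 𝔼 N) : tder n F (fun q => u q a) p ξ = tder n F u p ξ a := by
  have h := hu.tder_clm_apply (F := F) (v := fun _ => a) contMDiff_const p ξ
  rw [h, tder_const]; simp

lemma Smooth.inner {u v : M → 𝔼 N} (hu : Smooth n u) (hv : Smooth n v) :
    Smooth n fun q => Inner.inner ℝ (u q) (v q) := by
  have h : ContDiff ℝ ∞ (fun z : 𝔼 N × 𝔼 N => Inner.inner ℝ z.1 z.2) := contDiff_inner
  exact h.comp_contMDiff (hu.prodMk_space hv)

lemma inner_tder_proj (hF : IsSmoothImmersion n F) (p : M) (v a b : 𝔼 N) :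
    inner ℝ (tder n F (tder n F F) p v a) b = inner ℝ a (tder n F (tder n F F) p v b) := by
  have hP := smooth_tder_self hF
  have ha := smooth_clm_const hP a
  have hb := smooth_clm_const hP b
  have h1 : (fun q => inner ℝ (tder n F F q a) b) = fun q => inner ℝ a (tder n F F q b) :=
    funext fun q => inner_tder_self hF q a b
  have h2 := ha.tder_inner (F := F) (v := fun _ => b) contMDiff_const p v
  have h3 := Smooth.tder_inner (F := F) (u := fun _ => a) contMDiff_const hb p v
  rw [h1, h3, hP.tder_apply_const, hP.tder_apply_const, tder_const, tder_const] at h2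
  simpa using h2.symm

/-- Symmetry of the second fundamental form. -/
lemma tder_proj_symm (hF : IsSmoothImmersion n F) (p : M) (v w : 𝔼 N) :
    tder n F (tder n F F) p v (tder n F F p w) = tder n F (tder n F F) p w (tder n F F p v) := by
  have hP := smooth_tder_self hF
  set c := chartAt (𝔼 n) p with hc
  set f := F ∘ c.symm with hf
  have hfs : ContDiffOn ℝ ∞ f c.target := hF.sm.contDiffOn_chart p
  have hnhds : c.target ∈ 𝓝 (c p) := c.open_target.mem_nhds (c.map_source (mem_chart_source _ p))
  have hfa : ContDiffAt ℝ ∞ f (c p) := hfs.contDiffAt hnhds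
  have hsym : IsSymmSndFDerivAt ℝ f (c p) := hfa.isSymmSndFDerivAt (by simpa using ENat.LEInfty.out)
  have hd2 : HasFDerivAt (fderiv ℝ f) (fderiv ℝ (fderiv ℝ f) (c p)) (c p) :=
    ((hfa.fderiv_right (m := 1) (by norm_cast)).differentiableAt (by norm_num)).hasFDerivAt
  have hPd := hP.hasFDerivAt p
  -- Differentiating `P ∘ df = df` in the chart shows that `(D_η P)(df ξ)` is the normal part of
  -- `D²f(η, ξ)`, which is symmetric.
  have key : ∀ ξ η : 𝔼 n, mder n (tder n F F) p η (fderiv ℝ f (c p) ξ)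
      + tder n F F p (fderiv ℝ (fderiv ℝ f) (c p) η ξ) = fderiv ℝ (fderiv ℝ f) (c p) η ξ := by
    intro ξ η
    have h1 := hPd.clm_comp hd2
    have h2 : (fun y => (tder n F F ∘ c.symm) y ∘L fderiv ℝ f y) =ᶠ[𝓝 (c p)] fderiv ℝ f := by
      filter_upwards [hnhds] with y hy
      have hq := c.map_target hy
      have hinj := hF.fderiv_injective hq
      simp only [Function.comp_apply]
      rw [tder_eq_chart hF hF.sm hq, ← hc, c.right_inv hy, ContinuousLinearMap.comp_assoc]
      rw [← hc, c.right_inv hy] at hinj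
      rw [pinv_comp_self hinj]; rfl
    have h3 := (h1.congr_of_eventuallyEq h2.symm).unique hd2
    have h4 := congrArg (fun L : 𝔼 n →L[ℝ] 𝔼 n →L[ℝ] 𝔼 N => L η ξ) h3
    simp only [Function.comp_apply, chart_symm_self, hc] at h4
    exact (add_comm _ _).trans h4
  have hA : fderiv ℝ f (c p) = mder n F p := rfl
  have e1 := key (pinv (mder n F p) w) (pinv (mder n F p) v)
  have e2 := key (pinv (mder n F p) v) (pinv (mder n F p) w)
  rw [hsym.eq (pinv (mder n F p) v) (pinv (mder n F p) w)] at e1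
  exact (add_right_cancel (e2.trans e1.symm)).symm

/-! ### Second fundamental form and normal fields -/

lemma frame_mem (n : ℕ) {M : Type*} [TopologicalSpace M] [ChartedSpace (𝔼 n) M] (F : M → 𝔼 N)
    (p : M) (i) : (stdOrthonormalBasis ℝ (tangentPlane n F p) i : 𝔼 N) ∈ tangentPlane n F p :=
  Subtype.mem _

/-- Frame sums are converted to traces because the orthonormal bases are chosen point by point
without any continuity, whereas traces of smooth operator fields are smooth. -/
lemma frameSum_inner (hF : IsSmoothImmersion n F) (p : M) (A : 𝔼 N →L[ℝ] 𝔼 N) :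
    frameSum n F p (fun e => inner ℝ e (A e)) = traceL _ (A ∘L tder n F F p) := by
  rw [frameSum, sum_inner_subspace, tder_self hF]

lemma frameSum_congr (n : ℕ) {M : Type*} [TopologicalSpace M] [ChartedSpace (𝔼 n) M] {F : M → 𝔼 N}
    {V : Type*} [AddCommMonoid V] {p : M} {B B' : 𝔼 N → V} (h : ∀ e ∈ tangentPlane n F p, B e = B' e) :
    frameSum n F p B = frameSum n F p B' :=
  Finset.sum_congr rfl fun i _ => h _ (frame_mem n F p i)

/-- The extension of `w` is `q ↦ P_q w`, whose derivative `(D_v P) w` is already normal, so the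
outer projection does nothing. -/
lemma secondFF_eq (hF : IsSmoothImmersion n F) {p : M} {v w : 𝔼 N} (hv : v ∈ tangentPlane n F p)
    (hw : w ∈ tangentPlane n F p) : secondFF n F p v w = tder n F (tder n F F) p v w := by
  have h1 : (fun q => tanPart n F q w) = fun q => tder n F F q w :=
    funext fun q => tanPart_eq hF q w
  have hP := smooth_tder_self hF
  rw [secondFF, h1, dirDeriv_eq hF (smooth_clm_const hP w) hv, norPart_eq hF,
    hP.tder_apply_const]
  have := tder_self_tder_proj hF p v w
  rw [tder_self_of_mem hF hw] at this
  rw [this, sub_zero]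

lemma meanCurv_eq (hF : IsSmoothImmersion n F) (p : M) :
    meanCurv n F p = frameSum n F p fun e => tder n F (tder n F F) p e e :=
  frameSum_congr n fun _ he => secondFF_eq hF he he

/-- `Y` is a normal field along `F`. -/
def IsNormalField (n : ℕ) {M : Type*} [TopologicalSpace M] [ChartedSpace (𝔼 n) M] (F Y : M → 𝔼 N) :
    Prop := ∀ p, tder n F F p (Y p) = 0

/-- The Weingarten relation, obtained by differentiating `P Y = 0`. -/
lemma IsNormalField.proj_tder (hF : IsSmoothImmersion n F) {Y : M → 𝔼 N} (hY : Smooth n Y)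
    (hn : IsNormalField n F Y) (p : M) (v : 𝔼 N) :
    tder n F F p (tder n F Y p v) = - tder n F (tder n F F) p v (Y p) := by
  have hP := smooth_tder_self hF
  have h1 := hP.tder_clm_apply (F := F) hY p v
  have h2 : (fun q => ImmersedSurface.tder n F F q (Y q)) = fun _ => 0 := funext hn
  rw [h2, tder_const] at h1
  exact eq_neg_of_add_eq_zero_left h1.symm

/-- The divergence of a normal field. -/
lemma IsNormalField.traceL_tder (hF : IsSmoothImmersion n F) {Y : M → 𝔼 N} (hY : Smooth n Y)
    (hn : IsNormalField n F Y) (p : M) :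
    traceL _ (tder n F Y p) = - inner ℝ (Y p) (meanCurv n F p) := by
  rw [← tder_comp_tder_self hF, ← frameSum_inner hF, meanCurv_eq hF, frameSum, frameSum, inner_sum,
    ← Finset.sum_neg_distrib]
  refine Finset.sum_congr rfl fun i _ => ?_
  set e : 𝔼 N := ↑(stdOrthonormalBasis ℝ (tangentPlane n F p) i)
  have he : e ∈ tangentPlane n F p := frame_mem n F p i
  conv_lhs => rw [← tder_self_of_mem hF he, inner_tder_self hF, tder_self_of_mem hF he,
    hn.proj_tder hF hY]
  rw [inner_neg_right, ← inner_tder_proj hF, real_inner_comm]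

lemma isNormalField_sub (hF : IsSmoothImmersion n F) (Y : M → 𝔼 N) :
    IsNormalField n F fun q => Y q - tder n F F q (Y q) := fun p => by
  rw [map_sub, tder_tder_self hF, sub_self]

lemma normalConn_eq (hF : IsSmoothImmersion n F) {X : M → 𝔼 N} (hX : Smooth n X) {p : M} {v : 𝔼 N}
    (hv : v ∈ tangentPlane n F p) :
    normalConn n F X p v = tder n F X p v - tder n F F p (tder n F X p v) := by
  rw [normalConn, dirDeriv_eq hF hX hv, norPart_eq hF]

end Geometry

/-! ### Bochner identity for the Jacobi operator; weighted divergence -/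

section Geometry

variable {n N : ℕ} {M : Type*} [TopologicalSpace M] [ChartedSpace (𝔼 n) M]
  [IsManifold (𝓡 n) ∞ M]
  {E : Type*} [NormedAddCommGroup E] [NormedSpace ℝ E]
  {F : M → 𝔼 N}

/-- The tangential gradient of `|X|²/2`. -/
def gradHalfSq (n : ℕ) {M : Type*} [TopologicalSpace M] [ChartedSpace (𝔼 n) M] (F X : M → 𝔼 N)
    (p : M) : 𝔼 N := adjL (tder n F X p) (X p)

lemma smooth_gradHalfSq (hF : IsSmoothImmersion n F) {X : M → 𝔼 N} (hX : Smooth n X) :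
    Smooth n (gradHalfSq n F X) := by
  have h1 : Smooth n fun p => (adjL (tder n F X p) : 𝔼 N →L[ℝ] 𝔼 N) :=
    (adjL (V := 𝔼 N) (W := 𝔼 N)).contDiff.comp_contMDiff (smooth_tder hF hX)
  exact ContMDiff.clm_apply h1 hX

lemma inner_gradHalfSq (X : M → 𝔼 N) (p : M) (v : 𝔼 N) :
    inner ℝ v (gradHalfSq n F X p) = inner ℝ (tder n F X p v) (X p) :=
  ContinuousLinearMap.adjoint_inner_right _ _ _

lemma tder_self_gradHalfSq (hF : IsSmoothImmersion n F) (X : M → 𝔼 N) (p : M) :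
    tder n F F p (gradHalfSq n F X p) = gradHalfSq n F X p := by
  refine ext_inner_left ℝ fun v => ?_
  rw [← inner_tder_self hF, inner_gradHalfSq, inner_gradHalfSq, tder_tder_self hF]

/-- For fixed `e`, differentiate `⟨e, grad ½|X|²⟩ = ⟨∇_{e^⊤} X, X⟩` in the direction `e`. The
Levi-Civita correction in the Hessian vanishes because `q ↦ e^⊤` has no tangential derivative at
`p`. Summed over a frame, this gives `Δ ½|X|² = ⟨X, ΔX⟩ + |∇X|²`. -/
lemma frameSum_inner_normalHess (hF : IsSmoothImmersion n F) {X : M → 𝔼 N} (hX : Smooth n X)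
    (hn : IsNormalField n F X) (p : M) {e : 𝔼 N} (he : e ∈ tangentPlane n F p) :
    inner ℝ e (tder n F (gradHalfSq n F X) p e) =
      inner ℝ (X p) (normalHess n F X p e e) + ‖normalConn n F X p e‖ ^ 2 := by
  have hP := smooth_tder_self hF
  have hTX := smooth_tder hF hX
  have hTXe := smooth_clm_const hTX e
  set Y : M → 𝔼 N := fun q => tder n F X q e - tder n F F q (tder n F X q e) with hY
  have hYs : Smooth n Y := hTXe.sub (ContMDiff.clm_apply hP hTXe)
  have h1 : (fun q => normalConn n F X q (tanPart n F q e)) = Y := by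
    funext q
    rw [normalConn_eq hF hX (by rw [tanPart_eq hF]; exact tder_self_mem hF q e), tanPart_eq hF,
      tder_tder_self hF]
  have h2 : tanPart n F p (dirDeriv n F (fun q => tanPart n F q e) p e) = 0 := by
    have h3 : (fun q => tanPart n F q e) = fun q => tder n F F q e :=
      funext fun q => tanPart_eq hF q e
    rw [h3, dirDeriv_eq hF (smooth_clm_const hP e) he, tanPart_eq hF, hP.tder_apply_const]
    have := tder_self_tder_proj hF p e e
    rwa [tder_self_of_mem hF he] at this
  have h3 : normalHess n F X p e e = tder n F Y p e - tder n F F p (tder n F Y p e) := by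
    rw [normalHess, h1, h2, normalConn_eq hF hYs he,
      normalConn_eq hF hX (Submodule.zero_mem _)]
    simp
  have h4 : (fun q => inner ℝ e (gradHalfSq n F X q)) = fun q => inner ℝ (Y q) (X q) := by
    funext q
    rw [inner_gradHalfSq, hY, inner_sub_left, inner_tder_self hF, hn q, inner_zero_right, sub_zero]
  have h5 := Smooth.tder_inner (F := F) (u := fun _ => e) contMDiff_const (smooth_gradHalfSq hF hX) p e
  rw [h4, hYs.tder_inner hX, tder_const] at h5
  have h6 : normalConn n F X p e = Y p := normalConn_eq hF hX he
  have h7 : inner ℝ (Y p) (tder n F X p e) = ‖Y p‖ ^ 2 := by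
    have h9 : inner ℝ (Y p) (tder n F F p (tder n F X p e)) = 0 := by
      rw [← inner_tder_self hF,
        show tder n F F p (Y p) = 0 from isNormalField_sub hF (fun q => tder n F X q e) p,
        inner_zero_left]
    rw [← real_inner_self_eq_norm_sq]
    conv_rhs => rw [show Y p = tder n F X p e - tder n F F p (tder n F X p e) from rfl,
      inner_sub_right]
    exact (sub_eq_self.2 h9).symm
  have h8 : inner ℝ (X p) (normalHess n F X p e e) = inner ℝ (tder n F Y p e) (X p) := by
    rw [h3, inner_sub_right, ← inner_tder_self hF, hn p, inner_zero_left, sub_zero, real_inner_comm]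
  rw [h8, h6, ← h7]
  simp only [zero_apply, inner_zero_left, add_zero] at h5
  rw [← h5]; ring

/-- `Σ |⟨X, h_ij⟩|²`. -/
def sqPairing (n : ℕ) {M : Type*} [TopologicalSpace M] [ChartedSpace (𝔼 n) M] (F X : M → 𝔼 N)
    (p : M) : ℝ :=
  frameSum n F p fun e => frameSum n F p fun e' => inner ℝ (X p) (secondFF n F p e e') ^ 2

/-- The weighted divergence of a vector field along `F`. -/
def wdiv (n : ℕ) {M : Type*} [TopologicalSpace M] [ChartedSpace (𝔼 n) M] (F : M → 𝔼 N)
    (x₀ : 𝔼 N) (t₀ : ℝ) (W : M → 𝔼 N) (p : M) : ℝ :=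
  traceL _ (tder n F W p) - 1 / (2 * t₀) * inner ℝ (F p - x₀) (W p)

lemma frameSum_inner_mul (hF : IsSmoothImmersion n F) (p : M) (a b : 𝔼 N) :
    frameSum n F p (fun e => inner ℝ a e * inner ℝ b e) = inner ℝ a (tder n F F p b) := by
  have h := frameSum_inner hF p ((innerSL ℝ b).smulRight a)
  have h1 : (innerSL ℝ b).smulRight a ∘L tder n F F p
      = (innerSL ℝ (tder n F F p b)).smulRight a := by
    ext v; simp [inner_tder_self hF]
  rw [h1, traceL_smulRight] at h
  rw [real_inner_comm]
  refine Eq.trans (frameSum_congr n fun e _ => ?_) h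
  simp [inner_smul_right, real_inner_comm, mul_comm]

lemma frameSum_sq (hF : IsSmoothImmersion n F) (p : M) (a : 𝔼 N) :
    frameSum n F p (fun e => inner ℝ a e ^ 2) = ‖tder n F F p a‖ ^ 2 := by
  simp_rw [sq]
  rw [frameSum_inner_mul hF, ← real_inner_self_eq_norm_mul_norm]
  rw [inner_tder_self hF, tder_tder_self hF]

lemma inner_secondFF (hF : IsSmoothImmersion n F) {X : M → 𝔼 N} (hX : Smooth n X)
    (hn : IsNormalField n F X) {p : M} {e e' : 𝔼 N} (he : e ∈ tangentPlane n F p)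
    (he' : e' ∈ tangentPlane n F p) :
    inner ℝ (X p) (secondFF n F p e e') = - inner ℝ (tder n F X p e) e' := by
  rw [secondFF_eq hF he he', ← inner_tder_proj hF, ← neg_eq_iff_eq_neg.2 (hn.proj_tder hF hX p e),
    inner_neg_left, inner_tder_self hF, tder_self_of_mem hF he']

lemma sqPairing_eq (hF : IsSmoothImmersion n F) {X : M → 𝔼 N} (hX : Smooth n X)
    (hn : IsNormalField n F X) (p : M) :
    sqPairing n F X p = frameSum n F p fun e => ‖tder n F F p (tder n F X p e)‖ ^ 2 := by
  refine frameSum_congr n fun e he => ?_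
  rw [← frameSum_sq hF]
  refine frameSum_congr n fun e' he' => ?_
  rw [inner_secondFF hF hX hn he he', neg_sq]

lemma frameSum_normSq (hF : IsSmoothImmersion n F) (p : M) (C : 𝔼 N →L[ℝ] 𝔼 N) :
    frameSum n F p (fun e => ‖C e‖ ^ 2) =
      traceL _ ((C ∘L tder n F F p) ∘L ContinuousLinearMap.adjoint C) := by
  rw [traceL_comp_comm, ← ContinuousLinearMap.comp_assoc, ← frameSum_inner hF]
  refine frameSum_congr n fun e _ => ?_
  rw [ContinuousLinearMap.comp_apply, ContinuousLinearMap.adjoint_inner_right,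
    real_inner_self_eq_norm_sq]

lemma normSqNormalConn_add (hF : IsSmoothImmersion n F) {X : M → 𝔼 N} (hX : Smooth n X) (p : M) :
    normSqNormalConn n F X p + frameSum n F p (fun e => ‖tder n F F p (tder n F X p e)‖ ^ 2)
      = frameSum n F p fun e => ‖tder n F X p e‖ ^ 2 := by
  rw [normSqNormalConn, frameSum, frameSum, frameSum, ← Finset.sum_add_distrib]
  refine Finset.sum_congr rfl fun i _ => ?_
  rw [normalConn_eq hF hX (frame_mem n F p i)]
  set a := tder n F X p ↑(stdOrthonormalBasis ℝ (tangentPlane n F p) i)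
  have h : inner ℝ (tder n F F p a) (tder n F F p a) = inner ℝ a (tder n F F p a) := by
    rw [inner_tder_self hF, tder_tder_self hF]
  rw [@norm_sub_sq_real, ← real_inner_self_eq_norm_sq (tder n F F p a), h]
  ring

/-- By Pythagoras `|∇X|²` is `|DX|²` minus its tangential part; as a difference of traces it matches
the middle terms of `hasDerivAt_trace_pinv`. -/
lemma normSqNormalConn_eq (hF : IsSmoothImmersion n F) {X : M → 𝔼 N} (hX : Smooth n X) (p : M) :
    normSqNormalConn n F X p =
      traceL _ (tder n F X p ∘L ContinuousLinearMap.adjoint (tder n F X p))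
      - traceL _ (tder n F F p ∘L
        (tder n F X p ∘L ContinuousLinearMap.adjoint (tder n F X p))) := by
  have h1 := normSqNormalConn_add hF hX p
  have h2 := frameSum_normSq hF p (tder n F X p)
  have h3 := frameSum_normSq hF p (tder n F F p ∘L tder n F X p)
  simp only [ContinuousLinearMap.comp_apply] at h3
  rw [h2, h3] at h1
  set B := tder n F X p
  set P := tder n F F p with hP
  have h4 : B ∘L P = B := tder_comp_tder_self hF X p
  have h5 : ((P ∘L B) ∘L P) ∘L ContinuousLinearMap.adjoint (P ∘L B)
      = P ∘L ((B ∘L ContinuousLinearMap.adjoint B) ∘L P) := by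
    rw [ContinuousLinearMap.comp_assoc P B P, h4, ContinuousLinearMap.adjoint_comp, hP,
      adjoint_tder_self hF]
    rfl
  have h6 : P ∘L P = P := tder_comp_tder_self hF F p
  rw [h5, traceL_comp_comm P, ContinuousLinearMap.comp_assoc, h6, traceL_comp_comm, h4] at h1
  linarith

/-- With `B = DX`, symmetry of the second fundamental form makes `P B` self-adjoint on the tangent
plane, so its squared norm is the trace of its square. `B P = B` then removes the projections. -/
lemma sqPairing_eq_trace (hF : IsSmoothImmersion n F) {X : M → 𝔼 N} (hX : Smooth n X)
    (hn : IsNormalField n F X) (p : M) :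
    sqPairing n F X p = traceL _ (tder n F X p ∘L tder n F X p) := by
  set B := tder n F X p with hB
  set P := tder n F F p with hP
  have hBP : B ∘L P = B := tder_comp_tder_self hF X p
  have hPa : ContinuousLinearMap.adjoint P = P := adjoint_tder_self hF p
  have hsym : ContinuousLinearMap.adjoint (P ∘L B) ∘L P = P ∘L B := by
    ext1 v
    refine ext_inner_right ℝ fun w => ?_
    have h1 : ∀ v w, inner ℝ (P (B v)) (P w) = - inner ℝ (X p) (tder n F (tder n F F) p v (P w)) := by
      intro v w
      rw [hP, hB, hn.proj_tder hF hX, inner_neg_left, inner_tder_proj hF]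
    have h2 : inner ℝ (P (B v)) w = inner ℝ (P (B v)) (P w) := by
      rw [hP, inner_tder_self hF, inner_tder_self hF, tder_tder_self hF]
    rw [ContinuousLinearMap.comp_apply, ContinuousLinearMap.adjoint_inner_left,
      ContinuousLinearMap.comp_apply, ContinuousLinearMap.comp_apply, h2, h1,
      tder_proj_symm hF, ← h1, real_inner_comm]
  have h0 : P ∘L P = P := tder_comp_tder_self hF F p
  have h3 : ContinuousLinearMap.adjoint (P ∘L B) ∘L (P ∘L B) = (P ∘L B) ∘L B := by
    conv_rhs => rw [← hsym, ContinuousLinearMap.comp_assoc]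
  have h4 := frameSum_normSq hF p (P ∘L B)
  rw [traceL_comp_comm, ← ContinuousLinearMap.comp_assoc, h3] at h4
  rw [sqPairing_eq hF hX hn]
  refine h4.trans ?_
  rw [ContinuousLinearMap.comp_assoc, ContinuousLinearMap.comp_assoc, traceL_comp_comm,
    ContinuousLinearMap.comp_assoc, ContinuousLinearMap.comp_assoc, ← hP, h0, hBP]

/-- The Bochner formula for `½|X|²`; the drift term of `L` is exactly what turns the divergence of
the gradient into a weighted divergence. -/
lemma inner_jacobiOp (hF : IsSmoothImmersion n F) (x₀ : 𝔼 N) (t₀ : ℝ) {X : M → 𝔼 N}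
    (hX : Smooth n X) (hn : IsNormalField n F X) (p : M) :
    inner ℝ (X p) (jacobiOp n F x₀ t₀ X p) = wdiv n F x₀ t₀ (gradHalfSq n F X) p
      - normSqNormalConn n F X p + sqPairing n F X p + 1 / (2 * t₀) * ‖X p‖ ^ 2 := by
  have h1 : inner ℝ (X p) (normalLaplacian n F X p) =
      traceL _ (tder n F (gradHalfSq n F X) p) - normSqNormalConn n F X p := by
    rw [← tder_comp_tder_self hF, ← frameSum_inner hF, normalLaplacian, normSqNormalConn,
      frameSum, frameSum, frameSum, inner_sum, ← Finset.sum_sub_distrib]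
    refine Finset.sum_congr rfl fun i _ => ?_
    rw [frameSum_inner_normalHess hF hX hn p (frame_mem n F p i)]; ring
  have h2 : inner ℝ (X p) (frameSum n F p (fun e => frameSum n F p fun e' =>
        inner ℝ (X p) (secondFF n F p e e') • secondFF n F p e e')) = sqPairing n F X p := by
    simp only [frameSum, inner_sum, sqPairing, inner_smul_right, sq]
  have h3 : inner ℝ (X p) (frameSum n F p (fun e =>
        inner ℝ ((1 / (2 * t₀)) • (F p - x₀)) e • normalConn n F X p e))
      = 1 / (2 * t₀) * inner ℝ (F p - x₀) (gradHalfSq n F X p) := by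
    rw [← tder_self_gradHalfSq hF, ← frameSum_inner_mul hF, frameSum, frameSum, inner_sum,
      Finset.mul_sum]
    refine Finset.sum_congr rfl fun i _ => ?_
    have he := frame_mem n F p i
    set e : 𝔼 N := ↑(stdOrthonormalBasis ℝ (tangentPlane n F p) i)
    rw [inner_smul_right, normalConn_eq hF hX he, inner_sub_right, ← inner_tder_self hF, hn p,
      inner_zero_left, sub_zero, real_inner_comm e (gradHalfSq n F X p), inner_gradHalfSq,
      real_inner_smul_left, real_inner_comm (X p)]
    ring
  rw [jacobiOp, inner_add_right, inner_sub_right, inner_add_right, h1, h2, h3, inner_smul_right,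
    real_inner_self_eq_norm_sq, wdiv]
  ring

/-- On a self-shrinker, the weighted divergence only depends on the tangential part. -/
lemma wdiv_tder_self (hF : IsSmoothImmersion n F) {x₀ : 𝔼 N} {t₀ : ℝ}
    (hs : IsSelfShrinker n F x₀ t₀) {W : M → 𝔼 N} (hW : Smooth n W) (p : M) :
    wdiv n F x₀ t₀ (fun q => tder n F F q (W q)) p = wdiv n F x₀ t₀ W p := by
  have hPW : Smooth n fun q => tder n F F q (W q) := ContMDiff.clm_apply (smooth_tder_self hF) hW
  have hY : Smooth n fun q => W q - tder n F F q (W q) := hW.sub hPW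
  -- The divergence of the normal part of `W` is minus its pairing with the mean curvature. By the
  -- shrinker equation this equals the normal part of the drift term, so the two cancel in `wdiv`.
  have h1 := (isNormalField_sub hF W).traceL_tder hF hY p
  have h2 : meanCurv n F p = -((1 / (2 * t₀)) • norPart n F p (F p - x₀)) :=
    eq_neg_of_add_eq_zero_left (hs p)
  rw [hW.tder_sub hPW, map_sub, h2, norPart_eq hF] at h1
  have h3 : inner ℝ (W p - tder n F F p (W p)) (F p - x₀ - tder n F F p (F p - x₀))
      = inner ℝ (F p - x₀) (W p) - inner ℝ (F p - x₀) (tder n F F p (W p)) := by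
    simp only [inner_sub_left (W p), inner_sub_right _ (F p - x₀)]
    rw [inner_tder_self hF p _ (tder n F F p _), tder_tder_self hF F, inner_tder_self hF]
    rw [real_inner_comm (W p), ← inner_tder_self hF p (F p - x₀), real_inner_comm (W p)]
    ring
  rw [inner_neg_right, inner_smul_right, h3] at h1
  rw [wdiv, wdiv]
  linarith

end Geometry

/-! ### The induced volume measure and its change under a change of immersion -/

section Volume

open MeasureTheory Set

variable {n N : ℕ} {M : Type*} [TopologicalSpace M] [ChartedSpace (𝔼 n) M]
  [IsManifold (𝓡 n) ∞ M] [MeasurableSpace M] [BorelSpace M] {F : M → 𝔼 N}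

/-- The density of the volume of `F` in the chart at `c`. -/
def chartDensity (n : ℕ) {M : Type*} [TopologicalSpace M] [ChartedSpace (𝔼 n) M] (F : M → 𝔼 N)
    (c : M) (u : 𝔼 n) : ℝ := areaFactor (fderiv ℝ (F ∘ (chartAt (𝔼 n) c).symm) u)

lemma continuousOn_chartDensity (hF : Smooth n F) (c : M) :
    ContinuousOn (chartDensity n F c) (chartAt (𝔼 n) c).target :=
  continuous_areaFactor.comp_continuousOn
    (((hF.contDiffOn_chart c).continuousOn_fderiv_of_isOpen (chartAt (𝔼 n) c).open_target (by simp)))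

lemma chartDensity_nonneg (F : M → 𝔼 N) (c : M) (u : 𝔼 n) : 0 ≤ chartDensity n F c u :=
  Real.sqrt_nonneg _

lemma chartDensity_pos (hF : IsSmoothImmersion n F) {c : M} {u : 𝔼 n}
    (hu : u ∈ (chartAt (𝔼 n) c).target) : 0 < chartDensity n F c u := by
  have h := hF.fderiv_injective ((chartAt (𝔼 n) c).map_target hu)
  rw [(chartAt (𝔼 n) c).right_inv hu] at h
  exact areaFactor_pos h

lemma aemeasurable_chart_symm (c : M) :
    AEMeasurable (chartAt (𝔼 n) c).symm (volume.restrict (chartAt (𝔼 n) c).target) :=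
  (chartAt (𝔼 n) c).continuousOn_symm.aemeasurable (chartAt (𝔼 n) c).open_target.measurableSet

lemma aemeasurable_chartDensity (hF : Smooth n F) (c : M) :
    AEMeasurable (fun u => ENNReal.ofReal (chartDensity n F c u))
      (volume.restrict (chartAt (𝔼 n) c).target) :=
  ((continuousOn_chartDensity hF c).aemeasurable
    (chartAt (𝔼 n) c).open_target.measurableSet).ennreal_ofReal

lemma lintegral_chartVolume (hF : Smooth n F) (c : M) {g : M → ENNReal} (hg : Measurable g) :
    ∫⁻ p, g p ∂(chartVolume n F c) = ∫⁻ u in (chartAt (𝔼 n) c).target,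
      ENNReal.ofReal (chartDensity n F c u) * g ((chartAt (𝔼 n) c).symm u) := by
  have h1 := aemeasurable_chart_symm (n := n) c
  have h2 := aemeasurable_chartDensity hF c
  rw [chartVolume, lintegral_map' hg.aemeasurable
    (h1.mono_ac (withDensity_absolutelyContinuous _ _))]
  exact lintegral_withDensity_eq_lintegral_mul₀ h2 (hg.comp_aemeasurable h1)

lemma measurableSet_chart_inter (c : M) {B : Set M} (hB : MeasurableSet B) :
    MeasurableSet ((chartAt (𝔼 n) c).target ∩ (chartAt (𝔼 n) c).symm ⁻¹' B) := by
  have h := (chartAt (𝔼 n) c).open_target.measurableSet.subtype_image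
    ((continuousOn_iff_continuous_domRestrict.1 (chartAt (𝔼 n) c).continuousOn_symm).measurable hB)
  convert h using 1
  ext u
  simp [and_comm]

lemma chartVolume_apply (hF : Smooth n F) (c : M) {B : Set M} (hB : MeasurableSet B) :
    chartVolume n F c B = ∫⁻ u in (chartAt (𝔼 n) c).target ∩ (chartAt (𝔼 n) c).symm ⁻¹' B,
      ENNReal.ofReal (chartDensity n F c u) := by
  have ho := (chartAt (𝔼 n) c).open_target
  rw [← lintegral_indicator_one hB, lintegral_chartVolume hF c (measurable_one.indicator hB)]
  have hm : MeasurableSet ((chartAt (𝔼 n) c).target ∩ (chartAt (𝔼 n) c).symm ⁻¹' B) :=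
    measurableSet_chart_inter c hB
  rw [← lintegral_indicator ho.measurableSet, ← lintegral_indicator hm]
  congr 1
  ext u
  by_cases h1 : u ∈ (chartAt (𝔼 n) c).target <;> by_cases h2 : (chartAt (𝔼 n) c).symm u ∈ B <;>
    simp [indicator, h1, h2]

lemma chartVolume_compl_source (hF : Smooth n F) (c : M) :
    chartVolume n F c (chartAt (𝔼 n) c).sourceᶜ = 0 := by
  rw [chartVolume_apply hF c (chartAt (𝔼 n) c).open_source.measurableSet.compl]
  have : (chartAt (𝔼 n) c).target ∩ (chartAt (𝔼 n) c).symm ⁻¹' (chartAt (𝔼 n) c).sourceᶜ = ∅ := by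
    ext u; simp only [mem_inter_iff, mem_preimage, mem_compl_iff, mem_empty_iff_false, iff_false]
    exact fun h => h.2 ((chartAt (𝔼 n) c).map_target h.1)
  rw [this]; simp

/-- The chart volumes agree on the overlaps, by the change of variables formula. -/
lemma chartVolume_eq_of_subset (hF : Smooth n F) {c c' : M} {B : Set M} (hB : MeasurableSet B)
    (hc : B ⊆ (chartAt (𝔼 n) c).source) (hc' : B ⊆ (chartAt (𝔼 n) c').source) :
    chartVolume n F c B = chartVolume n F c' B := by
  set φ := chartAt (𝔼 n) c with hφ
  set φ' := chartAt (𝔼 n) c' with hφ'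
  have himg : φ.target ∩ φ.symm ⁻¹' B = (φ ∘ φ'.symm) '' (φ'.target ∩ φ'.symm ⁻¹' B) := by
    ext u; constructor
    · rintro ⟨hu, huB⟩
      refine ⟨φ' (φ.symm u), ⟨φ'.map_source (hc' huB), ?_⟩, ?_⟩
      · simpa [φ'.left_inv (hc' huB)] using huB
      · simp [φ'.left_inv (hc' huB), φ.right_inv hu]
    · rintro ⟨v, ⟨hv, hvB⟩, rfl⟩
      refine ⟨φ.map_source (hc hvB), ?_⟩
      simpa [φ.left_inv (hc hvB)] using hvB
  have hm : MeasurableSet (φ'.target ∩ φ'.symm ⁻¹' B) := measurableSet_chart_inter c' hB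
  have hd : ∀ v ∈ φ'.target ∩ φ'.symm ⁻¹' B,
      DifferentiableAt ℝ (φ ∘ φ'.symm) v := by
    rintro v ⟨hv, hvB⟩
    have := differentiableAt_transition (c := c) (c' := c') (hc hvB) (hc' hvB)
    rwa [φ'.right_inv hv] at this
  have hinj : InjOn (φ ∘ φ'.symm) (φ'.target ∩ φ'.symm ⁻¹' B) := by
    rintro v ⟨hv, hvB⟩ w ⟨hw, hwB⟩ h
    have := φ.injOn (hc hvB) (hc hwB) h
    rw [← φ'.right_inv hv, this, φ'.right_inv hw]
  rw [chartVolume_apply hF c hB, chartVolume_apply hF c' hB, himg,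
    lintegral_image_eq_lintegral_abs_det_fderiv_mul volume hm
      (fun v hv => (hd v hv).hasFDerivAt.hasFDerivWithinAt) hinj]
  refine setLIntegral_congr_fun hm fun v hv => ?_
  change _ = ENNReal.ofReal (areaFactor (fderiv ℝ (F ∘ φ'.symm) v))
  have h1 : (F ∘ φ'.symm) =ᶠ[𝓝 v] (F ∘ φ.symm) ∘ (φ ∘ φ'.symm) := by
    have h2 := (φ'.continuousAt_symm hv.1).eventually (φ.open_source.mem_nhds (hc hv.2))
    filter_upwards [h2] with w hw
    simp [φ.left_inv hw]
  have h3 : DifferentiableAt ℝ (F ∘ φ.symm) ((φ ∘ φ'.symm) v) :=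
    hF.differentiableAt_chart (hc hv.2)
  rw [h1.fderiv_eq, fderiv_comp v h3 (hd v hv), areaFactor_comp, mul_comm (areaFactor _),
    ENNReal.ofReal_mul (abs_nonneg _)]
  rfl

variable [SecondCountableTopology M]

/-- A supremum of measures is awkward to evaluate, so a competitor `ν` is glued from countably many
disjoint Borel pieces, each inside one chart. Agreement on overlaps shows that `ν` equals each chart
volume on subsets of that chart, hence dominates the supremum; the other inequality is trivial. -/
lemma inducedVolume_apply (hF : Smooth n F) {c : M} {B : Set M} (hB : MeasurableSet B)
    (hc : B ⊆ (chartAt (𝔼 n) c).source) : inducedVolume n F B = chartVolume n F c B := by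
  obtain ⟨s, hs, hsu⟩ := TopologicalSpace.countable_cover_nhds
    (f := fun c : M => (chartAt (𝔼 n) c).source)
    fun c => (chartAt (𝔼 n) c).open_source.mem_nhds (mem_chart_source _ c)
  have hne : s.Nonempty := by
    by_contra h
    rw [not_nonempty_iff_eq_empty] at h
    subst h
    have : c ∈ (⋃ x ∈ (∅ : Set M), (chartAt (𝔼 n) x).source) := by rw [hsu]; trivial
    simp at this
  obtain ⟨u, rfl⟩ := hs.exists_eq_range hne
  rw [biUnion_range] at hsu
  set A : ℕ → Set M := disjointed fun k => (chartAt (𝔼 n) (u k)).source with hA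
  have hAm : ∀ k, MeasurableSet (A k) := fun k =>
    MeasurableSet.disjointed (fun k => (chartAt (𝔼 n) (u k)).open_source.measurableSet) k
  have hAs : ∀ k, A k ⊆ (chartAt (𝔼 n) (u k)).source := fun k => disjointed_subset _ k
  have hAu : ⋃ k, A k = univ := by rw [hA, iUnion_disjointed, hsu]
  have hAd : Pairwise (Function.onFun Disjoint A) := disjoint_disjointed _
  set ν : Measure M := Measure.sum fun k => (chartVolume n F (u k)).restrict (A k) with hν
  have hsplit : ∀ (ρ : Measure M) (B : Set M), MeasurableSet B → ρ B = ∑' k, ρ (B ∩ A k) := by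
    intro ρ B hB
    rw [← measure_iUnion (fun i j hij => (hAd hij).mono inter_subset_right inter_subset_right)
      fun k => hB.inter (hAm k), ← inter_iUnion, hAu, inter_univ]
  have hνB : ∀ B, MeasurableSet B → ν B = ∑' k, chartVolume n F (u k) (B ∩ A k) := by
    intro B hB
    rw [hν, Measure.sum_apply _ hB]
    simp_rw [Measure.restrict_apply hB]
  have hνc : ∀ (c : M) (B : Set M), MeasurableSet B → B ⊆ (chartAt (𝔼 n) c).source →
      ν B = chartVolume n F c B := by
    intro c B hB hc
    rw [hνB B hB, hsplit _ B hB]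
    refine tsum_congr fun k => chartVolume_eq_of_subset hF (hB.inter (hAm k))
      (inter_subset_right.trans (hAs k)) (inter_subset_left.trans hc)
  have hle : inducedVolume n F ≤ ν := by
    refine iSup_le fun c => Measure.le_iff.2 fun B hB => ?_
    have hso := (chartAt (𝔼 n) c).open_source.measurableSet
    calc chartVolume n F c B ≤ chartVolume n F c (B ∩ (chartAt (𝔼 n) c).source)
          + chartVolume n F c (chartAt (𝔼 n) c).sourceᶜ := by
          refine (measure_mono ?_).trans (measure_union_le _ _)
          intro x hx
          by_cases h : x ∈ (chartAt (𝔼 n) c).source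
          · exact Or.inl ⟨hx, h⟩
          · exact Or.inr h
      _ = ν (B ∩ (chartAt (𝔼 n) c).source) := by
          rw [chartVolume_compl_source hF, add_zero, hνc c _ (hB.inter hso) inter_subset_right]
      _ ≤ ν B := measure_mono inter_subset_left
  refine le_antisymm ((hle B).trans (hνc c B hB hc).le) ?_
  exact (le_iSup (fun c => chartVolume n F c) c) B

lemma inducedVolume_restrict_source (hF : Smooth n F) (c : M) :
    (inducedVolume n F).restrict (chartAt (𝔼 n) c).source = chartVolume n F c := by
  have hso := (chartAt (𝔼 n) c).open_source.measurableSet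
  ext B hB
  rw [Measure.restrict_apply hB, inducedVolume_apply hF (hB.inter hso) inter_subset_right]
  refine le_antisymm (measure_mono inter_subset_left) ?_
  refine (measure_mono (t := B ∩ (chartAt (𝔼 n) c).source ∪ (chartAt (𝔼 n) c).sourceᶜ) ?_).trans
    ((measure_union_le _ _).trans (by rw [chartVolume_compl_source hF, add_zero]))
  intro x hx
  by_cases h : x ∈ (chartAt (𝔼 n) c).source
  · exact Or.inl ⟨hx, h⟩
  · exact Or.inr h

lemma measure_ext_chart {μ ν : Measure M}
    (h : ∀ c : M, μ.restrict (chartAt (𝔼 n) c).source = ν.restrict (chartAt (𝔼 n) c).source) :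
    μ = ν := by
  obtain ⟨s, hs, hsu⟩ := TopologicalSpace.countable_cover_nhds
    (f := fun c : M => (chartAt (𝔼 n) c).source)
    fun c => (chartAt (𝔼 n) c).open_source.mem_nhds (mem_chart_source _ c)
  have := (Measure.restrict_biUnion_congr (μ := μ) (ν := ν) hs
    (t := fun c : M => (chartAt (𝔼 n) c).source)).2 fun c _ => h c
  rwa [hsu, Measure.restrict_univ, Measure.restrict_univ] at this

/-- The ratio of the volume elements of two immersions. -/
def areaRatio (n : ℕ) {M : Type*} [TopologicalSpace M] [ChartedSpace (𝔼 n) M] (F F' : M → 𝔼 N)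
    (p : M) : ℝ := areaFactor (mder n F' p) / areaFactor (mder n F p)

/-- Numerator and denominator acquire the same factor `|det e|`, so the ratio can be read in any
chart and is therefore continuous. -/
lemma areaRatio_eq_chart (hF : IsSmoothImmersion n F) {F' : M → 𝔼 N} (hF' : Smooth n F')
    {c q : M} (hq : q ∈ (chartAt (𝔼 n) c).source) :
    areaRatio n F F' q = chartDensity n F' c (chartAt (𝔼 n) c q) /
      chartDensity n F c (chartAt (𝔼 n) c q) := by
  obtain ⟨e, he, -⟩ := exists_mder_eq hq
  have hdet : |(e : 𝔼 n →L[ℝ] 𝔼 n).det| ≠ 0 := abs_ne_zero.2 (LinearEquiv.isUnit_det' e.toLinearEquiv).ne_zero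
  rw [areaRatio, mder_eq_chart hq he (hF.sm.differentiableAt_chart hq),
    mder_eq_chart hq he (hF'.differentiableAt_chart hq), areaFactor_comp, areaFactor_comp,
    mul_div_mul_right _ _ hdet]
  rfl

lemma continuous_of_chart {Y : Type*} [TopologicalSpace Y] {u : M → Y}
    (h : ∀ c : M, ContinuousOn (u ∘ (chartAt (𝔼 n) c).symm) (chartAt (𝔼 n) c).target) :
    Continuous u := by
  rw [continuous_iff_continuousAt]
  intro p
  have h1 : ContinuousOn ((u ∘ (chartAt (𝔼 n) p).symm) ∘ chartAt (𝔼 n) p)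
      (chartAt (𝔼 n) p).source :=
    (h p).comp (chartAt (𝔼 n) p).continuousOn (chartAt (𝔼 n) p).mapsTo
  refine (h1.congr fun q hq => ?_).continuousAt
    ((chartAt (𝔼 n) p).open_source.mem_nhds (mem_chart_source _ p))
  simp [(chartAt (𝔼 n) p).left_inv hq]

lemma continuous_areaRatio (hF : IsSmoothImmersion n F) {F' : M → 𝔼 N} (hF' : Smooth n F') :
    Continuous (areaRatio n F F') := by
  refine continuous_of_chart (n := n) fun c => ?_
  refine ((continuousOn_chartDensity hF' c).div (continuousOn_chartDensity hF.sm c)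
    fun u hu => (chartDensity_pos hF hu).ne').congr fun u hu => ?_
  simp only [Function.comp_apply]
  rw [areaRatio_eq_chart hF hF' ((chartAt (𝔼 n) c).map_target hu), (chartAt (𝔼 n) c).right_inv hu]
  rfl

lemma areaRatio_nonneg (F F' : M → 𝔼 N) (p : M) : 0 ≤ areaRatio n F F' p :=
  div_nonneg (Real.sqrt_nonneg _) (Real.sqrt_nonneg _)

/-- This moves integrals over the varied surface to the fixed measure of `F`, where they can be
differentiated under the integral sign. -/
lemma inducedVolume_eq_withDensity (hF : IsSmoothImmersion n F) {F' : M → 𝔼 N}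
    (hF' : Smooth n F') : inducedVolume n F' =
      (inducedVolume n F).withDensity fun p => ENNReal.ofReal (areaRatio n F F' p) := by
  have hJ : Measurable fun p => ENNReal.ofReal (areaRatio n F F' p) :=
    (continuous_areaRatio hF hF').measurable.ennreal_ofReal
  refine measure_ext_chart (n := n) fun c => ?_
  have hso := (chartAt (𝔼 n) c).open_source.measurableSet
  rw [restrict_withDensity hso, inducedVolume_restrict_source hF',
    inducedVolume_restrict_source hF.sm]
  ext B hB
  rw [withDensity_apply _ hB, ← lintegral_indicator hB, ← lintegral_indicator_one hB,
    lintegral_chartVolume hF' c (measurable_one.indicator hB),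
    lintegral_chartVolume hF.sm c (hJ.indicator hB)]
  refine setLIntegral_congr_fun (chartAt (𝔼 n) c).open_target.measurableSet fun u hu => ?_
  by_cases h : (chartAt (𝔼 n) c).symm u ∈ B
  · simp only [indicator, h, if_true, Pi.one_apply, mul_one]
    rw [areaRatio_eq_chart hF hF' ((chartAt (𝔼 n) c).map_target hu),
      (chartAt (𝔼 n) c).right_inv hu, ← ENNReal.ofReal_mul (chartDensity_nonneg _ _ _),
      mul_div_cancel₀ _ (chartDensity_pos hF hu).ne']
  · simp [indicator, h]

lemma inducedVolume_lt_top_of_isCompact (hF : Smooth n F) {K : Set M} (hK : IsCompact K) :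
    inducedVolume n F K < ⊤ := by
  refine hK.measure_lt_top_of_nhdsWithin fun p _ => ?_
  have hp := (chartAt (𝔼 n) p).map_source (mem_chart_source (𝔼 n) p)
  obtain ⟨r, hr, hb⟩ := Metric.nhds_basis_closedBall.mem_iff.1
    ((chartAt (𝔼 n) p).open_target.mem_nhds hp)
  set S := (chartAt (𝔼 n) p).source ∩ chartAt (𝔼 n) p ⁻¹' Metric.ball (chartAt (𝔼 n) p p) r with hS
  have hSo : IsOpen S := (chartAt (𝔼 n) p).isOpen_inter_preimage Metric.isOpen_ball
  refine ⟨S, mem_nhdsWithin_of_mem_nhds (hSo.mem_nhds ⟨mem_chart_source _ p, Metric.mem_ball_self hr⟩), ?_⟩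
  rw [inducedVolume_apply hF hSo.measurableSet inter_subset_left, chartVolume_apply hF _ hSo.measurableSet]
  obtain ⟨C, hC⟩ := (isCompact_closedBall (chartAt (𝔼 n) p p) r).exists_bound_of_continuousOn
    ((continuousOn_chartDensity hF p).mono hb)
  have hsub : (chartAt (𝔼 n) p).target ∩ (chartAt (𝔼 n) p).symm ⁻¹' S
      ⊆ Metric.closedBall (chartAt (𝔼 n) p p) r := by
    rintro u ⟨hu, -, hu2⟩
    rw [mem_preimage, (chartAt (𝔼 n) p).right_inv hu] at hu2
    exact Metric.ball_subset_closedBall hu2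
  calc _ ≤ ∫⁻ u in Metric.closedBall (chartAt (𝔼 n) p p) r,
        ENNReal.ofReal (chartDensity n F p u) := lintegral_mono_set hsub
    _ ≤ ∫⁻ u in Metric.closedBall (chartAt (𝔼 n) p p) r, ENNReal.ofReal C := by
        refine setLIntegral_mono measurable_const fun u hu => ENNReal.ofReal_le_ofReal ?_
        exact (le_abs_self _).trans (hC u hu)
    _ < ⊤ := by
        rw [setLIntegral_const]
        exact ENNReal.mul_lt_top ENNReal.ofReal_lt_top (isCompact_closedBall _ _).measure_lt_top

/-- Integration in a chart. -/
lemma integral_inducedVolume_chart (hF : Smooth n F) (c : M) {g : M → ℝ} (hg : Measurable g)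
    (hs : ∀ p ∉ (chartAt (𝔼 n) c).source, g p = 0) :
    ∫ p, g p ∂(inducedVolume n F) = ∫ u in (chartAt (𝔼 n) c).target,
      chartDensity n F c u * g ((chartAt (𝔼 n) c).symm u) := by
  have h1 := aemeasurable_chart_symm (n := n) c
  have h2 := aemeasurable_chartDensity hF c
  rw [← setIntegral_eq_integral_of_forall_compl_eq_zero hs, inducedVolume_restrict_source hF,
    chartVolume, integral_map (h1.mono_ac (withDensity_absolutelyContinuous _ _))
      hg.aestronglyMeasurable]
  refine (integral_withDensity_eq_integral_toReal_smul₀ h2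
    (Filter.Eventually.of_forall fun _ => ENNReal.ofReal_lt_top) _).trans ?_
  refine integral_congr_ae (Filter.Eventually.of_forall fun u => ?_)
  simp only [smul_eq_mul, ENNReal.toReal_ofReal (chartDensity_nonneg F c u)]

end Volume

/-! ### Integration by parts against a Lipschitz function in Euclidean space -/

section EuclideanDivergence

open MeasureTheory Set

variable {n : ℕ}

/-- Integration by parts for a Lipschitz function and a compactly supported vector field. -/
lemma integral_mul_traceL_fderiv {C : NNReal} {f : 𝔼 n → ℝ} (hf : LipschitzWith C f)
    {η : 𝔼 n → 𝔼 n} (hη : ContDiff ℝ 1 η) (hc : HasCompactSupport η) :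
    ∫ u, f u * traceL _ (fderiv ℝ η u) = - ∫ u, fderiv ℝ f u (η u) := by
  have hηd : Differentiable ℝ η := hη.differentiable (by norm_num)
  set b := EuclideanSpace.basisFun (Fin n) ℝ with hb
  set g : Fin n → 𝔼 n → ℝ := fun i u => inner ℝ (b i) (η u) with hg
  have hgd : ∀ i, ContDiff ℝ 1 (g i) := fun i => contDiff_const.inner ℝ hη
  have hgc : ∀ i, HasCompactSupport (g i) := fun i =>
    hc.comp_left (g := fun v => inner ℝ (b i) v) (inner_zero_right _)
  have hgl : ∀ i, ∃ D, LipschitzWith D (g i) := fun i =>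
    (hgd i).lipschitzWith_of_hasCompactSupport (hgc i) (by norm_num)
  have hline : ∀ i u v, lineDeriv ℝ (g i) u v = inner ℝ (b i) (fderiv ℝ η u v) := by
    intro i u v
    have h1 : HasFDerivAt (g i) ((innerSL ℝ (b i)) ∘L fderiv ℝ η u) u :=
      (innerSL ℝ (b i)).hasFDerivAt.comp u (hηd u).hasFDerivAt
    rw [h1.hasLineDerivAt v |>.lineDeriv]; rfl
  -- Integration by parts is applied to each component of the field separately, in terms of line
  -- derivatives.
  have hpart : ∀ i, ∫ u, lineDeriv ℝ f u (b i) * g i u =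
      - ∫ u, f u * inner ℝ (b i) (fderiv ℝ η u (b i)) := by
    intro i
    obtain ⟨D, hD⟩ := hgl i
    rw [LipschitzWith.integral_lineDeriv_mul_eq hf hD (hgc i) (b i), ← integral_neg]
    refine integral_congr_ae (Filter.Eventually.of_forall fun u => ?_)
    simp only [hline, map_neg, inner_neg_right]; ring
  have hcont : Continuous (fderiv ℝ η) := hη.continuous_fderiv (by norm_num)
  have hI1 : ∀ i, Integrable (fun u => f u * inner ℝ (b i) (fderiv ℝ η u (b i))) := by
    intro i
    refine Continuous.integrable_of_hasCompactSupport
      (hf.continuous.mul (continuous_const.inner (hcont.clm_apply continuous_const))) ?_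
    refine (hc.fderiv (𝕜 := ℝ)).mono fun u hu => ?_
    contrapose! hu
    simp only [Function.mem_support, ne_eq, not_not] at hu ⊢
    simp [hu]
  have hI2 : ∀ i, Integrable (fun u => lineDeriv ℝ f u (b i) * g i u) := by
    intro i
    exact (hf.locallyIntegrable_lineDeriv (b i)).integrable_smul_right_of_hasCompactSupport
      (hgd i).continuous (hgc i)
  have e1 : ∀ u, f u * traceL _ (fderiv ℝ η u) = ∑ i, f u * inner ℝ (b i) (fderiv ℝ η u (b i)) := by
    intro u; rw [traceL_eq_sum b, Finset.mul_sum]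
  -- Rademacher's theorem: almost everywhere `f` is differentiable, so its line derivatives assemble
  -- into `fderiv`.
  have e2 : ∀ᵐ u, fderiv ℝ f u (η u) = ∑ i, lineDeriv ℝ f u (b i) * g i u := by
    filter_upwards [hf.ae_differentiableAt] with u hu
    conv_lhs => rw [← b.sum_repr' (η u), map_sum]
    refine Finset.sum_congr rfl fun i _ => ?_
    rw [map_smul, smul_eq_mul, mul_comm, hu.lineDeriv_eq_fderiv]
  rw [integral_congr_ae e2, integral_finsetSum _ fun i _ => hI2 i]
  simp_rw [e1]
  rw [integral_finsetSum _ fun i _ => hI1 i]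
  simp_rw [hpart]
  simp

end EuclideanDivergence

/-! ### Induced Lipschitz functions and the divergence in a chart -/

section LocalDivergence

open MeasureTheory Set

variable {n N : ℕ} {M : Type*} [TopologicalSpace M] [ChartedSpace (𝔼 n) M]
  [IsManifold (𝓡 n) ∞ M] {F : M → 𝔼 N}

/-- The induced distance is at most the length of a segment in a chart. -/
lemma inducedEDist_chart_le (hF : Smooth n F) (c : M) {u v : 𝔼 n}
    (hseg : segment ℝ u v ⊆ (chartAt (𝔼 n) c).target) {K : ℝ}
    (hK : ∀ w ∈ segment ℝ u v, ‖fderiv ℝ (F ∘ (chartAt (𝔼 n) c).symm) w (v - u)‖ ≤ K) :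
    inducedEDist n F ((chartAt (𝔼 n) c).symm u) ((chartAt (𝔼 n) c).symm v) ≤ ENNReal.ofReal K := by
  set l : ℝ → 𝔼 n := fun t => u + t • (v - u) with hl
  have hmem : ∀ t ∈ Icc (0:ℝ) 1, l t ∈ segment ℝ u v := by
    intro t ht
    rw [segment_eq_image']
    exact ⟨t, ht, rfl⟩
  have hld : ContDiff ℝ ∞ l := contDiff_const.add (contDiff_id.smul contDiff_const)
  unfold inducedEDist
  refine iInf_le_of_le ((chartAt (𝔼 n) c).symm ∘ l) (iInf_le_of_le ?_ (iInf_le_of_le ?_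
    (iInf_le_of_le ?_ ?_)))
  · have h1 : ContMDiffOn 𝓘(ℝ, 𝔼 n) (𝓡 n) 1 (chartAt (𝔼 n) c).symm (chartAt (𝔼 n) c).target :=
      (contMDiffOn_chart_symm (I := 𝓡 n) (n := ∞)).of_le (by simp)
    exact h1.comp (hld.contMDiff.contMDiffOn.of_le (by simp)) fun t ht => hseg (hmem t ht)
  · simp [hl]
  · simp [hl]
  · have hder : ∀ t ∈ Icc (0:ℝ) 1, derivWithin (F ∘ (chartAt (𝔼 n) c).symm ∘ l) (Icc 0 1) t =
        fderiv ℝ (F ∘ (chartAt (𝔼 n) c).symm) (l t) (v - u) := by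
      intro t ht
      have hlt := hseg (hmem t ht)
      have h1 := hF.differentiableAt_chart ((chartAt (𝔼 n) c).map_target hlt)
      rw [(chartAt (𝔼 n) c).right_inv hlt] at h1
      have h2 : HasDerivAt l (v - u) t := by
        have h3 : HasDerivAt l ((1:ℝ) • (v - u)) t :=
          ((hasDerivAt_id t).smul_const (v - u)).const_add u
        rwa [one_smul] at h3
      exact (h1.hasFDerivAt.comp_hasDerivAt t h2).hasDerivWithinAt.derivWithin
        (uniqueDiffOn_Icc zero_lt_one t ht)
    calc _ ≤ ∫⁻ t in Icc (0:ℝ) 1, ENNReal.ofReal K := by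
          refine setLIntegral_mono measurable_const fun t ht => ?_
          rw [hder t ht, ← ofReal_norm]
          exact ENNReal.ofReal_le_ofReal (hK _ (hmem t ht))
      _ = ENNReal.ofReal K := by simp

/-- `φ` is Lipschitz for the distance induced by `F`. -/
def IsInducedLipschitz (n : ℕ) {M : Type*} [TopologicalSpace M] [ChartedSpace (𝔼 n) M]
    (F : M → 𝔼 N) (L : ℝ) (φ : M → ℝ) : Prop :=
  ∀ p q, ENNReal.ofReal |φ p - φ q| ≤ ENNReal.ofReal L * inducedEDist n F p q

lemma IsInducedLipschitz.abs_sub_le_chart {L : ℝ} (hL : 0 ≤ L) {φ : M → ℝ} (hφ : IsInducedLipschitz n F L φ)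
    (hF : Smooth n F) (c : M) {u v : 𝔼 n}
    (hseg : segment ℝ u v ⊆ (chartAt (𝔼 n) c).target) {K : ℝ}
    (hK : ∀ w ∈ segment ℝ u v, ‖fderiv ℝ (F ∘ (chartAt (𝔼 n) c).symm) w (v - u)‖ ≤ K) :
    |φ ((chartAt (𝔼 n) c).symm u) - φ ((chartAt (𝔼 n) c).symm v)| ≤ L * K := by
  have hK0 : 0 ≤ K := (norm_nonneg _).trans (hK u (left_mem_segment ℝ u v))
  have h := (hφ _ _).trans (mul_le_mul_right (inducedEDist_chart_le hF c hseg hK) (ENNReal.ofReal L))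
  rw [← ENNReal.ofReal_mul hL] at h
  exact (ENNReal.ofReal_le_ofReal_iff (mul_nonneg hL hK0)).1 h

/-- The directional derivative is a limit of difference quotients along short segments, whose
induced length is at most `t` times nearly `‖dF w‖`. Where `f` is not differentiable, `fderiv` is
`0` and nothing is claimed. The map `f` only has to agree with the chart expression of `φ` on the
ball, so it can be a global extension. -/
lemma IsInducedLipschitz.abs_fderiv_le {L : ℝ} (hL : 0 ≤ L) {φ : M → ℝ}
    (hφ : IsInducedLipschitz n F L φ) (hF : Smooth n F) (c : M) {a : 𝔼 n} {r : ℝ}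
    (hb : Metric.ball a r ⊆ (chartAt (𝔼 n) c).target) {f : 𝔼 n → ℝ}
    (hf : EqOn (φ ∘ (chartAt (𝔼 n) c).symm) f (Metric.ball a r)) {u : 𝔼 n}
    (hu : u ∈ Metric.ball a r) (w : 𝔼 n) :
    |fderiv ℝ f u w| ≤ L * ‖fderiv ℝ (F ∘ (chartAt (𝔼 n) c).symm) u w‖ := by
  by_cases hd : DifferentiableAt ℝ f u
  swap
  · rw [fderiv_zero_of_not_differentiableAt hd]
    simp only [zero_apply, abs_zero]; positivity
  set A := fderiv ℝ (F ∘ (chartAt (𝔼 n) c).symm) with hA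
  have hAc : ContinuousAt A u :=
    ((hF.contDiffOn_chart c).continuousOn_fderiv_of_isOpen (chartAt (𝔼 n) c).open_target
      (by simp)).continuousAt ((chartAt (𝔼 n) c).open_target.mem_nhds (hb hu))
  have hlim : Filter.Tendsto (fun t : ℝ => t⁻¹ * |f (u + t • w) - f u|) (𝓝[>] 0)
      (𝓝 |fderiv ℝ f u w|) := by
    have h1 := (hd.hasFDerivAt.hasLineDerivAt w).tendsto_slope_zero_right
    refine h1.abs.congr' ?_
    filter_upwards [self_mem_nhdsWithin] with t ht
    rw [smul_eq_mul, abs_mul, abs_inv, abs_of_pos (show (0:ℝ) < t from ht)]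
  refine le_of_forall_pos_le_add fun ε hε => ?_
  -- The tolerance `ε / (L + 1)` costs at most `ε` after multiplication by `L`, and it is well
  -- defined for `L = 0`.
  obtain ⟨δ, hδ, hδ'⟩ : ∃ δ > 0, ∀ v ∈ Metric.ball u δ, v ∈ Metric.ball a r ∧ ‖A v w‖ < ‖A u w‖ + ε / (L + 1) := by
    have h1 : ∀ᶠ v in 𝓝 u, ‖A v w‖ < ‖A u w‖ + ε / (L + 1) := by
      have h2 : ContinuousAt (fun v => ‖A v w‖) u := (hAc.clm_apply continuousAt_const).norm
      exact h2.eventually_lt_const (by have : 0 < ε / (L + 1) := by positivity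
                                       linarith)
    have h3 : ∀ᶠ v in 𝓝 u, v ∈ Metric.ball a r := Metric.isOpen_ball.mem_nhds hu
    exact Metric.mem_nhds_iff.1 (h3.and h1)
  have hsmall : ∀ᶠ t in 𝓝[>] (0:ℝ), u + t • w ∈ Metric.ball u δ := by
    have h1 : Filter.Tendsto (fun t : ℝ => u + t • w) (𝓝 0) (𝓝 u) := by
      have : Continuous fun t : ℝ => u + t • w := by fun_prop
      simpa using this.tendsto 0
    exact (h1.eventually (Metric.ball_mem_nhds u hδ)).filter_mono nhdsWithin_le_nhds
  refine le_of_tendsto hlim ?_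
  filter_upwards [hsmall, self_mem_nhdsWithin] with t ht ht0
  have ht0 : (0:ℝ) < t := ht0
  have hsub : segment ℝ u (u + t • w) ⊆ Metric.ball u δ :=
    (convex_ball u δ).segment_subset (Metric.mem_ball_self hδ) ht
  have h1 := hφ.abs_sub_le_chart hL hF c (u := u) (v := u + t • w)
    (fun v hv => hb (hδ' v (hsub hv)).1) (K := t * (‖A u w‖ + ε / (L + 1))) (fun v hv => by
      have h2 := (hδ' v (hsub hv)).2
      rw [add_sub_cancel_left, map_smul, norm_smul, Real.norm_of_nonneg ht0.le]
      exact mul_le_mul_of_nonneg_left h2.le ht0.le)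
  have e1 := hf hu
  have e2 := hf (hδ' _ ht).1
  simp only [Function.comp_apply] at e1 e2
  rw [e1, e2, abs_sub_comm] at h1
  calc t⁻¹ * |f (u + t • w) - f u| ≤ t⁻¹ * (L * (t * (‖A u w‖ + ε / (L + 1)))) :=
        mul_le_mul_of_nonneg_left h1 (inv_nonneg.2 ht0.le)
    _ = L * ‖A u w‖ + L / (L + 1) * ε := by field_simp
    _ ≤ _ := by
        have : L / (L + 1) ≤ 1 := by rw [div_le_one (by positivity)]; linarith
        nlinarith

/-- A vector field in the chart whose Euclidean divergence is `√g` times the divergence of `W`. -/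
def chartField (n : ℕ) {M : Type*} [TopologicalSpace M] [ChartedSpace (𝔼 n) M]
    (F W : M → 𝔼 N) (c : M) (u : 𝔼 n) : 𝔼 n :=
  chartDensity n F c u • pinv (fderiv ℝ (F ∘ (chartAt (𝔼 n) c).symm) u)
    (W ((chartAt (𝔼 n) c).symm u))

lemma contDiffOn_chartDensity (hF : IsSmoothImmersion n F) (c : M) :
    ContDiffOn ℝ ∞ (chartDensity n F c) (chartAt (𝔼 n) c).target := by
  intro u hu
  have h1 := ((hF.sm.contDiffOn_chart c).fderiv_of_isOpen (m := ∞)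
    (chartAt (𝔼 n) c).open_target (by simp)) u hu
  have h3 := hF.fderiv_injective ((chartAt (𝔼 n) c).map_target hu)
  rw [(chartAt (𝔼 n) c).right_inv hu] at h3
  exact (contDiffAt_areaFactor h3).comp_contDiffWithinAt u h1

lemma contDiffOn_chart_pinv_apply (hF : IsSmoothImmersion n F) {W : M → 𝔼 N} (hW : Smooth n W) (c : M) :
    ContDiffOn ℝ ∞ (fun u => pinv (fderiv ℝ (F ∘ (chartAt (𝔼 n) c).symm) u)
      (W ((chartAt (𝔼 n) c).symm u))) (chartAt (𝔼 n) c).target := by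
  refine ContDiffOn.clm_apply (fun u hu => ?_) (hW.contDiffOn_chart c)
  have h1 := ((hF.sm.contDiffOn_chart c).fderiv_of_isOpen (m := ∞)
    (chartAt (𝔼 n) c).open_target (by simp)) u hu
  have h3 := hF.fderiv_injective ((chartAt (𝔼 n) c).map_target hu)
  rw [(chartAt (𝔼 n) c).right_inv hu] at h3
  exact (contDiffAt_pinv h3).comp_contDiffWithinAt u h1

lemma contDiffOn_chartField (hF : IsSmoothImmersion n F) {W : M → 𝔼 N} (hW : Smooth n W) (c : M) :
    ContDiffOn ℝ ∞ (chartField n F W c) (chartAt (𝔼 n) c).target :=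
  (contDiffOn_chartDensity hF c).smul (contDiffOn_chart_pinv_apply hF hW c)

/-- The divergence in a chart. -/
lemma traceL_fderiv_chartField (hF : IsSmoothImmersion n F) {W : M → 𝔼 N} (hW : Smooth n W)
    (hT : ∀ p, tder n F F p (W p) = W p) (c : M) {u : 𝔼 n} (hu : u ∈ (chartAt (𝔼 n) c).target) :
    traceL _ (fderiv ℝ (chartField n F W c) u) =
      chartDensity n F c u * traceL _ (tder n F W ((chartAt (𝔼 n) c).symm u)) := by
  set φ := chartAt (𝔼 n) c with hφ
  have hnhds : φ.target ∈ 𝓝 u := φ.open_target.mem_nhds hu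
  set f := F ∘ φ.symm with hf
  have hfa : ContDiffAt ℝ ∞ f u := (hF.sm.contDiffOn_chart c).contDiffAt hnhds
  have hsym : IsSymmSndFDerivAt ℝ f u := hfa.isSymmSndFDerivAt (by simpa using ENat.LEInfty.out)
  have hd2 : HasFDerivAt (fderiv ℝ f) (fderiv ℝ (fderiv ℝ f) u) u :=
    ((hfa.fderiv_right (m := 1) (by norm_cast)).differentiableAt (by norm_num)).hasFDerivAt
  have hinj := hF.fderiv_injective (φ.map_target hu)
  rw [← hφ, φ.right_inv hu] at hinj
  set v : 𝔼 n → 𝔼 n := fun u => pinv (fderiv ℝ f u) (W (φ.symm u)) with hv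
  have hvd : HasFDerivAt v (fderiv ℝ v u) u :=
    (((contDiffOn_chart_pinv_apply hF hW c).contDiffAt hnhds).differentiableAt (by simp)).hasFDerivAt
  -- Logarithmic derivative of `√g`: the trace of `A⁺ D²f` with `A = df`.
  have hρ : HasFDerivAt (chartDensity n F c) (chartDensity n F c u •
      (traceL (𝔼 n) ∘L ContinuousLinearMap.compL ℝ _ _ _ (pinv (fderiv ℝ f u)) ∘L
        fderiv ℝ (fderiv ℝ f) u)) u := by
    have h1 := (hasFDerivAt_areaFactor hinj).comp u hd2
    exact h1
  have hη : HasFDerivAt (chartField n F W c) _ u := hρ.smul hvd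
  -- A tangent field is `df(v)`, where `v` is its coordinate field in the chart.
  have hWv : (W ∘ φ.symm) =ᶠ[𝓝 u] fun u => fderiv ℝ f u (v u) := by
    filter_upwards [hnhds] with w hw
    have h1 := hT (φ.symm w)
    rw [tder_eq_chart hF hF.sm (φ.map_target hw), ← hφ, φ.right_inv hw] at h1
    exact h1.symm
  have hWd : HasFDerivAt (W ∘ φ.symm) _ u := (hd2.clm_apply hvd).congr_of_eventuallyEq hWv
  rw [hη.fderiv, tder_eq_chart hF hW (φ.map_target hu), ← hφ, φ.right_inv hu, hWd.fderiv,
    traceL_comp_comm]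
  -- Symmetry of `D²f` identifies the term from differentiating `df` in `W = df(v)` with the one
  -- from differentiating `√g`.
  have e1 : (fderiv ℝ (fderiv ℝ f) u).flip (v u) = fderiv ℝ (fderiv ℝ f) u (v u) := by
    ext1 ξ; exact hsym.eq ξ (v u)
  have e2 : pinv (fderiv ℝ f u) ∘L (fderiv ℝ f u ∘L fderiv ℝ v u) = fderiv ℝ v u := by
    rw [← ContinuousLinearMap.comp_assoc, pinv_comp_self hinj]; rfl
  rw [ContinuousLinearMap.comp_add, map_add, map_add, e1, e2, map_smul, traceL_smulRight]
  simp only [smul_apply, ContinuousLinearMap.comp_apply, smul_eq_mul,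
    ContinuousLinearMap.compL_apply]
  ring

end LocalDivergence

/-! ### Weak divergence inequality on the surface, by a partition of unity -/

section Divergence

open MeasureTheory Set

variable {n N : ℕ} {M : Type*} [TopologicalSpace M] [ChartedSpace (𝔼 n) M]
  [IsManifold (𝓡 n) ∞ M] {F : M → 𝔼 N}

/-- On a compact ball of the chart `dF` is bounded, so an induced Lipschitz function is Lipschitz in
coordinates and Rademacher's theorem becomes available. -/
lemma inducedLipschitz_lipschitzOnWith {L : ℝ} (hL : 0 ≤ L) {φ : M → ℝ}
    (hφ : IsInducedLipschitz n F L φ) (hF : Smooth n F) (c : M) {a : 𝔼 n} {r : ℝ}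
    (hb : Metric.closedBall a r ⊆ (chartAt (𝔼 n) c).target) :
    ∃ C, LipschitzOnWith C (φ ∘ (chartAt (𝔼 n) c).symm) (Metric.ball a r) := by
  obtain ⟨C, hC⟩ := (isCompact_closedBall a r).exists_bound_of_continuousOn
    (((hF.contDiffOn_chart c).continuousOn_fderiv_of_isOpen (chartAt (𝔼 n) c).open_target
      (by simp)).mono hb)
  refine ⟨(L * max C 0).toNNReal, LipschitzOnWith.of_dist_le_mul fun u hu v hv => ?_⟩
  have hseg : segment ℝ u v ⊆ Metric.closedBall a r :=
    ((convex_ball a r).segment_subset hu hv).trans Metric.ball_subset_closedBall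
  have h := hφ.abs_sub_le_chart hL hF c (hseg.trans hb) (K := max C 0 * ‖v - u‖) fun w hw => by
    refine (ContinuousLinearMap.le_opNorm _ _).trans ?_
    gcongr
    exact (hC w (hseg hw)).trans (le_max_left _ _)
  rw [Real.coe_toNNReal _ (mul_nonneg hL (le_max_right _ _)), Real.dist_eq, dist_comm, dist_eq_norm]
  exact h.trans (le_of_eq (mul_assoc _ _ _).symm)

variable [T2Space M] [MeasurableSpace M] [BorelSpace M] [SecondCountableTopology M]

lemma chartField_of_notMem {W : M → 𝔼 N} {c : M} {u : 𝔼 n}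
    (hu : W ((chartAt (𝔼 n) c).symm u) = 0) : chartField n F W c u = 0 := by
  rw [chartField, hu, map_zero, smul_zero]

/-- Inside one chart `∫ φ div W = -∫ dφ(W)`, and `|dφ(W)| ≤ L |W|` almost everywhere. The constant
does not depend on the chart, which allows the later summation. -/
lemma abs_integral_mul_divergence_le_of_chart (hF : IsSmoothImmersion n F) {φ : M → ℝ} {L : ℝ}
    (hL : 0 ≤ L) (hφ : IsInducedLipschitz n F L φ) (hφc : Continuous φ) {c : M} {a : 𝔼 n} {r : ℝ}
    (hb : Metric.closedBall a r ⊆ (chartAt (𝔼 n) c).target) {W : M → 𝔼 N} (hW : Smooth n W)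
    (hT : ∀ p, tder n F F p (W p) = W p)
    (hsupp : tsupport W ⊆ (chartAt (𝔼 n) c).source ∩ chartAt (𝔼 n) c ⁻¹' Metric.ball a r) :
    |∫ p, φ p * traceL _ (tder n F W p) ∂(inducedVolume n F)| ≤
      L * ∫ p, ‖W p‖ ∂(inducedVolume n F) := by
  set ψ := chartAt (𝔼 n) c with hψ
  obtain ⟨C, hC⟩ := inducedLipschitz_lipschitzOnWith hL hφ hF.sm c hb
  -- The Euclidean integration by parts needs a globally Lipschitz function. Values outside the ball
  -- do not matter, since `W` vanishes there.
  obtain ⟨f, hf, hfeq⟩ := hC.extend_real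
  have hbt : Metric.ball a r ⊆ ψ.target := Metric.ball_subset_closedBall.trans hb
  -- the compact set containing the support of the field in the chart
  have hKc : IsCompact (tsupport W) := by
    refine ((isCompact_closedBall a r).image_of_continuousOn
      (ψ.continuousOn_symm.mono hb)).of_isClosed_subset (isClosed_tsupport W) ?_
    intro p hp
    exact ⟨ψ p, Metric.ball_subset_closedBall (hsupp hp).2, ψ.left_inv (hsupp hp).1⟩
  set K := ψ '' tsupport W with hK
  have hKcomp : IsCompact K := hKc.image_of_continuousOn (ψ.continuousOn.mono fun p hp => (hsupp hp).1)
  have hKb : K ⊆ Metric.ball a r := by rintro _ ⟨p, hp, rfl⟩; exact (hsupp hp).2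
  set η : 𝔼 n → 𝔼 n := ψ.target.indicator (chartField n F W c) with hη
  have hη0 : ∀ u ∉ K, η u = 0 := by
    intro u hu
    by_cases ht : u ∈ ψ.target
    · rw [hη, indicator_of_mem ht]
      refine chartField_of_notMem ?_
      by_contra h
      exact hu ⟨ψ.symm u, subset_tsupport _ h, ψ.right_inv ht⟩
    · rw [hη, indicator_of_notMem ht]
  have hηt : ∀ u ∈ ψ.target, η =ᶠ[𝓝 u] chartField n F W c := fun u hu => by
    filter_upwards [ψ.open_target.mem_nhds hu] with w hw using indicator_of_mem hw _
  have hηs : ContDiff ℝ 1 η := by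
    rw [contDiff_iff_contDiffAt]
    intro u
    by_cases ht : u ∈ ψ.target
    · exact (((contDiffOn_chartField hF hW c).contDiffAt (ψ.open_target.mem_nhds ht)).of_le
        (by simp)).congr_of_eventuallyEq (hηt u ht)
    · have hu : u ∈ Kᶜ := fun h => ht (hbt (hKb h))
      have : η =ᶠ[𝓝 u] fun _ => 0 := by
        filter_upwards [hKcomp.isClosed.isOpen_compl.mem_nhds hu] with w hw using hη0 w hw
      exact contDiffAt_const.congr_of_eventuallyEq this
  have hηc : HasCompactSupport η := HasCompactSupport.intro hKcomp hη0
  have hdiv0 : ∀ u ∉ K, fderiv ℝ η u = 0 := by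
    intro u hu
    have : η =ᶠ[𝓝 u] fun _ => 0 := by
      filter_upwards [hKcomp.isClosed.isOpen_compl.mem_nhds hu] with w hw using hη0 w hw
    rw [this.fderiv_eq]; simp
  have hW0 : ∀ p ∉ ψ.source, tder n F W p = 0 := by
    intro p hp
    have hp' : p ∉ tsupport W := fun h => hp (hsupp h).1
    have h1 : W ∘ (chartAt (𝔼 n) p).symm =ᶠ[𝓝 (chartAt (𝔼 n) p p)] fun _ => 0 := by
      have h2 : W =ᶠ[𝓝 p] fun _ => 0 := notMem_tsupport_iff_eventuallyEq.1 hp'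
      have h3 := (chartAt (𝔼 n) p).continuousAt_symm ((chartAt (𝔼 n) p).map_source (mem_chart_source _ p))
      rw [ContinuousAt, chart_symm_self] at h3
      exact h3.eventually h2
    rw [tder, mder, h1.fderiv_eq]; simp
  have hdm : Continuous fun p => traceL _ (tder n F W p) :=
    (traceL _).continuous.comp (smooth_tder hF hW).continuous
  have hWp : ∀ p ∉ ψ.source, W p = 0 := fun p hp => by
    by_contra h; exact hp (hsupp (subset_tsupport _ h)).1
  have lhs : ∫ p, φ p * traceL _ (tder n F W p) ∂(inducedVolume n F) =
      ∫ u, f u * traceL _ (fderiv ℝ η u) := by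
    have hm : Continuous fun p => φ p * traceL _ (tder n F W p) := hφc.mul hdm
    rw [integral_inducedVolume_chart hF.sm c hm.measurable
      (fun p hp => by rw [hW0 p hp]; simp), ← integral_indicator ψ.open_target.measurableSet]
    refine integral_congr_ae (Filter.Eventually.of_forall fun u => ?_)
    by_cases ht : u ∈ ψ.target
    · simp only [indicator_of_mem ht]
      by_cases hu : u ∈ K
      · have h1 := hfeq (hKb hu)
        simp only [Function.comp_apply] at h1
        rw [(hηt u ht).fderiv_eq, traceL_fderiv_chartField hF hW hT c ht, ← h1]
        ring
      · have h1 : traceL _ (fderiv ℝ η u) = 0 := by rw [hdiv0 u hu, map_zero]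
        have h2 := h1
        rw [(hηt u ht).fderiv_eq, traceL_fderiv_chartField hF hW hT c ht] at h2
        rw [h1, mul_zero, mul_left_comm, h2, mul_zero]
    · simp only [indicator_of_notMem ht]
      rw [hdiv0 u fun h => ht (hbt (hKb h))]; simp
  have rhs : L * ∫ p, ‖W p‖ ∂(inducedVolume n F) =
      ∫ u, ψ.target.indicator (fun u => L * (chartDensity n F c u * ‖W (ψ.symm u)‖)) u := by
    rw [integral_indicator ψ.open_target.measurableSet, integral_const_mul,
      integral_inducedVolume_chart hF.sm c hW.continuous.norm.measurable
        (fun p hp => by rw [hWp p hp, norm_zero])]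
  rw [lhs, integral_mul_traceL_fderiv hf hηs hηc, abs_neg, rhs, ← Real.norm_eq_abs]
  refine norm_integral_le_of_norm_le ?_ (Filter.Eventually.of_forall fun u => ?_)
  · have hc0 : ContinuousOn (fun u => L * (chartDensity n F c u * ‖W (ψ.symm u)‖)) ψ.target :=
      continuousOn_const.mul ((continuousOn_chartDensity hF.sm c).mul
        ((hW.continuous.comp_continuousOn ψ.continuousOn_symm).norm))
    have h1 : IntegrableOn (fun u => L * (chartDensity n F c u * ‖W (ψ.symm u)‖)) K :=
      (hc0.mono (hKb.trans hbt)).integrableOn_compact hKcomp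
    refine (h1.integrable_indicator hKcomp.isClosed.measurableSet).congr
      (Filter.Eventually.of_forall fun u => ?_)
    by_cases hu : u ∈ K
    · simp only [indicator_of_mem hu, indicator_of_mem (hbt (hKb hu))]
    · rw [indicator_of_notMem hu]
      by_cases ht : u ∈ ψ.target
      · rw [indicator_of_mem ht]
        have : W (ψ.symm u) = 0 := by
          by_contra h
          exact hu ⟨ψ.symm u, subset_tsupport _ h, ψ.right_inv ht⟩
        simp [this]
      · rw [indicator_of_notMem ht]
  · by_cases hu : u ∈ K
    · have ht := hbt (hKb hu)
      rw [indicator_of_mem ht, Real.norm_eq_abs]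
      refine (hφ.abs_fderiv_le hL hF.sm c hbt hfeq (hKb hu) _).trans ?_
      have h1 : fderiv ℝ (F ∘ ψ.symm) u (η u) = chartDensity n F c u • W (ψ.symm u) := by
        rw [hη, indicator_of_mem ht, chartField, map_smul]
        congr 1
        have h2 := hT (ψ.symm u)
        rw [tder_eq_chart hF hF.sm (ψ.map_target ht), ← hψ, ψ.right_inv ht] at h2
        exact h2
      rw [h1, norm_smul, Real.norm_of_nonneg (chartDensity_nonneg _ _ _)]
    · rw [hη0 u hu, map_zero, norm_zero]
      refine indicator_nonneg (fun u _ => ?_) u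
      exact mul_nonneg hL (mul_nonneg (chartDensity_nonneg _ _ _) (norm_nonneg _))

lemma isFiniteMeasureOnCompacts_inducedVolume (hF : Smooth n F) :
    IsFiniteMeasureOnCompacts (inducedVolume n F) :=
  ⟨fun _ hK => inducedVolume_lt_top_of_isCompact hF hK⟩

/-- Weak form of the divergence theorem, for a compactly supported Lipschitz cutoff. -/
lemma abs_integral_mul_divergence_le (hF : IsSmoothImmersion n F) {φ : M → ℝ} {L : ℝ}
    (hL : 0 ≤ L) (hφ : IsInducedLipschitz n F L φ) (hφc : Continuous φ) (hφs : HasCompactSupport φ)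
    {W : M → 𝔼 N} (hW : Smooth n W) (hT : ∀ p, tder n F F p (W p) = W p)
    (hWi : Integrable (fun p => ‖W p‖) (inducedVolume n F)) :
    |∫ p, φ p * traceL _ (tder n F W p) ∂(inducedVolume n F)| ≤
      L * ∫ p, ‖W p‖ ∂(inducedVolume n F) := by
  have : IsFiniteMeasureOnCompacts (inducedVolume n F) :=
    isFiniteMeasureOnCompacts_inducedVolume hF.sm
  have : LocallyCompactSpace M := ChartedSpace.locallyCompactSpace (𝔼 n) M
  have hr : ∀ c : M, ∃ r > 0, Metric.closedBall (chartAt (𝔼 n) c c) r ⊆ (chartAt (𝔼 n) c).target :=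
    fun c => Metric.nhds_basis_closedBall.mem_iff.1 ((chartAt (𝔼 n) c).open_target.mem_nhds
      ((chartAt (𝔼 n) c).map_source (mem_chart_source _ c)))
  choose r hr0 hrb using hr
  set U : M → Set M := fun c => (chartAt (𝔼 n) c).source ∩
    chartAt (𝔼 n) c ⁻¹' Metric.ball (chartAt (𝔼 n) c c) (r c) with hU
  obtain ⟨ρ, hρ⟩ := SmoothPartitionOfUnity.exists_isSubordinate (𝓡 n) (isClosed_univ (X := M)) U
    (fun c => (chartAt (𝔼 n) c).isOpen_inter_preimage Metric.isOpen_ball)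
    (fun c _ => mem_iUnion.2 ⟨c, mem_chart_source _ c, Metric.mem_ball_self (hr0 c)⟩)
  have hfin := ρ.locallyFinite.finite_nonempty_inter_compact hφs
  set J := hfin.toFinset with hJ
  have hsum : ∀ p ∈ tsupport φ, ∑ j ∈ J, ρ j p = 1 := by
    intro p hp
    have h1 := ρ.sum_eq_one (mem_univ p)
    rw [← h1, finsum_eq_sum_of_support_subset]
    intro j hj
    rw [hJ, Finset.mem_coe, Set.Finite.mem_toFinset]
    exact ⟨p, hj, hp⟩
  have hρs : ∀ j, Smooth n (fun p => ρ j p) := fun j => (ρ j).contMDiff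
  have hρW : ∀ j, Smooth n (fun p => ρ j p • W p) := fun j => (hρs j).smul hW
  have hρT : ∀ j p, tder n F F p (ρ j p • W p) = ρ j p • W p := fun j p => by
    rw [map_smul, hT]
  have hloc : ∀ j, |∫ p, φ p * traceL _ (tder n F (fun p => ρ j p • W p) p) ∂(inducedVolume n F)| ≤
      L * ∫ p, ‖ρ j p • W p‖ ∂(inducedVolume n F) := fun j =>
    abs_integral_mul_divergence_le_of_chart hF hL hφ hφc (hrb j) (hρW j) (hρT j)
      ((tsupport_smul_subset_left _ _).trans (hρ j))
  have hsplit : ∀ p, φ p * traceL _ (tder n F W p) =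
      ∑ j ∈ J, φ p * traceL _ (tder n F (fun p => ρ j p • W p) p) := by
    intro p
    by_cases hp : φ p = 0
    · simp [hp]
    have hpo : {q | φ q ≠ 0} ∈ 𝓝 p := (isOpen_ne_fun hφc continuous_const).mem_nhds hp
    have h1 : ∀ j ξ, tder n F (fun p => ρ j p • W p) p ξ =
        ρ j p • tder n F W p ξ + tder n F (fun q => ρ j q) p ξ • W p := fun j ξ =>
      (hρs j).tder_smul hW p ξ
    -- On the open set `φ ≠ 0` the finite sum of the `ρ j` is constantly `1`, so the derivative
    -- terms in the product rule add up to zero.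
    have h2 : ∑ j ∈ J, tder n F (fun q => ρ j q) p = 0 := by
      have h3 : ∑ j ∈ J, mder n (fun q => ρ j q) p = 0 := by
        have h4 : HasFDerivAt (fun u => ∑ j ∈ J, ((fun q => ρ j q) ∘ (chartAt (𝔼 n) p).symm) u)
          (∑ j ∈ J, mder n (fun q => ρ j q) p) (chartAt (𝔼 n) p p) :=
          HasFDerivAt.fun_sum fun j _ => (hρs j).hasFDerivAt p
        have h5 : (fun u => ∑ j ∈ J, ((fun q => ρ j q) ∘ (chartAt (𝔼 n) p).symm) u)
            =ᶠ[𝓝 (chartAt (𝔼 n) p p)] fun _ => 1 := by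
          have h3 := (chartAt (𝔼 n) p).continuousAt_symm
            ((chartAt (𝔼 n) p).map_source (mem_chart_source _ p))
          rw [ContinuousAt, chart_symm_self] at h3
          filter_upwards [h3.eventually hpo] with u hu
          exact hsum _ (subset_tsupport _ hu)
        exact (h4.congr_of_eventuallyEq h5.symm).unique (hasFDerivAt_const _ _)
      ext1 ξ
      have h6 := congrArg (fun A : 𝔼 n →L[ℝ] ℝ => A (pinv (mder n F p) ξ)) h3
      simpa [tder] using h6
    have h7 : ∑ j ∈ J, tder n F (fun p => ρ j p • W p) p = tder n F W p := by
      ext1 ξ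
      have h8 := congrArg (fun A : 𝔼 N →L[ℝ] ℝ => A ξ) h2
      simp only [sum_apply, zero_apply] at h8
      rw [sum_apply]
      simp_rw [h1]
      rw [Finset.sum_add_distrib, ← Finset.sum_smul, ← Finset.sum_smul, h8,
        hsum p (subset_tsupport _ hp), one_smul, zero_smul, add_zero]
    rw [← Finset.mul_sum, ← map_sum, h7]
  have hint1 : ∀ j ∈ J, Integrable
      (fun p => φ p * traceL _ (tder n F (fun p => ρ j p • W p) p)) (inducedVolume n F) := fun j _ =>
    (hφc.mul ((traceL _).continuous.comp (smooth_tder hF (hρW j)).continuous)).integrable_of_hasCompactSupport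
      hφs.mul_right
  have hint2 : ∀ j, Integrable (fun p => ‖ρ j p • W p‖) (inducedVolume n F) := fun j => by
    refine hWi.mono' ((hρW j).continuous.norm.aestronglyMeasurable) (Filter.Eventually.of_forall fun p => ?_)
    rw [norm_norm, norm_smul, Real.norm_of_nonneg (ρ.nonneg j p)]
    exact mul_le_of_le_one_left (norm_nonneg _) (ρ.le_one j p)
  calc |∫ p, φ p * traceL _ (tder n F W p) ∂(inducedVolume n F)|
      = |∑ j ∈ J, ∫ p, φ p * traceL _ (tder n F (fun p => ρ j p • W p) p) ∂(inducedVolume n F)| := by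
        rw [← integral_finsetSum _ hint1]; simp_rw [hsplit]
    _ ≤ ∑ j ∈ J, L * ∫ p, ‖ρ j p • W p‖ ∂(inducedVolume n F) :=
        (Finset.abs_sum_le_sum_abs _ _).trans (Finset.sum_le_sum fun j _ => hloc j)
    _ = L * ∫ p, ∑ j ∈ J, ‖ρ j p • W p‖ ∂(inducedVolume n F) := by
        rw [← Finset.mul_sum, integral_finsetSum _ fun j _ => hint2 j]
    _ ≤ _ := by
        refine mul_le_mul_of_nonneg_left (integral_mono (integrable_finsetSum _ fun j _ => hint2 j)
          hWi fun p => ?_) hL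
        simp only
        have h1 : ∀ j, ‖ρ j p • W p‖ = ρ j p * ‖W p‖ := fun j => by
          rw [norm_smul, Real.norm_of_nonneg (ρ.nonneg j p)]
        simp_rw [h1]
        rw [← Finset.sum_mul]
        -- The `ρ j` are nonnegative with sum at most `1`, so adding up the local estimates loses
        -- nothing in the constant.
        refine mul_le_of_le_one_left (norm_nonneg _) ?_
        refine le_trans ?_ (ρ.sum_le_one p)
        classical
        rw [finsum_eq_sum_of_support_subset (s := J ∪ (ρ.finsupport p)) _ (by
          intro j hj
          rw [Finset.coe_union, ρ.coe_finsupport]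
          exact Or.inr hj)]
        exact Finset.sum_le_sum_of_subset_of_nonneg Finset.subset_union_left fun j _ _ => ρ.nonneg j p

end Divergence

/-! ### The induced distance as a Riemannian distance -/

section Distance

open MeasureTheory Set Bundle

variable {n N : ℕ} {M : Type*} [TopologicalSpace M] [ChartedSpace (𝔼 n) M]
  [IsManifold (𝓡 n) ∞ M] {F : M → 𝔼 N}

/-- The pull-back `⟨A v, A w⟩` of the inner product by a linear map. -/
def metricForm (A : 𝔼 n →L[ℝ] 𝔼 N) : 𝔼 n →L[ℝ] 𝔼 n →L[ℝ] ℝ :=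
  (innerSL ℝ).bilinearComp A A

lemma metricForm_apply (A : 𝔼 n →L[ℝ] 𝔼 N) (v w : 𝔼 n) :
    metricForm A v w = inner ℝ (A v) (A w) := rfl

lemma isVonNBounded_metricForm {A : 𝔼 n →L[ℝ] 𝔼 N} (hA : Function.Injective A) :
    Bornology.IsVonNBounded ℝ {v : 𝔼 n | metricForm A v v < 1} := by
  rw [NormedSpace.isVonNBounded_iff, isBounded_iff_forall_norm_le]
  refine ⟨‖pinv A‖, fun v hv => ?_⟩
  have h1 : ‖A v‖ ≤ 1 := by
    have : ‖A v‖ ^ 2 < 1 := by rw [← real_inner_self_eq_norm_sq]; exact hv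
    nlinarith [norm_nonneg (A v)]
  calc ‖v‖ = ‖pinv A (A v)‖ := by rw [pinv_apply_self hA]
    _ ≤ ‖pinv A‖ * ‖A v‖ := (pinv A).le_opNorm _
    _ ≤ ‖pinv A‖ := mul_le_of_le_one_right (norm_nonneg _) h1

lemma continuous_metricForm : Continuous (metricForm : (𝔼 n →L[ℝ] 𝔼 N) → _) := by
  have : (metricForm : (𝔼 n →L[ℝ] 𝔼 N) → _) = fun A =>
      (ContinuousLinearMap.compL ℝ (𝔼 n) (𝔼 N) ℝ).flip A ∘L (innerSL ℝ ∘L A) := by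
    ext A v w; rfl
  rw [this]
  fun_prop

def inducedForm (F : M → 𝔼 N) (p : M) :
    TangentSpace (𝓡 n) p →L[ℝ] TangentSpace (𝓡 n) p →L[ℝ] ℝ :=
  (metricForm (mder n F p) : 𝔼 n →L[ℝ] 𝔼 n →L[ℝ] ℝ)

lemma inducedForm_apply (F : M → 𝔼 N) (p : M) (v w : TangentSpace (𝓡 n) p) :
    inducedForm F p v w = inner ℝ (mder n F p v) (mder n F p w) := rfl

/-- In the trivialization at `c` the metric is the pull-back by the derivative in the fixed chart at
`c`, whose continuity is known. The trivialization contributes the derivative of the transition map,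
which `mder_eq_chart` cancels. -/
lemma inCoordinates_inducedForm (hF : Smooth n F) {c q : M} (hq : q ∈ (chartAt (𝔼 n) c).source) :
    ContinuousLinearMap.inCoordinates (𝔼 n) (TangentSpace (𝓡 n) (M := M)) (𝔼 n →L[ℝ] ℝ)
      (fun p : M => TangentSpace (𝓡 n) p →L[ℝ] ℝ) c q c q (inducedForm F q) =
      metricForm (fderiv ℝ (F ∘ (chartAt (𝔼 n) c).symm) (chartAt (𝔼 n) c q)) := by
  have hb : q ∈ (trivializationAt (𝔼 n) (TangentSpace (𝓡 n) (M := M)) c).baseSet := by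
    simpa using hq
  have hs : ∀ v : 𝔼 n, mder n F q ((trivializationAt (𝔼 n) (TangentSpace (𝓡 n)) c).symm q v) =
      fderiv ℝ (F ∘ (chartAt (𝔼 n) c).symm) (chartAt (𝔼 n) c q) v := by
    intro v
    obtain ⟨e, he, he'⟩ := exists_mder_eq hq
    have h1 := congrArg (fun L : 𝔼 n →L[ℝ] TangentSpace (𝓡 n) q => L v)
      (TangentBundle.symmL_trivializationAt_eq_core (I := 𝓡 n) (𝕜 := ℝ) hq)
    have h2 : (trivializationAt (𝔼 n) (TangentSpace (𝓡 n)) c).symm q v = e.symm v := by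
      rw [← Bundle.Trivialization.symmL_apply (R := ℝ) _ hb]
      refine h1.trans ?_
      rw [tangentBundleCore_coordChange_achart]
      have h3 : fderivWithin ℝ (extChartAt (𝓡 n) q ∘ (extChartAt (𝓡 n) c).symm) (range (𝓡 n))
          (extChartAt (𝓡 n) c q) = (e.symm : 𝔼 n →L[ℝ] 𝔼 n) := by
        simp only [mfld_simps, fderivWithin_univ]
        exact he'.fderiv
      rw [h3]
      rfl
    rw [h2, mder_eq_chart hq he (hF.differentiableAt_chart hq)]
    simp
  ext v w : 2
  rw [inCoordinates_apply_eq₂ (E₃ := fun _ : M => ℝ) hb hb (by simp)]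
  simp [inducedForm_apply, metricForm_apply, hs]

lemma continuous_inducedForm (hF : Smooth n F) :
    Continuous (fun p : M => TotalSpace.mk' (𝔼 n →L[ℝ] 𝔼 n →L[ℝ] ℝ)
      (E := fun p : M => TangentSpace (𝓡 n) p →L[ℝ] TangentSpace (𝓡 n) p →L[ℝ] ℝ)
      p (inducedForm F p)) := by
  rw [continuous_iff_continuousAt]
  intro c
  rw [FiberBundle.continuousAt_totalSpace]
  refine ⟨continuousAt_id, ?_⟩
  have h1 : ContinuousOn (fderiv ℝ (F ∘ (chartAt (𝔼 n) c).symm)) (chartAt (𝔼 n) c).target :=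
    (hF.contDiffOn_chart c).continuousOn_fderiv_of_isOpen (chartAt (𝔼 n) c).open_target (by simp)
  have h2 : ContinuousAt (fun q => fderiv ℝ (F ∘ (chartAt (𝔼 n) c).symm) (chartAt (𝔼 n) c q)) c :=
    ContinuousAt.comp (g := fderiv ℝ (F ∘ (chartAt (𝔼 n) c).symm))
      (h1.continuousAt ((chartAt (𝔼 n) c).open_target.mem_nhds (mem_chart_target _ c)))
      ((chartAt (𝔼 n) c).continuousAt (mem_chart_source _ c))
  refine (continuous_metricForm.continuousAt.comp h2).congr ?_
  filter_upwards [(chartAt (𝔼 n) c).open_source.mem_nhds (mem_chart_source _ c)] with q hq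
  exact (inCoordinates_inducedForm hF hq).symm

/-- The Riemannian metric induced by an immersion. -/
def inducedMetric (hF : IsSmoothImmersion n F) :
    ContinuousRiemannianMetric (𝔼 n) (fun p : M => TangentSpace (𝓡 n) p) where
  inner := inducedForm F
  symm p v w := real_inner_comm (mder n F p w) (mder n F p v)
  pos p v hv := by
    rw [inducedForm_apply, real_inner_self_pos]
    intro h
    exact hv (hF.mder_injective p (h.trans (map_zero _).symm))
  isVonNBounded p := isVonNBounded_metricForm (hF.mder_injective p)
  continuous := continuous_inducedForm hF.sm

lemma mder_mfderivWithin (hF : Smooth n F) {γ : ℝ → M}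
    (hγ : ContMDiffOn 𝓘(ℝ, ℝ) (𝓡 n) 1 γ (Icc 0 1)) {t : ℝ} (ht : t ∈ Icc (0:ℝ) 1) :
    mder n F (γ t) (mfderivWithin 𝓘(ℝ, ℝ) (𝓡 n) γ (Icc 0 1) t (1:ℝ)) =
      derivWithin (F ∘ γ) (Icc 0 1) t := by
  have h1 := mfderiv_comp_mfderivWithin (I := 𝓘(ℝ, ℝ)) (I' := 𝓡 n) (I'' := 𝓘(ℝ, 𝔼 N)) t
    ((hF (γ t)).mdifferentiableAt (by simp)) (hγ.mdifferentiableOn (by simp) t ht)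
    (uniqueDiffOn_Icc zero_lt_one t ht).uniqueMDiffWithinAt
  rw [mfderivWithin_eq_fderivWithin] at h1
  rw [← fderivWithin_derivWithin]
  have h2 := congrArg (fun L : ℝ →L[ℝ] 𝔼 N => L 1) h1
  refine Eq.trans ?_ h2.symm
  rw [← diff_eq_mder hF]
  rfl

variable [T2Space M]

/-- The distance of the induced metric, as an extended pseudo-metric space structure. -/
@[reducible] def inducedPseudoEMetricSpace (hF : IsSmoothImmersion n F) : PseudoEMetricSpace M :=
  letI : RiemannianBundle (fun p : M => TangentSpace (𝓡 n) p) :=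
    ⟨(inducedMetric hF).toRiemannianMetric⟩
  haveI : LocallyCompactSpace M := ChartedSpace.locallyCompactSpace (𝔼 n) M
  haveI : IsManifold (𝓡 n) 1 M := .of_le (n := ∞) (by simp)
  PseudoEMetricSpace.ofRiemannianMetric (𝓡 n) M

lemma pathELength_inducedMetric (hF : IsSmoothImmersion n F) {γ : ℝ → M}
    (hγ : ContMDiffOn 𝓘(ℝ, ℝ) (𝓡 n) 1 γ (Icc 0 1)) :
    letI : RiemannianBundle (fun p : M => TangentSpace (𝓡 n) p) :=
      ⟨(inducedMetric hF).toRiemannianMetric⟩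
    Manifold.pathELength (𝓡 n) γ 0 1 =
      ∫⁻ t in Icc (0 : ℝ) 1, ‖derivWithin (F ∘ γ) (Icc 0 1) t‖ₑ := by
  let : RiemannianBundle (fun p : M => TangentSpace (𝓡 n) p) :=
      ⟨(inducedMetric hF).toRiemannianMetric⟩
  rw [Manifold.pathELength_eq_lintegral_mfderivWithin_Icc]
  refine setLIntegral_congr_fun measurableSet_Icc fun t ht => ?_
  have h : ∀ v : TangentSpace (𝓡 n) (γ t), ‖v‖ₑ = ‖mder n F (γ t) v‖ₑ := by
    intro v
    rw [← ofReal_norm, ← ofReal_norm, norm_eq_sqrt_real_inner, norm_eq_sqrt_real_inner]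
    rfl
  simp only [h]
  congr 1
  exact mder_mfderivWithin hF.sm hγ ht

/-- Both are infima of the same lengths over the same `C¹` curves. The identification makes metric
arguments available with the original topology of `M`. -/
lemma edist_inducedPseudoEMetricSpace (hF : IsSmoothImmersion n F) (p q : M) :
    (inducedPseudoEMetricSpace hF).edist p q = inducedEDist n F p q := by
  let : RiemannianBundle (fun p : M => TangentSpace (𝓡 n) p) :=
    ⟨(inducedMetric hF).toRiemannianMetric⟩
  change Manifold.riemannianEDist (𝓡 n) p q = _
  refine le_antisymm ?_ ?_
  · refine le_iInf fun γ => le_iInf fun hγ => le_iInf fun h0 => le_iInf fun h1 => ?_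
    rw [← pathELength_inducedMetric hF hγ]
    exact Manifold.riemannianEDist_le_pathELength hγ h0 h1 zero_le_one
  · refine le_of_forall_gt fun r hr => ?_
    obtain ⟨γ, h0, h1, hγ, hl⟩ := Manifold.exists_lt_of_riemannianEDist_lt hr
    rw [pathELength_inducedMetric hF hγ] at hl
    refine lt_of_le_of_lt ?_ hl
    exact iInf_le_of_le γ (iInf_le_of_le hγ (iInf_le_of_le h0 (iInf_le _ h1)))

/-- The length-space property. An almost minimizing curve is cut at a time when its distance from
`p` equals `a`, which exists by the intermediate value theorem; the remaining piece has length less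
than `b`. -/
lemma exists_intermediate_point (hF : IsSmoothImmersion n F) {p q : M} {a b : ENNReal}
    (h : inducedEDist n F p q < a + b) (hb : 0 < b) :
    ∃ z, inducedEDist n F p z ≤ a ∧ inducedEDist n F z q < b := by
  let : RiemannianBundle (fun p : M => TangentSpace (𝓡 n) p) :=
    ⟨(inducedMetric hF).toRiemannianMetric⟩
  let := inducedPseudoEMetricSpace hF
  simp only [← edist_inducedPseudoEMetricSpace hF] at h ⊢
  change edist p q < _ at h
  change ∃ z, edist p z ≤ a ∧ edist z q < b
  by_cases hqa : edist p q ≤ a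
  · exact ⟨q, hqa, by simpa using hb⟩
  push Not at hqa
  obtain ⟨γ, h0, h1, hγ, hl⟩ := Manifold.exists_lt_of_riemannianEDist_lt (I := 𝓡 n) h
  have hc : ContinuousOn (fun t => edist p (γ t)) (Icc 0 1) :=
    continuous_edist.comp_continuousOn (continuousOn_const.prodMk hγ.continuousOn)
  have hiv := intermediate_value_Icc zero_le_one hc
  obtain ⟨t, ht, hta⟩ := hiv (show a ∈ _ by simp [h0, h1, hqa.le])
  refine ⟨γ t, hta.le, ?_⟩
  have e1 : edist p (γ t) ≤ Manifold.pathELength (𝓡 n) γ 0 t :=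
    Manifold.riemannianEDist_le_pathELength (hγ.mono (Icc_subset_Icc_right ht.2)) h0 rfl ht.1
  have e2 : edist (γ t) q ≤ Manifold.pathELength (𝓡 n) γ t 1 :=
    Manifold.riemannianEDist_le_pathELength (hγ.mono (Icc_subset_Icc_left ht.1)) rfl h1 ht.2
  rw [← Manifold.pathELength_add ht.1 ht.2] at hl
  have hta' : edist p (γ t) = a := hta
  rw [hta'] at e1
  by_contra hcon
  push Not at hcon
  exact absurd hl (not_lt.2 (add_le_add e1 (hcon.trans e2)))

end Distance

/-! ### Hopf-Rinow for length spaces, and a proper Lipschitz function -/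

section HopfRinow

open Set

variable {Y : Type*} [PseudoEMetricSpace Y] [CompleteSpace Y]

/-- The set of radii with compact balls is closed from below: by the length property the ball of
radius `r` lies in a small neighbourhood of a slightly smaller, compact one, so it is totally
bounded, and completeness finishes. -/
lemma isCompact_closedEBall_of_lt
    (hlen : ∀ (x y : Y) (a b : ENNReal), edist x y < a + b → 0 < b →
      ∃ z, edist x z ≤ a ∧ edist z y < b) (c : Y) {r : NNReal}
    (h : ∀ r' < r, IsCompact (Metric.closedEBall c (r' : ENNReal))) :
    IsCompact (Metric.closedEBall c (r : ENNReal)) := by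
  refine isCompact_iff_totallyBounded_isComplete.2 ⟨?_, Metric.isClosed_closedEBall.isComplete⟩
  rw [EMetric.totallyBounded_iff]
  intro δ hδ
  obtain ⟨e, he0, heδ⟩ := ENNReal.lt_iff_exists_nnreal_btwn.1 hδ
  have he0 : 0 < e := by exact_mod_cast he0
  -- For a radius below the required precision the centre alone is a net; otherwise subtracting `e /
  -- 3` from `r` makes sense.
  by_cases hre : r < e
  · refine ⟨{c}, finite_singleton c, fun y hy => ?_⟩
    simp only [mem_singleton_iff, iUnion_iUnion_eq_left, Metric.mem_eball]
    exact (Metric.mem_closedEBall.1 hy).trans_lt ((ENNReal.coe_lt_coe.2 hre).trans heδ)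
  push Not at hre
  have hr0 : 0 < r := he0.trans_le hre
  -- An `e/3`-net of the ball of radius `r - e/3`; points of the large ball are closer than `2e/3`
  -- to that ball, so the net has precision `e` for them.
  obtain ⟨t, ht, hcov⟩ := EMetric.totallyBounded_iff.1
    (h (r - e / 3) (tsub_lt_self hr0 (by positivity))).totallyBounded (e / 3 : NNReal)
    (by exact_mod_cast (by positivity : 0 < e / 3))
  refine ⟨t, ht, fun y hy => ?_⟩
  have hy' : edist c y < ((r - e / 3 : NNReal) : ENNReal) + ((2 * e / 3 : NNReal) : ENNReal) := by
    rw [edist_comm]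
    refine (Metric.mem_closedEBall.1 hy).trans_lt ?_
    rw [← ENNReal.coe_add, ENNReal.coe_lt_coe]
    have h3 : e / 3 ≤ r := le_trans (by
      rw [← NNReal.coe_le_coe]; push_cast; linarith [e.2, (NNReal.coe_nonneg e)]) hre
    rw [← NNReal.coe_lt_coe]
    push_cast [NNReal.coe_sub h3]
    have : (0:ℝ) < e := he0
    linarith
  obtain ⟨z, hz1, hz2⟩ := hlen c y _ _ hy' (by exact_mod_cast (by positivity : 0 < 2 * e / 3))
  have hz := hcov (show z ∈ _ from Metric.mem_closedEBall'.2 hz1)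
  simp only [mem_iUnion, Metric.mem_eball, exists_prop] at hz ⊢
  obtain ⟨w, hw, hzw⟩ := hz
  refine ⟨w, hw, ?_⟩
  calc edist y w ≤ edist z y + edist z w := edist_triangle_left _ _ _
    _ < ((2 * e / 3 : NNReal) : ENNReal) + ((e / 3 : NNReal) : ENNReal) :=
      ENNReal.add_lt_add hz2 hzw
    _ = e := by
      rw [← ENNReal.coe_add, ENNReal.coe_inj, ← NNReal.coe_inj]
      push_cast; ring
    _ ≤ δ := heδ.le

/-- The set of radii is open above: a compact neighbourhood of the ball contains a `δ`-thickening,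
and by the length property the ball of radius `r + δ/2` lies inside the thickening. -/
lemma exists_isCompact_closedEBall_gt [LocallyCompactSpace Y]
    (hlen : ∀ (x y : Y) (a b : ENNReal), edist x y < a + b → 0 < b →
      ∃ z, edist x z ≤ a ∧ edist z y < b) (c : Y) {r : NNReal}
    (h : IsCompact (Metric.closedEBall c (r : ENNReal))) :
    ∃ r' > r, IsCompact (Metric.closedEBall c (r' : ENNReal)) := by
  obtain ⟨K, hK, hKi⟩ := exists_compact_superset h
  obtain ⟨δ, hδ, hsub⟩ := h.exists_thickening_subset_open isOpen_interior hKi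
  refine ⟨r + (δ / 2).toNNReal, ?_, hK.of_isClosed_subset Metric.isClosed_closedEBall ?_⟩
  · rw [gt_iff_lt, ← NNReal.coe_lt_coe]; push_cast
    rw [Real.coe_toNNReal _ (by positivity)]
    linarith
  · intro y hy
    refine interior_subset (hsub ?_)
    have h1 : edist c y < (r : ENNReal) + ENNReal.ofReal δ := by
      rw [edist_comm]
      refine (Metric.mem_closedEBall.1 hy).trans_lt ?_
      rw [ENNReal.coe_add]
      refine ENNReal.add_lt_add_left ENNReal.coe_ne_top ?_
      rw [ENNReal.ofReal, ENNReal.coe_lt_coe, ← NNReal.coe_lt_coe, Real.coe_toNNReal _ hδ.le,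
        Real.coe_toNNReal _ (by positivity)]
      linarith
    obtain ⟨z, hz1, hz2⟩ := hlen c y _ _ h1 (by simpa using hδ)
    rw [Metric.mem_thickening_iff_exists_edist_lt]
    exact ⟨z, Metric.mem_closedEBall'.2 hz1, by rwa [edist_comm]⟩

/-- A continuity argument on the radius: were the set of radii with compact balls bounded, its
supremum would belong to it and could still be enlarged. -/
lemma isCompact_closedEBall [LocallyCompactSpace Y]
    (hlen : ∀ (x y : Y) (a b : ENNReal), edist x y < a + b → 0 < b →
      ∃ z, edist x z ≤ a ∧ edist z y < b) (c : Y) (r : NNReal) :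
    IsCompact (Metric.closedEBall c (r : ENNReal)) := by
  by_contra hr
  set S : Set NNReal := {s | IsCompact (Metric.closedEBall c (s : ENNReal))} with hS
  have hmono : ∀ s ∈ S, ∀ s' ≤ s, s' ∈ S := fun s hs s' hss =>
    IsCompact.of_isClosed_subset hs Metric.isClosed_closedEBall
      (Metric.closedEBall_subset_closedEBall (by exact_mod_cast hss))
  have hbdd : BddAbove S := ⟨r, fun s hs => by
    by_contra h
    exact hr (hmono s hs r (not_le.1 h).le)⟩
  -- At radius `0` the condition on smaller radii is vacuous.
  have hne : S.Nonempty := ⟨0, isCompact_closedEBall_of_lt hlen c fun r' hr' => by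
    simp at hr'⟩
  have hsup : sSup S ∈ S := isCompact_closedEBall_of_lt hlen c fun r' hr' => by
    obtain ⟨s, hs, hrs⟩ := exists_lt_of_lt_csSup hne hr'
    exact hmono s hs r' hrs.le
  obtain ⟨r', hr', hr'S⟩ := exists_isCompact_closedEBall_gt hlen c hsup
  exact absurd (le_csSup hbdd hr'S) (not_le.2 hr')

/-- A proper 1-Lipschitz exhaustion function. -/
lemma exists_proper_lipschitz [LocallyCompactSpace Y] [SecondCountableTopology Y]
    (hlen : ∀ (x y : Y) (a b : ENNReal), edist x y < a + b → 0 < b →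
      ∃ z, edist x z ≤ a ∧ edist z y < b) :
    ∃ ρ : Y → ℝ, (∀ x y, ENNReal.ofReal |ρ x - ρ y| ≤ edist x y) ∧
      ∀ R, ∃ K, IsCompact K ∧ ∀ x, ρ x ≤ R → x ∈ K := by
  rcases isEmpty_or_nonempty Y with hY | hY
  · exact ⟨fun _ => 0, fun x => (hY.false x).elim, fun R => ⟨∅, isCompact_empty,
      fun x => (hY.false x).elim⟩⟩
  set c := TopologicalSpace.denseSeq Y
  -- The distance to a single point may be infinite, as the space need not be connected. The infimum
  -- over a dense sequence, with penalty `k` on its `k`-th member, is finite everywhere, and each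
  -- sublevel set lies in finitely many compact balls.
  set ρ : Y → ENNReal := fun x => ⨅ k : ℕ, (k + edist (c k) x) with hρ
  have hfin : ∀ x, ρ x ≠ ⊤ := by
    intro x
    obtain ⟨k, hk⟩ := (TopologicalSpace.denseRange_denseSeq Y).exists_mem_open
      (Metric.isOpen_eball (x := x) (ε := 1)) ⟨x, Metric.mem_eball_self one_pos⟩
    refine ne_top_of_le_ne_top ?_ (iInf_le _ k)
    exact ENNReal.add_ne_top.2 ⟨ENNReal.natCast_ne_top k, (hk.trans_le le_top).ne⟩
  have hle : ∀ x y, ρ x ≤ ρ y + edist x y := by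
    intro x y
    rw [hρ, ENNReal.iInf_add]
    refine iInf_mono fun k => ?_
    rw [add_assoc]
    gcongr
    exact (edist_triangle (c k) y x).trans (by rw [edist_comm y x])
  refine ⟨fun x => (ρ x).toReal, fun x y => ?_, fun R => ?_⟩
  · by_cases hd : edist x y = ⊤
    · simp [hd]
    have h1 := ENNReal.toReal_mono (by simp [hfin, hd]) (hle x y)
    have h2 := ENNReal.toReal_mono (by simp [hfin, edist_comm y x, hd]) (hle y x)
    rw [ENNReal.toReal_add (hfin _) hd] at h1
    rw [edist_comm y x, ENNReal.toReal_add (hfin _) hd] at h2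
    refine ENNReal.ofReal_le_of_le_toReal (abs_sub_le_iff.2 ⟨by linarith, by linarith⟩)
  · obtain ⟨m, hm⟩ := exists_nat_gt R
    refine ⟨⋃ k ∈ Finset.range m, Metric.closedEBall (c k) (m : NNReal),
      (Finset.range m).isCompact_biUnion fun k _ => isCompact_closedEBall hlen (c k) m,
      fun x hx => ?_⟩
    have h1 : ρ x < m := by
      rw [← ENNReal.ofReal_toReal (hfin x), ← ENNReal.ofReal_natCast]
      exact (ENNReal.ofReal_lt_ofReal_iff_of_nonneg ENNReal.toReal_nonneg).2 (hx.trans_lt hm)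
    obtain ⟨k, hk⟩ := iInf_lt_iff.1 h1
    simp only [mem_iUnion]
    refine ⟨k, ?_, ?_⟩
    · rw [Finset.mem_range]
      exact_mod_cast (le_self_add.trans_lt hk : (k : ENNReal) < m)
    · rw [Metric.mem_closedEBall']
      simpa using (le_add_self.trans_lt hk).le

end HopfRinow

/-! ### The divergence theorem on a complete surface -/

section DivergenceTheorem

open MeasureTheory Set

variable {n N : ℕ} {M : Type*} [TopologicalSpace M] [ChartedSpace (𝔼 n) M]
  [IsManifold (𝓡 n) ∞ M] [T2Space M] {F : M → 𝔼 N}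

lemma completeSpace_inducedPseudoEMetricSpace (hF : IsSmoothImmersion n F)
    (hc : IsCompleteSurface n F) :
    @CompleteSpace M (inducedPseudoEMetricSpace hF).toUniformSpace := by
  let := inducedPseudoEMetricSpace hF
  refine UniformSpace.complete_of_cauchySeq_tendsto fun u hu => hc u fun δ hδ => ?_
  obtain ⟨k, hk⟩ := EMetric.cauchySeq_iff.1 hu δ hδ
  refine ⟨k, fun i hi j hj => ?_⟩
  rw [← edist_inducedPseudoEMetricSpace hF]
  exact hk i hi j hj

lemma IsInducedLipschitz.continuous (hF : IsSmoothImmersion n F) {L : ℝ} {φ : M → ℝ}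
    (hφ : IsInducedLipschitz n F L φ) : Continuous φ := by
  let := inducedPseudoEMetricSpace hF
  have : LipschitzWith L.toNNReal φ := fun p q => by
    rw [edist_dist, Real.dist_eq]
    refine (hφ p q).trans_eq ?_
    rw [← edist_inducedPseudoEMetricSpace hF]
    rfl
  exact this.continuous

/-- A complete surface carries a proper function which is 1-Lipschitz for the induced distance. -/
lemma exists_proper_inducedLipschitz [SecondCountableTopology M] (hF : IsSmoothImmersion n F)
    (hc : IsCompleteSurface n F) :
    ∃ ρ : M → ℝ, IsInducedLipschitz n F 1 ρ ∧
      ∀ R, ∃ K, IsCompact K ∧ ∀ x, ρ x ≤ R → x ∈ K := by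
  let := inducedPseudoEMetricSpace hF
  have : CompleteSpace M := completeSpace_inducedPseudoEMetricSpace hF hc
  have : LocallyCompactSpace M := ChartedSpace.locallyCompactSpace (𝔼 n) M
  obtain ⟨ρ, h1, h2⟩ := exists_proper_lipschitz (Y := M) fun x y a b h hb => by
    obtain ⟨z, hz1, hz2⟩ := exists_intermediate_point hF (p := x) (q := y) (a := a) (b := b)
      (by rw [← edist_inducedPseudoEMetricSpace hF]; exact h) hb
    rw [← edist_inducedPseudoEMetricSpace hF] at hz1 hz2
    exact ⟨z, hz1, hz2⟩
  refine ⟨ρ, fun p q => ?_, h2⟩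
  rw [← edist_inducedPseudoEMetricSpace hF, ENNReal.ofReal_one, one_mul]
  exact h1 p q

/-- Compactly supported cutoff functions with small Lipschitz constants. -/
lemma exists_cutoff [SecondCountableTopology M] (hF : IsSmoothImmersion n F)
    (hc : IsCompleteSurface n F) :
    ∃ φ : ℕ → M → ℝ, (∀ k : ℕ, IsInducedLipschitz n F (1 / ((k : ℝ) + 1)) (φ k)) ∧
      (∀ k, HasCompactSupport (φ k)) ∧ (∀ k p, |φ k p| ≤ 1) ∧
      ∀ p, ∀ᶠ k in Filter.atTop, φ k p = 1 := by
  obtain ⟨ρ, h1, h2⟩ := exists_proper_inducedLipschitz hF hc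
  -- The cutoff is `1` where `ρ ≤ k + 1`, `0` where `ρ ≥ 2(k + 1)`, and has slope `1 / (k + 1)` in
  -- `ρ` between.
  refine ⟨fun k p => max 0 (min 1 (2 - ρ p / (k + 1))), fun k p q => ?_, fun k => ?_,
    fun k p => ?_, fun p => ?_⟩
  · have hk : (0:ℝ) < k + 1 := by positivity
    have h3 : |max 0 (min 1 (2 - ρ p / (k + 1))) - max 0 (min 1 (2 - ρ q / (k + 1)))| ≤
        1 / (k + 1) * |ρ p - ρ q| := by
      refine (abs_max_sub_max_le_max _ _ _ _).trans ?_
      rw [sub_self, abs_zero, max_eq_right (abs_nonneg _)]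
      refine (abs_min_sub_min_le_max _ _ _ _).trans ?_
      rw [sub_self, abs_zero, max_eq_right (abs_nonneg _)]
      rw [show (2 - ρ p / (k + 1)) - (2 - ρ q / (k + 1)) = -(1 / (k + 1) * (ρ p - ρ q)) by ring,
        abs_neg, abs_mul, abs_of_pos (by positivity : (0:ℝ) < 1 / (k + 1))]
    refine (ENNReal.ofReal_le_ofReal h3).trans ?_
    rw [ENNReal.ofReal_mul (by positivity)]
    have h4 := h1 p q
    rw [ENNReal.ofReal_one, one_mul] at h4
    gcongr
  · have hk : (0:ℝ) < k + 1 := by positivity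
    obtain ⟨K, hK, hρK⟩ := h2 (2 * (k + 1))
    refine HasCompactSupport.intro hK fun p hp => ?_
    have h3 : 2 * ((k:ℝ) + 1) < ρ p := not_le.1 fun h => hp (hρK p h)
    have h4 : 2 < ρ p / (k + 1) := by rwa [lt_div_iff₀ hk]
    exact max_eq_left ((min_le_right _ _).trans (by linarith))
  · rw [abs_of_nonneg (le_max_left _ _)]
    exact max_le zero_le_one (min_le_left _ _)
  · obtain ⟨m, hm⟩ := exists_nat_ge (ρ p)
    filter_upwards [Filter.eventually_ge_atTop m] with k hk
    have hk' : (m:ℝ) ≤ k := by exact_mod_cast hk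
    have h4 : ρ p / (k + 1) ≤ 1 := by
      rw [div_le_one (by positivity)]; linarith
    rw [min_eq_left (by linarith), max_eq_right zero_le_one]

/-- The divergence theorem on a complete surface, for tangent fields which are integrable together
with their divergence. -/
theorem integral_divergence_eq_zero [SecondCountableTopology M] [MeasurableSpace M] [BorelSpace M]
    (hF : IsSmoothImmersion n F) (hc : IsCompleteSurface n F) {W : M → 𝔼 N} (hW : Smooth n W)
    (hT : ∀ p, tder n F F p (W p) = W p)
    (hWi : Integrable (fun p => ‖W p‖) (inducedVolume n F))
    (hdi : Integrable (fun p => traceL (𝔼 N) (tder n F W p)) (inducedVolume n F)) :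
    ∫ p, traceL (𝔼 N) (tder n F W p) ∂(inducedVolume n F) = 0 := by
  obtain ⟨φ, hL, hs, h1, hlim⟩ := exists_cutoff hF hc
  have hlim1 : Filter.Tendsto (fun k => ∫ p, φ k p * traceL (𝔼 N) (tder n F W p)
      ∂(inducedVolume n F)) Filter.atTop
      (𝓝 (∫ p, traceL (𝔼 N) (tder n F W p) ∂(inducedVolume n F))) := by
    refine tendsto_integral_of_dominated_convergence
      (fun p => |traceL (𝔼 N) (tder n F W p)|) (fun k => ?_) hdi.abs (fun k => ?_) ?_
    · exact ((hL k).continuous hF).aestronglyMeasurable.mul hdi.aestronglyMeasurable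
    · refine Filter.Eventually.of_forall fun p => ?_
      rw [norm_mul, Real.norm_eq_abs, Real.norm_eq_abs]
      exact mul_le_of_le_one_left (abs_nonneg _) (h1 k p)
    · refine Filter.Eventually.of_forall fun p => ?_
      refine tendsto_const_nhds.congr' ?_
      filter_upwards [hlim p] with k hk
      rw [hk, one_mul]
  -- The weak inequality bounds the integral by the Lipschitz constant of the cutoff times `∫ |W|`,
  -- which tends to `0`.
  have hlim2 : Filter.Tendsto (fun k => ∫ p, φ k p * traceL (𝔼 N) (tder n F W p)
      ∂(inducedVolume n F)) Filter.atTop (𝓝 0) := by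
    refine squeeze_zero_norm (a := fun k : ℕ => 1 / ((k:ℝ) + 1) * ∫ p, ‖W p‖ ∂(inducedVolume n F))
      (fun k => ?_) ?_
    · exact abs_integral_mul_divergence_le hF (by positivity) (hL k) ((hL k).continuous hF)
        (hs k) hW hT hWi
    · simpa using (tendsto_one_div_add_atTop_nhds_zero_nat (𝕜 := ℝ)).mul_const
        (∫ p, ‖W p‖ ∂(inducedVolume n F))
  exact tendsto_nhds_unique hlim1 hlim2

end DivergenceTheorem

/-! ### Derivatives of maps depending on a real parameter -/

section ParameterDerivative

open Set

variable {V E : Type*} [NormedAddCommGroup V] [NormedSpace ℝ V] [NormedAddCommGroup E]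
  [NormedSpace ℝ E] {Ψ : ℝ × V → E} {Ω : Set (ℝ × V)}

lemma hasDerivAt_fst_of_differentiableAt {q : ℝ × V} (h : DifferentiableAt ℝ Ψ q) :
    HasDerivAt (fun r => Ψ (r, q.2)) (fderiv ℝ Ψ q (1, 0)) q.1 :=
  HasFDerivAt.comp_hasDerivAt (f := fun r : ℝ => (r, q.2)) q.1 h.hasFDerivAt
    ((hasDerivAt_id q.1).prodMk (hasDerivAt_const q.1 q.2))

lemma hasFDerivAt_snd_of_differentiableAt {q : ℝ × V} (h : DifferentiableAt ℝ Ψ q) :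
    HasFDerivAt (fun u => Ψ (q.1, u)) (fderiv ℝ Ψ q ∘L ContinuousLinearMap.inr ℝ ℝ V) q.2 :=
  HasFDerivAt.comp (f := fun u : V => (q.1, u)) q.2 h.hasFDerivAt (hasFDerivAt_prodMk_right q.1 q.2)

lemma contDiffOn_deriv_fst {m k : WithTop ℕ∞} (hΩ : IsOpen Ω) (h : ContDiffOn ℝ k Ψ Ω)
    (hmk : m + 1 ≤ k) : ContDiffOn ℝ m (fun q : ℝ × V => deriv (fun r => Ψ (r, q.2)) q.1) Ω := by
  refine ((h.fderiv_of_isOpen hΩ hmk).clm_apply (contDiffOn_const (c := ((1, 0) : ℝ × V)))).congr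
    fun q hq => ?_
  refine (hasDerivAt_fst_of_differentiableAt ?_).deriv
  exact (h.contDiffAt (hΩ.mem_nhds hq)).differentiableAt
    (ne_of_gt (lt_of_lt_of_le (by simp) (le_trans le_add_self hmk)))

/-- Symmetry of the second derivative, applied to `(1, 0)` and `(0, v)`: the derivative in the
parameter commutes with the differential in the point. -/
lemma hasDerivAt_fderiv_snd (hΩ : IsOpen Ω) (h : ContDiffOn ℝ ∞ Ψ Ω) {q : ℝ × V} (hq : q ∈ Ω) :
    HasDerivAt (fun s => fderiv ℝ (fun u => Ψ (s, u)) q.2)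
      (fderiv ℝ (fun u => deriv (fun r => Ψ (r, u)) q.1) q.2) q.1 := by
  have hd : ∀ q ∈ Ω, DifferentiableAt ℝ Ψ q := fun q hq =>
    (h.contDiffAt (hΩ.mem_nhds hq)).differentiableAt (by simp)
  have hC := h.contDiffAt (hΩ.mem_nhds hq)
  have hd2 : DifferentiableAt ℝ (fderiv ℝ Ψ) q :=
    (hC.fderiv_right (m := 1) (by rw [one_add_one_eq_two]; simpa using ENat.LEInfty.out)).differentiableAt (by simp)
  have hsym := hC.isSymmSndFDerivAt (by simpa using ENat.LEInfty.out)
  have h1 : HasDerivAt (fun s => fderiv ℝ Ψ (s, q.2) ∘L ContinuousLinearMap.inr ℝ ℝ V)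
      (fderiv ℝ (fderiv ℝ Ψ) q (1, 0) ∘L ContinuousLinearMap.inr ℝ ℝ V) q.1 := by
    have := hasDerivAt_fst_of_differentiableAt hd2
    exact ((ContinuousLinearMap.compL ℝ V (ℝ × V) E).flip
      (ContinuousLinearMap.inr ℝ ℝ V)).hasFDerivAt.comp_hasDerivAt q.1 this
  have h2 : HasFDerivAt (fun u => fderiv ℝ Ψ (q.1, u) (1, 0))
      ((ContinuousLinearMap.apply ℝ E ((1, 0) : ℝ × V)) ∘L
        (fderiv ℝ (fderiv ℝ Ψ) q ∘L ContinuousLinearMap.inr ℝ ℝ V)) q.2 :=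
    (ContinuousLinearMap.apply ℝ E ((1, 0) : ℝ × V)).hasFDerivAt.comp q.2
      (hasFDerivAt_snd_of_differentiableAt hd2)
  have e1 : ∀ᶠ s in 𝓝 q.1, (s, q.2) ∈ Ω :=
    (Continuous.prodMk_left q.2).continuousAt.eventually (hΩ.mem_nhds hq)
  have e2 : ∀ᶠ u in 𝓝 q.2, (q.1, u) ∈ Ω :=
    (Continuous.prodMk_right q.1).continuousAt.eventually (hΩ.mem_nhds hq)
  have h2' : HasFDerivAt (fun u => deriv (fun r => Ψ (r, u)) q.1)
      ((ContinuousLinearMap.apply ℝ E ((1, 0) : ℝ × V)) ∘L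
        (fderiv ℝ (fderiv ℝ Ψ) q ∘L ContinuousLinearMap.inr ℝ ℝ V)) q.2 := by
    refine h2.congr_of_eventuallyEq ?_
    filter_upwards [e2] with u hu
    exact (hasDerivAt_fst_of_differentiableAt (hd _ hu)).deriv
  rw [h2'.fderiv]
  have h3 : fderiv ℝ (fderiv ℝ Ψ) q (1, 0) ∘L ContinuousLinearMap.inr ℝ ℝ V =
      (ContinuousLinearMap.apply ℝ E ((1, 0) : ℝ × V)) ∘L
        (fderiv ℝ (fderiv ℝ Ψ) q ∘L ContinuousLinearMap.inr ℝ ℝ V) := by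
    ext v
    exact hsym _ _
  rw [← h3]
  refine h1.congr_of_eventuallyEq ?_
  filter_upwards [e1] with s hs
  exact (hasFDerivAt_snd_of_differentiableAt (q := (s, q.2)) (hd _ hs)).fderiv

end ParameterDerivative

/-! ### Families of maps on the manifold -/

section Family

open Set

variable {n N : ℕ} {M : Type*} [TopologicalSpace M] [ChartedSpace (𝔼 n) M]
  [IsManifold (𝓡 n) ∞ M] {E : Type*} [NormedAddCommGroup E] [NormedSpace ℝ E] {ε : ℝ}
  {Φ : ℝ → M → E}

/-- A family of maps on `M`, of class `C^k` in the parameter `|s| < ε` and the point. -/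
def IsFamily (n : ℕ) {M : Type*} [TopologicalSpace M] [ChartedSpace (𝔼 n) M] (k : WithTop ℕ∞)
    (ε : ℝ) (Φ : ℝ → M → E) : Prop :=
  ∀ c : M, ContDiffOn ℝ k (fun q : ℝ × 𝔼 n => Φ q.1 ((chartAt (𝔼 n) c).symm q.2))
    (Ioo (-ε) ε ×ˢ (chartAt (𝔼 n) c).target)

/-- The derivative of a family of maps with respect to the parameter. -/
def dparam (Φ : ℝ → M → E) (s : ℝ) (p : M) : E := deriv (fun r => Φ r p) s

lemma isOpen_family_domain (ε : ℝ) (c : M) :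
    IsOpen (Ioo (-ε) ε ×ˢ (chartAt (𝔼 n) c).target) :=
  isOpen_Ioo.prod (chartAt (𝔼 n) c).open_target

lemma IsDeformation.isFamily {F : M → 𝔼 N} {Φ : ℝ → M → 𝔼 N} (hΦ : IsDeformation n F Φ ε) :
    IsFamily n ∞ ε Φ := by
  intro c
  rw [← contMDiffOn_iff_contDiffOn]
  have h1 : ContMDiffOn 𝓘(ℝ, ℝ × 𝔼 n) (𝓘(ℝ, ℝ).prod (𝓡 n)) ∞
      (fun q : ℝ × 𝔼 n => (q.1, (chartAt (𝔼 n) c).symm q.2))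
      (Ioo (-ε) ε ×ˢ (chartAt (𝔼 n) c).target) := by
    refine ContMDiffOn.prodMk ?_ ?_
    · exact (contMDiff_iff_contDiff.2 contDiff_fst).contMDiffOn
    · exact (contMDiffOn_chart_symm (I := 𝓡 n)).comp
        ((contMDiff_iff_contDiff.2 contDiff_snd).contMDiffOn) fun q hq => hq.2
  exact hΦ.smooth.comp h1 fun q hq => ⟨hq.1, mem_univ _⟩

lemma IsFamily.dparam {m k : WithTop ℕ∞} (hΦ : IsFamily n k ε Φ) (hmk : m + 1 ≤ k) :
    IsFamily n m ε (dparam Φ) := fun c =>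
  contDiffOn_deriv_fst (isOpen_family_domain ε c) (hΦ c) hmk

lemma IsFamily.smooth (hΦ : IsFamily n ∞ ε Φ) {s : ℝ} (hs : s ∈ Ioo (-ε) ε) : Smooth n (Φ s) :=
  smooth_of_chart fun c => (hΦ c).comp (f := fun u => (s, u))
    (contDiff_const.prodMk contDiff_id).contDiffOn fun _ hu => ⟨hs, hu⟩

lemma IsFamily.hasDerivAt {k : WithTop ℕ∞} (hΦ : IsFamily n k ε Φ) (hk : k ≠ 0) {s : ℝ}
    (hs : s ∈ Ioo (-ε) ε) (p : M) :
    HasDerivAt (fun r => Φ r p) (ImmersedSurface.dparam Φ s p) s := by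
  have h := (((hΦ p).contDiffAt ((isOpen_family_domain ε p).mem_nhds
    (x := (s, chartAt (𝔼 n) p p)) ⟨hs, mem_chart_target _ p⟩)).differentiableAt hk)
  have h2 := hasDerivAt_fst_of_differentiableAt h
  simp only [chart_symm_self] at h2
  exact h2.differentiableAt.hasDerivAt

lemma IsFamily.hasDerivAt_mder (hΦ : IsFamily n ∞ ε Φ) {s : ℝ} (hs : s ∈ Ioo (-ε) ε) (p : M) :
    HasDerivAt (fun r => mder n (Φ r) p) (mder n (ImmersedSurface.dparam Φ s) p) s :=
  hasDerivAt_fderiv_snd (isOpen_family_domain ε p) (hΦ p) (q := (s, chartAt (𝔼 n) p p))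
    ⟨hs, mem_chart_target _ p⟩

/-- A family of continuous maps is bounded near every point and parameter. -/
lemma IsFamily.exists_local_bound (hΦ : IsFamily n 0 ε Φ) (hε : 0 < ε) (p : M) :
    ∃ C : ℝ, ∃ δ > 0, ∃ U ∈ 𝓝 p, ∀ s, |s| < δ → ∀ q ∈ U, ‖Φ s q‖ ≤ C := by
  have h := ((hΦ p).continuousOn.norm).continuousAt ((isOpen_family_domain ε p).mem_nhds
    (x := ((0:ℝ), chartAt (𝔼 n) p p)) ⟨by simpa using hε, mem_chart_target _ p⟩)
  have h2 := h.eventually (Iio_mem_nhds (lt_add_one _))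
  rw [nhds_prod_eq] at h2
  obtain ⟨A, hA, B, hB, hAB⟩ := Filter.mem_prod_iff.1 h2
  obtain ⟨δ, hδ, hδA⟩ := Metric.mem_nhds_iff.1 hA
  refine ⟨‖Φ 0 ((chartAt (𝔼 n) p).symm (chartAt (𝔼 n) p p))‖ + 1, δ, hδ, (chartAt (𝔼 n) p).source ∩ chartAt (𝔼 n) p ⁻¹' B,
    Filter.inter_mem ((chartAt (𝔼 n) p).open_source.mem_nhds (mem_chart_source _ p))
      (((chartAt (𝔼 n) p).continuousAt (mem_chart_source _ p)).preimage_mem_nhds hB),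
    fun s hs q hq => ?_⟩
  have h3 := hAB (show (s, chartAt (𝔼 n) p q) ∈ A ×ˢ B from
    ⟨hδA (by simpa using hs), hq.2⟩)
  have h4 : ‖Φ s ((chartAt (𝔼 n) p).symm (chartAt (𝔼 n) p q))‖ <
      ‖Φ 0 ((chartAt (𝔼 n) p).symm (chartAt (𝔼 n) p p))‖ + 1 := h3
  rw [(chartAt (𝔼 n) p).left_inv hq.1] at h4
  exact h4.le

lemma IsFamily.exists_bound (hΦ : IsFamily n 0 ε Φ) (hε : 0 < ε) {K : Set M} (hK : IsCompact K) :
    ∃ C : ℝ, ∃ δ > 0, ∀ s, |s| < δ → ∀ q ∈ K, ‖Φ s q‖ ≤ C := by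
  refine hK.induction_on (p := fun K => ∃ C : ℝ, ∃ δ > 0, ∀ s, |s| < δ → ∀ q ∈ K, ‖Φ s q‖ ≤ C)
    ⟨0, 1, one_pos, by simp⟩ ?_ ?_ ?_
  · rintro s t hst ⟨C, δ, hδ, h⟩
    exact ⟨C, δ, hδ, fun r hr q hq => h r hr q (hst hq)⟩
  · rintro s t ⟨C, δ, hδ, h⟩ ⟨C', δ', hδ', h'⟩
    refine ⟨max C C', min δ δ', lt_min hδ hδ', fun r hr q hq => ?_⟩
    rcases hq with hq | hq
    · exact (h r (hr.trans_le (min_le_left _ _)) q hq).trans (le_max_left _ _)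
    · exact (h' r (hr.trans_le (min_le_right _ _)) q hq).trans (le_max_right _ _)
  · intro p _
    obtain ⟨C, δ, hδ, U, hU, h⟩ := hΦ.exists_local_bound hε p
    exact ⟨U, mem_nhdsWithin_of_mem_nhds hU, C, δ, hδ, h⟩

end Family

/-! ### Logarithmic derivatives of the Gaussian weight -/

section GaussWeight

variable {n N : ℕ}

lemma gaussWeight_pos (n : ℕ) {t : ℝ} (ht : 0 < t) (x z : 𝔼 N) : 0 < gaussWeight n x t z := by
  unfold gaussWeight; positivity

lemma contDiffAt_gaussWeight {V : Type*} [NormedAddCommGroup V] [NormedSpace ℝ V]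
    {k : WithTop ℕ∞} {x z : V → 𝔼 N} {t : V → ℝ} {q : V} (hx : ContDiffAt ℝ k x q)
    (ht : ContDiffAt ℝ k t q) (hz : ContDiffAt ℝ k z q) (hpos : 0 < t q) :
    ContDiffAt ℝ k (fun q => gaussWeight n (x q) (t q) (z q)) q := by
  unfold gaussWeight
  refine ContDiffAt.mul (ContDiffAt.rpow_const_of_ne (contDiffAt_const.mul ht) (by positivity))
    (ContDiffAt.exp (ContDiffAt.div ?_ (contDiffAt_const.mul ht) (by positivity)))
  exact ((hz.sub hx).norm_sq ℝ).neg

/-- The logarithmic derivative of the Gaussian weight along a curve, in terms of `t`, `t'`, the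
position `d` relative to the centre, and `d'`. -/
def gaussRate (n : ℕ) (t t₁ : ℝ) (d d₁ : 𝔼 N) : ℝ :=
  -(n / 2 * (t₁ / t)) + ‖d‖ ^ 2 * t₁ / (4 * t ^ 2) - inner ℝ d d₁ / (2 * t)

lemma hasDerivAt_gaussWeight {x z : ℝ → 𝔼 N} {t : ℝ → ℝ} {x₁ z₁ : 𝔼 N} {t₁ s : ℝ}
    (hx : HasDerivAt x x₁ s) (ht : HasDerivAt t t₁ s) (hz : HasDerivAt z z₁ s) (hpos : 0 < t s) :
    HasDerivAt (fun r => gaussWeight n (x r) (t r) (z r))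
      (gaussWeight n (x s) (t s) (z s) * gaussRate n (t s) t₁ (z s - x s) (z₁ - x₁)) s := by
  have h1 : HasDerivAt (fun r => ‖z r - x r‖ ^ 2) (2 * inner ℝ (z s - x s) (z₁ - x₁)) s :=
    (hz.sub hx).norm_sq
  have h2 := (h1.neg.div (ht.const_mul 4) (by positivity)).exp
  have h3 := (ht.const_mul (4 * Real.pi)).rpow_const (p := -(n:ℝ) / 2)
    (Or.inl (by positivity))
  have h4 := h3.mul h2
  unfold gaussWeight
  refine h4.congr_deriv ?_
  have hp : (0:ℝ) < 4 * Real.pi * t s := by positivity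
  rw [Real.rpow_sub_one hp.ne']
  unfold gaussRate
  generalize (4 * Real.pi * t s) ^ (-(n:ℝ) / 2) = a
  simp only [Pi.neg_apply]
  generalize Real.exp (-‖z s - x s‖ ^ 2 / (4 * t s)) = b
  have := hpos.ne'
  have := Real.pi_pos.ne'
  field_simp
  ring

/-- The derivative of the logarithmic derivative of the Gaussian weight along a curve. -/
def gaussRateDeriv (n : ℕ) (t t₁ t₂ : ℝ) (d d₁ d₂ : 𝔼 N) : ℝ :=
  -(n * t₂ / (2 * t)) + n * t₁ ^ 2 / (2 * t ^ 2) + ‖d‖ ^ 2 * t₂ / (4 * t ^ 2)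
    - ‖d‖ ^ 2 * t₁ ^ 2 / (2 * t ^ 3) + inner ℝ d d₁ * t₁ / t ^ 2
    - ‖d₁‖ ^ 2 / (2 * t) - inner ℝ d d₂ / (2 * t)

lemma hasDerivAt_gaussRate {d d₁ : ℝ → 𝔼 N} {t t₁ : ℝ → ℝ} {d₂ : 𝔼 N} {t₂ s : ℝ}
    (hd : HasDerivAt d (d₁ s) s) (hd₁ : HasDerivAt d₁ d₂ s) (ht : HasDerivAt t (t₁ s) s)
    (ht₁ : HasDerivAt t₁ t₂ s) (hpos : 0 < t s) :
    HasDerivAt (fun r => gaussRate n (t r) (t₁ r) (d r) (d₁ r))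
      (gaussRateDeriv n (t s) (t₁ s) t₂ (d s) (d₁ s) d₂) s := by
  have h1 : HasDerivAt (fun r => ‖d r‖ ^ 2) (2 * inner ℝ (d s) (d₁ s)) s := hd.norm_sq
  have h2 := ((ht₁.div ht hpos.ne').const_mul ((n:ℝ) / 2)).neg
  have h3 := (h1.mul ht₁).div ((ht.pow 2).const_mul 4)
    (by simp only [Pi.pow_apply]; positivity)
  have h4 := (hd.inner ℝ hd₁).div (ht.const_mul 2) (by positivity)
  have h5 := (h2.add h3).sub h4
  unfold gaussRate
  refine h5.congr_deriv ?_
  unfold gaussRateDeriv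
  rw [real_inner_self_eq_norm_sq]
  have := hpos.ne'
  simp only [Pi.mul_apply, Pi.pow_apply]
  field_simp
  ring

end GaussWeight

/-! ### Derivatives of the weighted density in the parameter -/

section Density

open Set

variable {n N : ℕ} {M : Type*} [TopologicalSpace M] [ChartedSpace (𝔼 n) M]
  [IsManifold (𝓡 n) ∞ M] [MeasurableSpace M] [BorelSpace M]
  [SecondCountableTopology M] {F : M → 𝔼 N} {ε : ℝ}
  {Φ : ℝ → M → 𝔼 N} {xs : ℝ → 𝔼 N} {ts : ℝ → ℝ}

lemma weightedDensity_eq (hF : Smooth n F) {s : ℝ} (hs : Smooth n (Φ s)) (p : M) :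
    weightedDensity n F Φ xs ts p s =
      gaussWeight n (xs s) (ts s) (Φ s p) * areaRatio n F (Φ s) p := by
  rw [weightedDensity, areaRatio, diff_eq_mder hF, diff_eq_mder hs]

/-- The order `2` is that of the curves `xs` and `ts`; the deformation itself is smooth, so taking
its differential loses nothing. Off the zero set of `ts` and at injective differentials all the
building blocks are smooth. -/
lemma isFamily_weightedDensity (hF : IsSmoothImmersion n F) (hΦ : IsFamily n ∞ ε Φ)
    (himm : ∀ s ∈ Ioo (-ε) ε, IsSmoothImmersion n (Φ s)) (hxs : ContDiffOn ℝ 2 xs (Ioo (-ε) ε))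
    (hts : ContDiffOn ℝ 2 ts (Ioo (-ε) ε)) (hpos : ∀ s ∈ Ioo (-ε) ε, 0 < ts s) :
    IsFamily n 2 ε (fun s p => weightedDensity n F Φ xs ts p s) := by
  intro c
  have hopen := isOpen_family_domain (n := n) ε c
  have h2 : (2 : WithTop ℕ∞) ≤ ∞ := by simpa using ENat.LEInfty.out
  have h3 : (3 : WithTop ℕ∞) ≤ ∞ := ENat.LEInfty.out
  -- The density is rewritten with derivatives in the fixed chart at `c` instead of the preferred
  -- charts; the area ratio does not change.
  have key : ContDiffOn ℝ 2 (fun q : ℝ × 𝔼 n =>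
      gaussWeight n (xs q.1) (ts q.1) (Φ q.1 ((chartAt (𝔼 n) c).symm q.2)) *
        (areaFactor (fderiv ℝ (fun q : ℝ × 𝔼 n => Φ q.1 ((chartAt (𝔼 n) c).symm q.2)) q ∘L
          ContinuousLinearMap.inr ℝ ℝ (𝔼 n)) / chartDensity n F c q.2))
      (Ioo (-ε) ε ×ˢ (chartAt (𝔼 n) c).target) := by
    intro q hq
    refine ContDiffAt.contDiffWithinAt ?_
    have hΨ := (hΦ c).contDiffAt (hopen.mem_nhds hq)
    have hq1 : Ioo (-ε) ε ∈ 𝓝 q.1 := isOpen_Ioo.mem_nhds hq.1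
    refine ContDiffAt.mul (contDiffAt_gaussWeight
      ((hxs.contDiffAt hq1).comp q contDiffAt_fst) ((hts.contDiffAt hq1).comp q contDiffAt_fst)
      (hΨ.of_le h2) (hpos _ hq.1)) (ContDiffAt.div ?_ ?_ ?_)
    · have h3 : ContDiffAt ℝ 2 (fun q' : ℝ × 𝔼 n => fderiv ℝ (fun q : ℝ × 𝔼 n =>
          Φ q.1 ((chartAt (𝔼 n) c).symm q.2)) q' ∘L ContinuousLinearMap.inr ℝ ℝ (𝔼 n)) q :=
        (hΨ.fderiv_right (m := 2) (by rwa [two_add_one_eq_three])).clm_comp contDiffAt_const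
      refine ContDiffAt.comp (g := areaFactor) q (contDiffAt_areaFactor ?_) h3
      rw [← (hasFDerivAt_snd_of_differentiableAt (hΨ.differentiableAt (by simp))).fderiv]
      have h4 := (himm q.1 hq.1).fderiv_injective ((chartAt (𝔼 n) c).map_target hq.2)
      rwa [(chartAt (𝔼 n) c).right_inv hq.2] at h4
    · exact ((contDiffOn_chartDensity hF c).contDiffAt
        ((chartAt (𝔼 n) c).open_target.mem_nhds hq.2)).of_le h2 |>.comp q contDiffAt_snd
    · exact (chartDensity_pos hF hq.2).ne'
  refine key.congr fun q hq => ?_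
  have hΨ := (hΦ c).contDiffAt (hopen.mem_nhds hq)
  have e : fderiv ℝ (Φ q.1 ∘ (chartAt (𝔼 n) c).symm) q.2 =
      fderiv ℝ (fun q : ℝ × 𝔼 n => Φ q.1 ((chartAt (𝔼 n) c).symm q.2)) q ∘L
        ContinuousLinearMap.inr ℝ ℝ (𝔼 n) :=
    (hasFDerivAt_snd_of_differentiableAt (hΨ.differentiableAt (by simp))).fderiv
  have e2 : areaRatio n F (Φ q.1) ((chartAt (𝔼 n) c).symm q.2) =
      areaFactor (fderiv ℝ (Φ q.1 ∘ (chartAt (𝔼 n) c).symm) q.2) / chartDensity n F c q.2 := by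
    rw [areaRatio_eq_chart hF (hΦ.smooth hq.1) ((chartAt (𝔼 n) c).map_target hq.2),
      (chartAt (𝔼 n) c).right_inv hq.2, chartDensity]
  rw [← e, ← e2]
  exact weightedDensity_eq hF.sm (hΦ.smooth hq.1) _

/-- The logarithmic derivative of the weighted density with respect to the parameter. -/
def densityRate (n : ℕ) {M : Type*} [TopologicalSpace M] [ChartedSpace (𝔼 n) M]
    (Φ : ℝ → M → 𝔼 N) (xs : ℝ → 𝔼 N) (ts : ℝ → ℝ) (s : ℝ) (p : M) : ℝ :=
  gaussRate n (ts s) (deriv ts s) (Φ s p - xs s) (dparam Φ s p - deriv xs s) +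
    traceL (𝔼 n) (pinv (mder n (Φ s) p) ∘L mder n (dparam Φ s) p)

/-- Keeping the derivative in the form `w · r` makes the second derivative `w (r² + r')`, so that
Gaussian and area element can be differentiated separately and added. -/
lemma hasDerivAt_weightedDensity (hF : IsSmoothImmersion n F) (hΦ : IsFamily n ∞ ε Φ)
    (himm : ∀ s ∈ Ioo (-ε) ε, IsSmoothImmersion n (Φ s)) (hxs : ContDiffOn ℝ 2 xs (Ioo (-ε) ε))
    (hts : ContDiffOn ℝ 2 ts (Ioo (-ε) ε)) (hpos : ∀ s ∈ Ioo (-ε) ε, 0 < ts s) {s : ℝ}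
    (hs : s ∈ Ioo (-ε) ε) (p : M) :
    HasDerivAt (weightedDensity n F Φ xs ts p)
      (weightedDensity n F Φ xs ts p s * densityRate n Φ xs ts s p) s := by
  have hsn : Ioo (-ε) ε ∈ 𝓝 s := isOpen_Ioo.mem_nhds hs
  have h1 := hasDerivAt_gaussWeight (n := n)
    ((hxs.contDiffAt hsn).differentiableAt (by simp)).hasDerivAt
    ((hts.contDiffAt hsn).differentiableAt (by simp)).hasDerivAt
    (hΦ.hasDerivAt (by simp) hs p) (hpos s hs)
  have h2 := (hasFDerivAt_areaFactor ((himm s hs).mder_injective p)).comp_hasDerivAt s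
    (hΦ.hasDerivAt_mder hs p)
  have h3 := h1.mul (h2.div_const (areaFactor (mder n F p)))
  refine (h3.congr_of_eventuallyEq ?_).congr_deriv ?_
  · filter_upwards [hsn] with r hr
    exact weightedDensity_eq hF.sm (hΦ.smooth hr) p
  · rw [weightedDensity_eq hF.sm (hΦ.smooth hs), areaRatio, densityRate]
    simp only [smul_apply, smul_eq_mul, ContinuousLinearMap.comp_apply,
      ContinuousLinearMap.compL_apply, Function.comp_apply]
    ring

lemma hasDerivAt_densityRate (hΦ : IsFamily n ∞ ε Φ)
    (himm : ∀ s ∈ Ioo (-ε) ε, IsSmoothImmersion n (Φ s)) (hxs : ContDiffOn ℝ 2 xs (Ioo (-ε) ε))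
    (hts : ContDiffOn ℝ 2 ts (Ioo (-ε) ε)) (hpos : ∀ s ∈ Ioo (-ε) ε, 0 < ts s) {s : ℝ}
    (hs : s ∈ Ioo (-ε) ε) (p : M) :
    HasDerivAt (fun r => densityRate n Φ xs ts r p)
      (gaussRateDeriv n (ts s) (deriv ts s) (deriv (deriv ts) s) (Φ s p - xs s)
          (dparam Φ s p - deriv xs s) (dparam (dparam Φ) s p - deriv (deriv xs) s)
        + (traceL (𝔼 N) (tder n (Φ s) (dparam (dparam Φ) s) p)
          + traceL (𝔼 N) (tder n (Φ s) (dparam Φ s) p ∘L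
              ContinuousLinearMap.adjoint (tder n (Φ s) (dparam Φ s) p))
          - traceL (𝔼 N) (tder n (Φ s) (Φ s) p ∘L (tder n (Φ s) (dparam Φ s) p ∘L
              ContinuousLinearMap.adjoint (tder n (Φ s) (dparam Φ s) p)))
          - traceL (𝔼 N) (tder n (Φ s) (dparam Φ s) p ∘L tder n (Φ s) (dparam Φ s) p))) s := by
  have hsn : Ioo (-ε) ε ∈ 𝓝 s := isOpen_Ioo.mem_nhds hs
  have hΦ₁ : IsFamily n ∞ ε (dparam Φ) := hΦ.dparam (by simp)
  have d2 : ∀ {G : Type} [NormedAddCommGroup G] [NormedSpace ℝ G] {f : ℝ → G},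
      ContDiffOn ℝ 2 f (Ioo (-ε) ε) →
      HasDerivAt f (deriv f s) s ∧ HasDerivAt (deriv f) (deriv (deriv f) s) s := fun {G} _ _ f hf =>
    ⟨((hf.contDiffAt hsn).differentiableAt (by simp)).hasDerivAt,
      (((hf.deriv_of_isOpen (m := 1) isOpen_Ioo (by rw [one_add_one_eq_two])).contDiffAt
        hsn).differentiableAt (by simp)).hasDerivAt⟩
  obtain ⟨hx1, hx2⟩ := d2 hxs
  obtain ⟨ht1, ht2⟩ := d2 hts
  exact (hasDerivAt_gaussRate (n := n) ((hΦ.hasDerivAt (by simp) hs p).sub hx1)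
    ((hΦ₁.hasDerivAt (by simp) hs p).sub hx2) ht1 ht2 (hpos s hs)).add
    (hasDerivAt_trace_pinv ((himm s hs).mder_injective p) (hΦ.hasDerivAt_mder hs p)
      (hΦ₁.hasDerivAt_mder hs p))

end Density

/-! ### Bounds for the Gaussian weight and its rates -/

section GaussBounds

variable {n N : ℕ}

/-- The rate is polynomial in `t⁻¹`, the velocities and the displacement; `D` stays separate from
`B` because the displacement is unbounded on the surface. -/
lemma abs_gaussRate_le {t t₁ B c D : ℝ} {d d₁ : 𝔼 N} (ht : 0 < t) (hc : t⁻¹ ≤ c)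
    (h₁ : |t₁| ≤ B) (hd : ‖d‖ ≤ D) (hd₁ : ‖d₁‖ ≤ B) :
    |gaussRate n t t₁ d d₁| ≤ n / 2 * (B * c) + D ^ 2 * B * c ^ 2 / 4 + D * B * c / 2 := by
  have hi : 0 < t⁻¹ := inv_pos.2 ht
  have hB : 0 ≤ B := (abs_nonneg _).trans h₁
  have hD : 0 ≤ D := (norm_nonneg _).trans hd
  have e : gaussRate n t t₁ d d₁ = -(n / 2 * (t₁ * t⁻¹)) + ‖d‖ ^ 2 * t₁ * t⁻¹ ^ 2 / 4
      - inner ℝ d d₁ * t⁻¹ / 2 := by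
    unfold gaussRate; field_simp
  have hin : |inner ℝ d d₁| ≤ D * B := (abs_real_inner_le_norm d d₁).trans (by gcongr)
  rw [e]
  refine (abs_sub _ _).trans (add_le_add ((abs_add_le _ _).trans (add_le_add ?_ ?_)) ?_)
  · rw [abs_neg, abs_mul, abs_mul, abs_of_pos hi, abs_of_nonneg (by positivity : (0:ℝ) ≤ n / 2)]
    gcongr
  · rw [abs_div, abs_mul, abs_mul, abs_of_nonneg (by positivity : (0:ℝ) ≤ ‖d‖ ^ 2),
      abs_of_nonneg (by positivity : (0:ℝ) ≤ t⁻¹ ^ 2), abs_of_nonneg (by norm_num : (0:ℝ) ≤ 4)]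
    gcongr
  · rw [abs_div, abs_mul, abs_of_pos hi, abs_of_nonneg (by norm_num : (0:ℝ) ≤ 2)]
    gcongr

lemma abs_gaussRateDeriv_le {t t₁ t₂ B c D : ℝ} {d d₁ d₂ : 𝔼 N} (ht : 0 < t) (hc : t⁻¹ ≤ c)
    (h₁ : |t₁| ≤ B) (h₂ : |t₂| ≤ B) (hd : ‖d‖ ≤ D) (hd₁ : ‖d₁‖ ≤ B) (hd₂ : ‖d₂‖ ≤ B) :
    |gaussRateDeriv n t t₁ t₂ d d₁ d₂| ≤ n * B * c / 2 + n * B ^ 2 * c ^ 2 / 2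
      + D ^ 2 * B * c ^ 2 / 4 + D ^ 2 * B ^ 2 * c ^ 3 / 2 + D * B * B * c ^ 2 + B ^ 2 * c / 2
      + D * B * c / 2 := by
  have hi : 0 < t⁻¹ := inv_pos.2 ht
  have hB : 0 ≤ B := (abs_nonneg _).trans h₁
  have hD : 0 ≤ D := (norm_nonneg _).trans hd
  have e : gaussRateDeriv n t t₁ t₂ d d₁ d₂ = -(n * t₂ * t⁻¹ / 2) + n * t₁ ^ 2 * t⁻¹ ^ 2 / 2
      + ‖d‖ ^ 2 * t₂ * t⁻¹ ^ 2 / 4 - ‖d‖ ^ 2 * t₁ ^ 2 * t⁻¹ ^ 3 / 2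
      + inner ℝ d d₁ * t₁ * t⁻¹ ^ 2 - ‖d₁‖ ^ 2 * t⁻¹ / 2 - inner ℝ d d₂ * t⁻¹ / 2 := by
    unfold gaussRateDeriv; field_simp
  have hin : |inner ℝ d d₁| ≤ D * B := (abs_real_inner_le_norm d d₁).trans (by gcongr)
  have hin' : |inner ℝ d d₂| ≤ D * B := (abs_real_inner_le_norm d d₂).trans (by gcongr)
  have hi1 : |t⁻¹| ≤ c := by rwa [abs_of_pos hi]
  rw [e]
  refine (abs_sub _ _).trans (add_le_add ((abs_sub _ _).trans (add_le_add ((abs_add_le _ _).trans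
    (add_le_add ((abs_sub _ _).trans (add_le_add ((abs_add_le _ _).trans (add_le_add
    ((abs_add_le _ _).trans (add_le_add ?_ ?_)) ?_)) ?_)) ?_)) ?_)) ?_) <;>
  · simp only [abs_neg, abs_div, abs_mul, abs_pow, Nat.abs_ofNat, Nat.abs_cast, abs_norm]
    gcongr

/-- Polynomials times Gaussian weights decay exponentially, uniformly in the parameters. -/
lemma exists_gaussWeight_le (n k : ℕ) {t₀ : ℝ} (ht₀ : 0 < t₀) (B : ℝ) :
    ∃ C, 0 ≤ C ∧ ∀ (x z : 𝔼 N) (t : ℝ), t₀ / 2 ≤ t → t ≤ 2 * t₀ → ‖x‖ ≤ B →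
      (1 + ‖z‖) ^ k * gaussWeight n x t z ≤ C * Real.exp (-‖z‖) := by
  refine ⟨(4 * Real.pi * (t₀ / 2)) ^ (-(n:ℝ) / 2) * Real.exp (2 * B + 8 * t₀) *
    (k.factorial * Real.exp 1), by positivity, fun x z t h1 h2 hx => ?_⟩
  have ht : 0 < t := by linarith
  have e1 : (4 * Real.pi * t) ^ (-(n:ℝ) / 2) ≤ (4 * Real.pi * (t₀ / 2)) ^ (-(n:ℝ) / 2) := by
    refine Real.rpow_le_rpow_of_nonpos (by positivity) (by gcongr) ?_
    have : (0:ℝ) ≤ n := n.cast_nonneg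
    linarith
  -- The square `(‖z - x‖ - 8t₀)² ≥ 0` turns Gaussian decay into `e^{-2‖z‖}`. One factor `e^{-‖z‖}`
  -- absorbs the polynomial, and the other remains in the bound.
  have e2 : -‖z - x‖ ^ 2 / (4 * t) ≤ (2 * B + 8 * t₀) + -(2 * ‖z‖) := by
    have h3 : ‖z‖ - B ≤ ‖z - x‖ := by
      have := norm_sub_norm_le z x
      linarith
    have h4 : ‖z - x‖ ^ 2 / (8 * t₀) ≤ ‖z - x‖ ^ 2 / (4 * t) := by
      exact div_le_div_of_nonneg_left (sq_nonneg _) (by positivity) (by linarith)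
    have h5 : 2 * ‖z - x‖ - 8 * t₀ ≤ ‖z - x‖ ^ 2 / (8 * t₀) := by
      rw [le_div_iff₀ (by positivity)]
      nlinarith [sq_nonneg (‖z - x‖ - 8 * t₀)]
    rw [neg_div]
    linarith
  have e3 : (1 + ‖z‖) ^ k ≤ k.factorial * Real.exp 1 * Real.exp ‖z‖ := by
    have h6 := Real.pow_div_factorial_le_exp (1 + ‖z‖) (by positivity) k
    rw [div_le_iff₀ (by positivity), Real.exp_add] at h6
    linarith
  calc (1 + ‖z‖) ^ k * gaussWeight n x t z
      ≤ (k.factorial * Real.exp 1 * Real.exp ‖z‖) *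
        ((4 * Real.pi * (t₀ / 2)) ^ (-(n:ℝ) / 2) *
          Real.exp ((2 * B + 8 * t₀) + -(2 * ‖z‖))) := by
        unfold gaussWeight
        gcongr
    _ = _ := by
        rw [Real.exp_add (2 * B + 8 * t₀), show -(2 * ‖z‖) = -‖z‖ + -‖z‖ by ring,
          Real.exp_add (-‖z‖)]
        have : Real.exp ‖z‖ * Real.exp (-‖z‖) = 1 := by rw [← Real.exp_add]; simp
        generalize Real.exp (2 * B + 8 * t₀) = a
        generalize Real.exp ‖z‖ = b at *
        generalize Real.exp (-‖z‖) = c at *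
        linear_combination (k.factorial * Real.exp 1) * (4 * Real.pi * (t₀ / 2)) ^ (-(n:ℝ) / 2) *
          a * c * this

end GaussBounds

/-! ### Integrability from polynomial volume growth -/

section Growth

open MeasureTheory Set

variable {n N : ℕ} {M : Type*} [TopologicalSpace M] [ChartedSpace (𝔼 n) M]
  [IsManifold (𝓡 n) ∞ M] [MeasurableSpace M] [BorelSpace M] {F : M → 𝔼 N}

lemma summable_rpow_mul_exp_neg (C₁ C₂ d : ℝ) :
    Summable fun k : ℕ => Real.exp (-k) * (|C₁| * ((k:ℝ) + 1) ^ d + C₂) := by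
  have h1 : ∀ m : ℕ, Summable fun k : ℕ => ((k:ℝ) + 1) ^ m * Real.exp (-k) := by
    intro m
    have h := (summable_nat_add_iff 1).2 (Real.summable_pow_mul_exp_neg_nat_mul m one_pos)
    refine (h.mul_left (Real.exp 1)).congr fun k => ?_
    push_cast
    rw [show Real.exp (-k) = Real.exp 1 * Real.exp (-1 * ((k:ℝ) + 1)) by
      rw [← Real.exp_add]; ring_nf]
    ring
  have h2 : Summable fun k : ℕ => ((k:ℝ) + 1) ^ d * Real.exp (-k) := by
    refine Summable.of_nonneg_of_le (fun k => by positivity) (fun k => ?_) (h1 ⌈d⌉₊)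
    gcongr
    rw [← Real.rpow_natCast]
    exact Real.rpow_le_rpow_of_exponent_le (by linarith [(k.cast_nonneg : (0:ℝ) ≤ k)])
      (Nat.le_ceil d)
  refine ((h2.mul_left |C₁|).add ((h1 0).mul_left C₂)).congr fun k => ?_
  ring

/-- On the region where `⌊‖F‖⌋ = k` the integrand is at most `e^{-k}`, and that region lies in a
ball of radius `k + 1`. Polynomial volume then leaves a convergent series. -/
lemma integrable_exp_neg_norm (hF : Smooth n F) (hg : HasPolynomialVolumeGrowth n F) :
    Integrable (fun p => Real.exp (-‖F p‖)) (inducedVolume n F) := by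
  obtain ⟨C₁, C₂, d, hC₁, hC₂, hd, h⟩ := hg
  refine ⟨(hF.continuous.norm.neg.rexp).aestronglyMeasurable, ?_⟩
  rw [hasFiniteIntegral_iff_ofReal (Filter.Eventually.of_forall fun p => (Real.exp_pos _).le)]
  have hmeas : ∀ k : ℕ, MeasurableSet {p | ‖F p‖ < (k:ℝ) + 1} := fun k =>
    (isOpen_lt hF.continuous.norm continuous_const).measurableSet
  -- The single term `k = ⌊‖F p‖⌋` already dominates.
  have h1 : ∀ p, ENNReal.ofReal (Real.exp (-‖F p‖)) ≤
      ∑' k : ℕ, {p | ‖F p‖ < (k:ℝ) + 1}.indicator (fun _ => ENNReal.ofReal (Real.exp (-k))) p := by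
    intro p
    refine le_trans ?_ (ENNReal.le_tsum ⌊‖F p‖⌋₊)
    rw [indicator_of_mem (show p ∈ {q | ‖F q‖ < (⌊‖F p‖⌋₊ : ℝ) + 1} from
      Nat.lt_floor_add_one ‖F p‖)]
    exact ENNReal.ofReal_le_ofReal (Real.exp_le_exp.2 (neg_le_neg (Nat.floor_le (norm_nonneg _))))
  calc ∫⁻ p, ENNReal.ofReal (Real.exp (-‖F p‖)) ∂(inducedVolume n F)
      ≤ ∫⁻ p, ∑' k : ℕ, {p | ‖F p‖ < (k:ℝ) + 1}.indicator
          (fun _ => ENNReal.ofReal (Real.exp (-k))) p ∂(inducedVolume n F) := lintegral_mono h1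
    _ = ∑' k : ℕ, ENNReal.ofReal (Real.exp (-k)) *
          inducedVolume n F {p | ‖F p‖ < (k:ℝ) + 1} := by
        rw [lintegral_tsum fun k => (measurable_const.indicator (hmeas k)).aemeasurable]
        refine tsum_congr fun k => ?_
        rw [lintegral_indicator_const (hmeas k)]
    _ ≤ ∑' k : ℕ, ENNReal.ofReal (Real.exp (-k) * (|C₁| * ((k:ℝ) + 1) ^ d + C₂)) := by
        refine ENNReal.tsum_le_tsum fun k => ?_
        rw [ENNReal.ofReal_mul (Real.exp_pos _).le, abs_of_pos hC₁]
        gcongr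
        exact h _ (by positivity)
    _ < ⊤ := by
        have hs := summable_rpow_mul_exp_neg C₁ C₂ d
        rw [← ENNReal.ofReal_tsum_of_nonneg (fun k => by positivity) hs]
        exact ENNReal.ofReal_lt_top

lemma integrable_of_norm_le_exp (hF : Smooth n F) (hg : HasPolynomialVolumeGrowth n F) {g : M → ℝ}
    (hc : Continuous g) {C : ℝ} (hC : ∀ p, |g p| ≤ C * Real.exp (-‖F p‖)) :
    Integrable g (inducedVolume n F) :=
  ((integrable_exp_neg_norm hF hg).const_mul C).mono' hc.aestronglyMeasurable
    (Filter.Eventually.of_forall hC)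

lemma continuous_gaussWeight (n : ℕ) (x : 𝔼 N) (t : ℝ) : Continuous (gaussWeight n x t) := by
  unfold gaussWeight; fun_prop

/-- Functions of polynomial growth are integrable against Gaussian weights. -/
lemma integrable_mul_gaussWeight (hF : Smooth n F) (hg : HasPolynomialVolumeGrowth n F)
    (x₀ : 𝔼 N) {t₀ : ℝ} (ht₀ : 0 < t₀) {g : M → ℝ} (hc : Continuous g) (k : ℕ) {C : ℝ}
    (hC : ∀ p, |g p| ≤ C * (1 + ‖F p‖) ^ k) :
    Integrable (fun p => g p * gaussWeight n x₀ t₀ (F p)) (inducedVolume n F) := by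
  obtain ⟨C', -, hC'⟩ := exists_gaussWeight_le (N := N) n k ht₀ ‖x₀‖
  refine integrable_of_norm_le_exp hF hg
    (hc.mul ((continuous_gaussWeight n x₀ t₀).comp hF.continuous)) (C := |C| * C') fun p => ?_
  have hG := (gaussWeight_pos n ht₀ x₀ (F p)).le
  rw [abs_mul, abs_of_nonneg hG]
  calc |g p| * gaussWeight n x₀ t₀ (F p) ≤ (|C| * (1 + ‖F p‖) ^ k) * gaussWeight n x₀ t₀ (F p) := by
        gcongr
        exact (hC p).trans (by gcongr; exact le_abs_self C)
    _ = |C| * ((1 + ‖F p‖) ^ k * gaussWeight n x₀ t₀ (F p)) := by ring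
    _ ≤ |C| * (C' * Real.exp (-‖F p‖)) := by
        refine mul_le_mul_of_nonneg_left ?_ (abs_nonneg C)
        exact hC' x₀ (F p) t₀ (by linarith) (by linarith) le_rfl
    _ = _ := by ring

end Growth

/-! ### Rules for the weighted divergence -/

section WeightedDivergence

variable {n N : ℕ} {M : Type*} [TopologicalSpace M] [ChartedSpace (𝔼 n) M]
  [IsManifold (𝓡 n) ∞ M] {F : M → 𝔼 N} {x₀ : 𝔼 N} {t₀ : ℝ}

lemma wdiv_add {V W : M → 𝔼 N} (hV : Smooth n V) (hW : Smooth n W) (p : M) :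
    wdiv n F x₀ t₀ (fun q => V q + W q) p = wdiv n F x₀ t₀ V p + wdiv n F x₀ t₀ W p := by
  rw [wdiv, hV.tder_add hW, map_add, inner_add_right, wdiv, wdiv]
  ring

lemma wdiv_smul {φ : M → ℝ} {W : M → 𝔼 N} (hφ : Smooth n φ) (hW : Smooth n W) (p : M) :
    wdiv n F x₀ t₀ (fun q => φ q • W q) p = φ p * wdiv n F x₀ t₀ W p + tder n F φ p (W p) := by
  have h : tder n F (fun q => φ q • W q) p =
      φ p • tder n F W p + (tder n F φ p).smulRight (W p) := by
    ext1 v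
    rw [hφ.tder_smul hW]; rfl
  rw [wdiv, h, map_add, map_smul, traceL_smulRight, inner_smul_right, wdiv, smul_eq_mul]
  ring

lemma wdiv_const (y : 𝔼 N) (p : M) :
    wdiv n F x₀ t₀ (fun _ => y) p = -(1 / (2 * t₀) * inner ℝ (F p - x₀) y) := by
  rw [wdiv, tder_const, map_zero, zero_sub]

lemma Smooth.sub_const {u : M → 𝔼 N} (hu : Smooth n u) (a : 𝔼 N) :
    Smooth n (fun q => u q - a) := hu.sub contMDiff_const

lemma tder_sub_const (hF : Smooth n F) (p : M) :
    tder n F (fun q => F q - x₀) p = tder n F F p := by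
  rw [hF.tder_sub contMDiff_const, tder_const, sub_zero]

lemma wdiv_position (hF : IsSmoothImmersion n F) (p : M) :
    wdiv n F x₀ t₀ (fun q => F q - x₀) p = n - 1 / (2 * t₀) * ‖F p - x₀‖ ^ 2 := by
  rw [wdiv, tder_sub_const hF.sm, traceL_tder_self hF, real_inner_self_eq_norm_sq]

lemma wdiv_quadratic_smul (hF : IsSmoothImmersion n F) (a b c : ℝ) (y : 𝔼 N) {W : M → 𝔼 N}
    (hW : Smooth n W) (p : M) :
    wdiv n F x₀ t₀ (fun q => (a + b * ‖F q - x₀‖ ^ 2 + c * inner ℝ (F q - x₀) y) • W q) p =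
      (a + b * ‖F p - x₀‖ ^ 2 + c * inner ℝ (F p - x₀) y) * wdiv n F x₀ t₀ W p
        + 2 * b * inner ℝ (F p - x₀) (tder n F F p (W p))
        + c * inner ℝ (tder n F F p (W p)) y := by
  have hx : HasFDerivAt (fun z : 𝔼 N => z - x₀) (ContinuousLinearMap.id ℝ _) (F p) :=
    (hasFDerivAt_id _).sub_const x₀
  have h1 := (((hx.norm_sq).const_mul b).const_add a).add
    ((hx.inner ℝ (hasFDerivAt_const y (F p))).const_mul c)
  have hs : Smooth n (fun q => a + b * ‖F q - x₀‖ ^ 2 + c * inner ℝ (F q - x₀) y) := by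
    have hx := hF.sm.sub_const x₀
    have h2 : Smooth n (fun q => ‖F q - x₀‖ ^ 2) := by
      refine (hx.inner hx).congr fun q => ?_
      rw [real_inner_self_eq_norm_sq]
    exact (contMDiff_const.add (contMDiff_const.mul h2)).add
      (contMDiff_const.mul (hx.inner contMDiff_const))
  rw [wdiv_smul hs hW]
  have h3 := hF.sm.tder_comp (F := F) h1
  have h4 := congrArg (fun L : 𝔼 N →L[ℝ] ℝ => L (W p)) h3
  rw [show tder n F (fun q => a + b * ‖F q - x₀‖ ^ 2 + c * inner ℝ (F q - x₀) y) p (W p) = _ from h4]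
  simp only [ContinuousLinearMap.comp_apply, add_apply, smul_apply, innerSL_apply_apply,
    ContinuousLinearMap.id_apply, ContinuousLinearMap.prod_apply, fderivInnerCLM_apply, zero_apply,
    inner_zero_right, zero_add, smul_eq_mul, nsmul_eq_mul]
  push_cast
  ring

lemma smooth_gaussWeight (hF : Smooth n F) : Smooth n (fun p => gaussWeight n x₀ t₀ (F p)) := by
  have : ContDiff ℝ ∞ (gaussWeight (N := N) n x₀ t₀) := by
    unfold gaussWeight
    exact contDiff_const.mul (((contDiff_id.sub contDiff_const).norm_sq ℝ).neg.div_const _).exp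
  exact this.contMDiff.comp hF

/-- The gradient of `G` along the surface is `-G (x - x₀)^⊤ / (2t₀)`, so for tangent `W` the drift
in `wdiv` is the derivative of the weight: `div (G W) = G · wdiv W`. -/
lemma traceL_tder_gaussWeight_smul (hF : IsSmoothImmersion n F) {W : M → 𝔼 N}
    (hW : Smooth n W) {p : M} (hT : tder n F F p (W p) = W p) :
    traceL (𝔼 N) (tder n F (fun q => gaussWeight n x₀ t₀ (F q) • W q) p) =
      gaussWeight n x₀ t₀ (F p) * wdiv n F x₀ t₀ W p := by
  have hx : HasFDerivAt (fun z : 𝔼 N => z - x₀) (ContinuousLinearMap.id ℝ _) (F p) :=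
    (hasFDerivAt_id _).sub_const x₀
  have h1 : HasFDerivAt (gaussWeight n x₀ t₀) _ (F p) :=
    ((hx.norm_sq.neg.mul_const (4 * t₀)⁻¹).exp).const_mul ((4 * Real.pi * t₀) ^ (-(n : ℝ) / 2))
  have h3 := hF.sm.tder_comp (F := F) h1
  have h4 := congrArg (fun L : 𝔼 N →L[ℝ] ℝ => L (W p)) h3
  have h := wdiv_smul (F := F) (x₀ := x₀) (t₀ := t₀) (smooth_gaussWeight (x₀ := x₀) (t₀ := t₀) hF.sm)
    hW p
  rw [show tder n F (fun q => gaussWeight n x₀ t₀ (F q)) p (W p) = _ from h4] at h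
  simp only [ContinuousLinearMap.comp_apply, hT] at h
  rw [wdiv, sub_eq_iff_eq_add] at h
  rw [h, inner_smul_right, gaussWeight]
  simp only [neg_apply, smul_apply, innerSL_apply_apply, ContinuousLinearMap.comp_apply,
    ContinuousLinearMap.id_apply, smul_eq_mul, nsmul_eq_mul, Pi.neg_apply]
  push_cast
  rw [← div_eq_mul_inv]
  by_cases ht : t₀ = 0
  · simp [ht]
  field_simp
  ring

end WeightedDivergence

/-! ### The pointwise second variation identity -/

section SecondVariation

variable {n N : ℕ} {M : Type*} [TopologicalSpace M] [ChartedSpace (𝔼 n) M]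
  [IsManifold (𝓡 n) ∞ M] {F : M → 𝔼 N} {x₀ : 𝔼 N} {t₀ : ℝ}

/-- The integrand of the second variation formula. -/
def secondVariationDensity (n : ℕ) {M : Type*} [TopologicalSpace M] [ChartedSpace (𝔼 n) M]
    (F : M → 𝔼 N) (x₀ : 𝔼 N) (t₀ : ℝ) (X : M → 𝔼 N) (y : 𝔼 N) (h : ℝ) (p : M) : ℝ :=
  -inner ℝ (X p) (jacobiOp n F x₀ t₀ X p - (1 / t₀) • y + (2 / t₀ * h) • meanCurv n F p)
    - (1 / (2 * t₀) * ‖norPart n F p y‖ ^ 2 + 1 / t₀ * h ^ 2 * ‖meanCurv n F p‖ ^ 2)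

/-- The vector field whose weighted divergence collects the terms of the second variation that
depend on the variations of the centre and the time only. -/
def centreField (n : ℕ) {M : Type*} (F : M → 𝔼 N) (x₀ : 𝔼 N) (t₀ : ℝ) (y y₂ : 𝔼 N) (h h₂ : ℝ)
    (p : M) : 𝔼 N :=
  ((h ^ 2 * n / (4 * t₀ ^ 2) + h ^ 2 / (2 * t₀ ^ 2) - h₂ / (2 * t₀))
      + (-(h ^ 2 / (8 * t₀ ^ 3))) * ‖F p - x₀‖ ^ 2
      + (-(h / t₀ ^ 2)) * inner ℝ (F p - x₀) y) • (F p - x₀)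
    + ((2 * h / t₀ - h * n / t₀)
      + h / (2 * t₀ ^ 2) * ‖F p - x₀‖ ^ 2
      + (-(1 / (2 * t₀))) * inner ℝ (F p - x₀) y) • y
    + -y₂

lemma IsSelfShrinker.meanCurv_eq (hs : IsSelfShrinker n F x₀ t₀) (p : M) :
    meanCurv n F p = -((1 / (2 * t₀)) • norPart n F p (F p - x₀)) :=
  eq_neg_of_add_eq_zero_left (hs p)

/-- Both parts of the rate are weighted divergences, since `wdiv (x - x₀) = n - |x - x₀|²/(2t₀)` and
`wdiv y = -⟨x - x₀, y⟩/(2t₀)`. Products with quadratic coefficients therefore reproduce the square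
of the rate up to lower terms, while `h₂` and `y₂` enter linearly. The coefficients of `⟨x - x₀, y⟩
(x - x₀)` and `|x - x₀|² y` are fixed by two conditions: the cubic cross term of the square must
appear, and the tangential cross terms `⟨(x - x₀)^⊤, y⟩` must cancel. -/
lemma wdiv_centreField (hF : IsSmoothImmersion n F) (y y₂ : 𝔼 N) (h h₂ : ℝ) (ht₀ : t₀ ≠ 0) (p : M) :
    wdiv n F x₀ t₀ (centreField n F x₀ t₀ y y₂ h h₂) p =
      (h * (‖F p - x₀‖ ^ 2 / (4 * t₀ ^ 2) - n / (2 * t₀)) + inner ℝ (F p - x₀) y / (2 * t₀)) ^ 2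
      - inner ℝ (tder n F F p y) y / (2 * t₀)
      - h ^ 2 * inner ℝ (F p - x₀) (tder n F F p (F p - x₀)) / (4 * t₀ ^ 3)
      - h ^ 2 * ‖F p - x₀‖ ^ 2 / (4 * t₀ ^ 3) + n * h ^ 2 / (2 * t₀ ^ 2)
      - h * inner ℝ (F p - x₀) y / t₀ ^ 2
      + h₂ * (‖F p - x₀‖ ^ 2 / (4 * t₀ ^ 2) - n / (2 * t₀)) + inner ℝ (F p - x₀) y₂ / (2 * t₀) := by
  have hx := hF.sm.sub_const x₀
  have h2 : Smooth n (fun q => ‖F q - x₀‖ ^ 2) := by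
    refine (hx.inner hx).congr fun q => ?_
    rw [real_inner_self_eq_norm_sq]
  have hq : ∀ a b c : ℝ, Smooth n (fun q => a + b * ‖F q - x₀‖ ^ 2 + c * inner ℝ (F q - x₀) y) :=
    fun a b c => (contMDiff_const.add (contMDiff_const.mul h2)).add
      (contMDiff_const.mul (hx.inner contMDiff_const))
  have hy : Smooth n (fun _ : M => y) := contMDiff_const
  have hA : ∀ a b c : ℝ, Smooth n
      (fun q => (a + b * ‖F q - x₀‖ ^ 2 + c * inner ℝ (F q - x₀) y) • (F q - x₀)) :=
    fun a b c => (hq a b c).smul hx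
  have hB : ∀ a b c : ℝ, Smooth n
      (fun q => (a + b * ‖F q - x₀‖ ^ 2 + c * inner ℝ (F q - x₀) y) • y) :=
    fun a b c => (hq a b c).smul hy
  have hAB : ∀ a b c a' b' c' : ℝ, Smooth n
      (fun q => (a + b * ‖F q - x₀‖ ^ 2 + c * inner ℝ (F q - x₀) y) • (F q - x₀) +
        (a' + b' * ‖F q - x₀‖ ^ 2 + c' * inner ℝ (F q - x₀) y) • y) :=
    fun a b c a' b' c' => (hA a b c).add (hB a' b' c')
  unfold centreField
  rw [wdiv_add (hAB _ _ _ _ _ _) contMDiff_const, wdiv_add (hA _ _ _) (hB _ _ _), wdiv_quadratic_smul hF _ _ _ _ hx,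
    wdiv_quadratic_smul hF _ _ _ _ hy, wdiv_position hF, wdiv_const, wdiv_const, inner_neg_right]
  have e1 : inner ℝ (F p - x₀) (tder n F F p y) = inner ℝ (tder n F F p (F p - x₀)) y :=
    (inner_tder_self hF p _ _).symm
  rw [e1]
  field_simp
  ring

lemma smooth_centreField (hF : Smooth n F) (y y₂ : 𝔼 N) (h h₂ : ℝ) :
    Smooth n (centreField n F x₀ t₀ y y₂ h h₂) := by
  have hx := hF.sub_const x₀
  have h2 : Smooth n (fun q => ‖F q - x₀‖ ^ 2) := by
    refine (hx.inner hx).congr fun q => ?_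
    rw [real_inner_self_eq_norm_sq]
  have hq : ∀ a b c : ℝ, Smooth n (fun q => a + b * ‖F q - x₀‖ ^ 2 + c * inner ℝ (F q - x₀) y) :=
    fun a b c => (contMDiff_const.add (contMDiff_const.mul h2)).add
      (contMDiff_const.mul (hx.inner contMDiff_const))
  exact (((hq _ _ _).smul hx).add ((hq _ _ _).smul contMDiff_const)).add contMDiff_const

/-- The change `-⟨x - x₀, X⟩/(2t₀)` of the Gaussian and the change `-⟨X, H⟩` of the area cancel by
the shrinker equation, even pointwise. Only the motion of centre and time is left. -/
lemma normal_variation_rate (hF : IsSmoothImmersion n F) (hs : IsSelfShrinker n F x₀ t₀)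
    {X : M → 𝔼 N} (hX : Smooth n X) (hn : IsNormalField n F X) (y : 𝔼 N) (h : ℝ) (p : M) :
    gaussRate n t₀ h (F p - x₀) (X p - y) + traceL (𝔼 N) (tder n F X p) =
      h * (‖F p - x₀‖ ^ 2 / (4 * t₀ ^ 2) - n / (2 * t₀)) + inner ℝ (F p - x₀) y / (2 * t₀) := by
  have e1 : inner ℝ (X p) (tder n F F p (F p - x₀)) = 0 := by
    rw [← inner_tder_self hF, hn p, inner_zero_left]
  rw [hn.traceL_tder hF hX, hs.meanCurv_eq, norPart_eq hF, inner_neg_right, inner_smul_right,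
    inner_sub_right (X p), e1, gaussRate, inner_sub_right, real_inner_comm (X p)]
  ring

/-- The second derivative of the weighted density differs from the integrand of the second
variation formula by a weighted divergence. -/
lemma second_variation_pointwise (hF : IsSmoothImmersion n F) (hs : IsSelfShrinker n F x₀ t₀)
    (ht₀ : t₀ ≠ 0) {X Z : M → 𝔼 N} (hX : Smooth n X) (hn : IsNormalField n F X) (hZ : Smooth n Z)
    (y y₂ : 𝔼 N) (h h₂ : ℝ) (p : M) :
    (gaussRate n t₀ h (F p - x₀) (X p - y) + traceL (𝔼 N) (tder n F X p)) ^ 2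
      + (gaussRateDeriv n t₀ h h₂ (F p - x₀) (X p - y) (Z p - y₂)
        + (traceL (𝔼 N) (tder n F Z p)
          + traceL (𝔼 N) (tder n F X p ∘L ContinuousLinearMap.adjoint (tder n F X p))
          - traceL (𝔼 N) (tder n F F p ∘L
              (tder n F X p ∘L ContinuousLinearMap.adjoint (tder n F X p)))
          - traceL (𝔼 N) (tder n F X p ∘L tder n F X p))) =
      secondVariationDensity n F x₀ t₀ X y h p + wdiv n F x₀ t₀
        (fun q => Z q + gradHalfSq n F X q + centreField n F x₀ t₀ y y₂ h h₂ q) p := by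
  have hS := smooth_gradHalfSq hF hX
  have hZS : Smooth n (fun q => Z q + gradHalfSq n F X q) := hZ.add hS
  rw [normal_variation_rate hF hs hX hn, wdiv_add hZS (smooth_centreField hF.sm _ _ _ _),
    wdiv_add hZ hS, wdiv_centreField hF _ _ _ _ ht₀]
  have e1 : inner ℝ (X p) (tder n F F p (F p - x₀)) = 0 := by
    rw [← inner_tder_self hF, hn p, inner_zero_left]
  -- The Bochner identity in trace form, to be matched with the traces from the area element.
  have e2 := inner_jacobiOp hF x₀ t₀ hX hn p
  rw [sqPairing_eq_trace hF hX hn, normSqNormalConn_eq hF hX] at e2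
  have e3 : wdiv n F x₀ t₀ Z p =
    traceL _ (tder n F Z p) - 1 / (2 * t₀) * inner ℝ (F p - x₀) (Z p) := rfl
  have nor : ∀ v, ‖norPart n F p v‖ ^ 2 = ‖v‖ ^ 2 - inner ℝ v (tder n F F p v) := by
    intro v
    rw [norPart_eq hF, norm_sub_sq_real, ← real_inner_self_eq_norm_sq (tder n F F p v),
      inner_tder_self hF, tder_tder_self hF]
    ring
  -- The shrinker equation expresses `|H|²` and `⟨X, H⟩` through the position vector, after which
  -- the claim is an identity between scalar expressions.
  have e4 : ‖meanCurv n F p‖ ^ 2 =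
      (‖F p - x₀‖ ^ 2 - inner ℝ (F p - x₀) (tder n F F p (F p - x₀))) / (4 * t₀ ^ 2) := by
    rw [hs.meanCurv_eq, norm_neg, norm_smul, mul_pow, nor, Real.norm_eq_abs, sq_abs]
    field_simp
    ring
  have e5 : inner ℝ (X p) (meanCurv n F p) = -(inner ℝ (F p - x₀) (X p) / (2 * t₀)) := by
    rw [hs.meanCurv_eq, norPart_eq hF, inner_neg_right, inner_smul_right, inner_sub_right (X p), e1,
      real_inner_comm (X p)]
    ring
  have e6 : ‖X p - y‖ ^ 2 = ‖X p‖ ^ 2 - 2 * inner ℝ (X p) y + ‖y‖ ^ 2 := norm_sub_sq_real _ _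
  rw [secondVariationDensity, inner_add_right, inner_sub_right, inner_smul_right, inner_smul_right,
    e5, e4, nor, gaussRateDeriv, e6, inner_sub_right (F p - x₀), inner_sub_right (F p - x₀),
    real_inner_comm (tder n F F p y) y, e2, e3]
  field_simp
  ring

end SecondVariation

/-! ### Continuity and Gaussian integrability of the terms; weighted divergence theorem -/

section WeightedIntegrals

open MeasureTheory Set

variable {n N : ℕ} {M : Type*} [TopologicalSpace M] [ChartedSpace (𝔼 n) M]
  [IsManifold (𝓡 n) ∞ M] {F : M → 𝔼 N} {x₀ : 𝔼 N} {t₀ : ℝ}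

lemma continuous_traceL_tder (hF : IsSmoothImmersion n F) {W : M → 𝔼 N} (hW : Smooth n W) :
    Continuous fun p => traceL (𝔼 N) (tder n F W p) :=
  (traceL (𝔼 N)).continuous.comp (smooth_tder hF hW).continuous

lemma continuous_wdiv (hF : IsSmoothImmersion n F) {W : M → 𝔼 N} (hW : Smooth n W) :
    Continuous (wdiv n F x₀ t₀ W) :=
  (continuous_traceL_tder hF hW).sub
    (continuous_const.mul ((hF.sm.continuous.sub continuous_const).inner hW.continuous))

lemma continuous_normSqNormalConn (hF : IsSmoothImmersion n F) {X : M → 𝔼 N} (hX : Smooth n X) :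
    Continuous (normSqNormalConn n F X) := by
  have h := (smooth_tder hF hX).continuous
  have ha : Continuous fun p => ContinuousLinearMap.adjoint (tder n F X p) :=
    (ContinuousLinearMap.adjoint (𝕜 := ℝ) (E := 𝔼 N) (F := 𝔼 N)).continuous.comp h
  have hP := (smooth_tder_self hF).continuous
  rw [show normSqNormalConn n F X = _ from funext (normSqNormalConn_eq hF hX)]
  exact ((traceL (𝔼 N)).continuous.comp (h.clm_comp ha)).sub
    ((traceL (𝔼 N)).continuous.comp (hP.clm_comp (h.clm_comp ha)))

/-- Continuity is read off from the Bochner identity, whose terms are traces; the definition of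
`jacobiOp` uses frames that need not depend continuously on the point. -/
lemma continuous_inner_jacobiOp (hF : IsSmoothImmersion n F) {X : M → 𝔼 N} (hX : Smooth n X)
    (hn : IsNormalField n F X) :
    Continuous fun p => inner ℝ (X p) (jacobiOp n F x₀ t₀ X p) := by
  have h := (smooth_tder hF hX).continuous
  have hs : Continuous (sqPairing n F X) := by
    rw [show sqPairing n F X = _ from funext (sqPairing_eq_trace hF hX hn)]
    exact (traceL (𝔼 N)).continuous.comp (h.clm_comp h)
  rw [show (fun p => inner ℝ (X p) (jacobiOp n F x₀ t₀ X p)) = _ from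
    funext (inner_jacobiOp hF x₀ t₀ hX hn)]
  exact (((continuous_wdiv hF (smooth_gradHalfSq hF hX)).sub
    (continuous_normSqNormalConn hF hX)).add hs).add (continuous_const.mul (hX.continuous.norm.pow 2))

lemma norm_tder_self_le (hF : IsSmoothImmersion n F) (p : M) (v : 𝔼 N) :
    ‖tder n F F p v‖ ≤ ‖v‖ := by
  rw [← tanPart_eq hF]
  exact Submodule.norm_starProjection_apply_le _ _

lemma norm_norPart_le (p : M) (v : 𝔼 N) : ‖norPart n F p v‖ ≤ ‖v‖ :=
  Submodule.norm_starProjection_apply_le _ _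

lemma continuous_norPart (hF : IsSmoothImmersion n F) {v : M → 𝔼 N} (hv : Continuous v) :
    Continuous fun p => norPart n F p (v p) := by
  simp only [norPart_eq hF]
  exact hv.sub ((smooth_tder_self hF).continuous.clm_apply hv)

lemma IsSelfShrinker.continuous_meanCurv (hs : IsSelfShrinker n F x₀ t₀)
    (hF : IsSmoothImmersion n F) : Continuous (meanCurv n F) := by
  rw [show meanCurv n F = _ from funext hs.meanCurv_eq]
  have h := continuous_norPart hF (hF.sm.continuous.sub (continuous_const (y := x₀)))
  exact (h.const_smul (1 / (2 * t₀))).neg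

lemma IsSelfShrinker.norm_meanCurv_le (hs : IsSelfShrinker n F x₀ t₀) (p : M) :
    ‖meanCurv n F p‖ ≤ |1 / (2 * t₀)| * ‖F p - x₀‖ := by
  rw [hs.meanCurv_eq, norm_neg, norm_smul, Real.norm_eq_abs]
  gcongr
  exact norm_norPart_le p _

/-- Cauchy-Schwarz for `⟨X, ∇_e X⟩` in each frame direction. It makes `½ grad |X|²` integrable as
soon as `X` and `∇X` are square integrable. -/
lemma norm_gradHalfSq_sq_le (hF : IsSmoothImmersion n F) {X : M → 𝔼 N} (hX : Smooth n X)
    (hn : IsNormalField n F X) (p : M) :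
    ‖gradHalfSq n F X p‖ ^ 2 ≤ ‖X p‖ ^ 2 * normSqNormalConn n F X p := by
  have h1 := frameSum_sq hF p (gradHalfSq n F X p)
  rw [tder_self_gradHalfSq hF] at h1
  rw [← h1, normSqNormalConn, frameSum, frameSum, Finset.mul_sum]
  refine Finset.sum_le_sum fun i _ => ?_
  have he := frame_mem n F p i
  set e : 𝔼 N := ↑(stdOrthonormalBasis ℝ (tangentPlane n F p) i)
  have h2 : inner ℝ (gradHalfSq n F X p) e = inner ℝ (X p) (normalConn n F X p e) := by
    rw [real_inner_comm, inner_gradHalfSq, normalConn_eq hF hX he, inner_sub_right,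
      ← inner_tder_self hF, hn p, inner_zero_left, sub_zero, real_inner_comm]
  rw [h2, ← mul_pow, ← sq_abs]
  gcongr
  exact abs_real_inner_le_norm _ _

lemma normSqNormalConn_nonneg (F X : M → 𝔼 N) (p : M) : 0 ≤ normSqNormalConn n F X p := by
  unfold normSqNormalConn frameSum
  exact Finset.sum_nonneg fun _ _ => sq_nonneg _

lemma norm_quadratic_smul_le (a b c : ℝ) (x y w : 𝔼 N) :
    ‖(a + b * ‖x‖ ^ 2 + c * inner ℝ x y) • w‖ ≤
      (|a| + |b| + |c| * ‖y‖) * (1 + ‖x‖) ^ 2 * ‖w‖ := by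
  rw [norm_smul, Real.norm_eq_abs]
  gcongr
  have hx := norm_nonneg x
  calc |a + b * ‖x‖ ^ 2 + c * inner ℝ x y|
      ≤ |a| * 1 + |b| * ‖x‖ ^ 2 + |c| * (‖x‖ * ‖y‖) := by
        refine (abs_add_three _ _ _).trans ?_
        rw [abs_mul, abs_mul, abs_of_nonneg (sq_nonneg ‖x‖), mul_one]
        gcongr
        exact abs_real_inner_le_norm x y
    _ ≤ |a| * (1 + ‖x‖) ^ 2 + |b| * (1 + ‖x‖) ^ 2 + |c| * ((1 + ‖x‖) ^ 2 * ‖y‖) := by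
        gcongr <;> nlinarith
    _ = _ := by ring

lemma exists_norm_centreField_le (F : M → 𝔼 N) (x₀ : 𝔼 N) (t₀ : ℝ) (y y₂ : 𝔼 N) (h h₂ : ℝ) :
    ∃ K, ∀ p, ‖centreField n F x₀ t₀ y y₂ h h₂ p‖ ≤ K * (1 + ‖F p‖) ^ 3 := by
  have key : ∀ a b c a' b' c' : ℝ, ∃ K, ∀ z : 𝔼 N,
      ‖(a + b * ‖z - x₀‖ ^ 2 + c * inner ℝ (z - x₀) y) • (z - x₀)
        + (a' + b' * ‖z - x₀‖ ^ 2 + c' * inner ℝ (z - x₀) y) • y + -y₂‖ ≤ K * (1 + ‖z‖) ^ 3 := by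
    intro a b c a' b' c'
    refine ⟨((|a| + |b| + |c| * ‖y‖) + (|a'| + |b'| + |c'| * ‖y‖) * ‖y‖ + ‖y₂‖) * (1 + ‖x₀‖) ^ 3,
      fun z => ?_⟩
    set D := 1 + ‖z - x₀‖ with hD
    have hD1 : 1 ≤ D := by have := norm_nonneg (z - x₀); linarith
    have hDz : D ≤ (1 + ‖x₀‖) * (1 + ‖z‖) := by
      have := norm_sub_le z x₀
      nlinarith [mul_nonneg (norm_nonneg x₀) (norm_nonneg z)]
    calc _ ≤ (|a| + |b| + |c| * ‖y‖) * D ^ 2 * D + (|a'| + |b'| + |c'| * ‖y‖) * D ^ 3 * ‖y‖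
          + ‖y₂‖ * D ^ 3 := by
          refine norm_add₃_le.trans ?_
          rw [norm_neg]
          gcongr
          · refine (norm_quadratic_smul_le a b c _ y _).trans ?_
            gcongr
            linarith
          · refine (norm_quadratic_smul_le a' b' c' _ y _).trans ?_
            gcongr
            norm_num
          · exact le_mul_of_one_le_right (norm_nonneg _) (one_le_pow₀ hD1)
      _ = ((|a| + |b| + |c| * ‖y‖) + (|a'| + |b'| + |c'| * ‖y‖) * ‖y‖ + ‖y₂‖) * D ^ 3 := by ring
      _ ≤ ((|a| + |b| + |c| * ‖y‖) + (|a'| + |b'| + |c'| * ‖y‖) * ‖y‖ + ‖y₂‖) *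
          ((1 + ‖x₀‖) * (1 + ‖z‖)) ^ 3 := by gcongr
      _ = _ := by ring
  obtain ⟨K, hK⟩ := key _ _ _ _ _ _
  exact ⟨K, fun p => hK (F p)⟩

variable [MeasurableSpace M] [BorelSpace M]

lemma integrable_of_abs_le_mul_gaussWeight (hF : Smooth n F) (ht₀ : 0 < t₀) {f b : M → ℝ}
    (hf : Continuous f)
    (hb : Integrable (fun p => b p * gaussWeight n x₀ t₀ (F p)) (inducedVolume n F))
    (h : ∀ p, |f p| ≤ b p) :
    Integrable (fun p => f p * gaussWeight n x₀ t₀ (F p)) (inducedVolume n F) := by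
  refine hb.mono' (hf.mul ((continuous_gaussWeight n x₀ t₀).comp
    hF.continuous)).aestronglyMeasurable (Filter.Eventually.of_forall fun p => ?_)
  rw [norm_mul, Real.norm_of_nonneg (gaussWeight_pos n ht₀ x₀ (F p)).le]
  exact mul_le_mul_of_nonneg_right (h p) (gaussWeight_pos n ht₀ x₀ (F p)).le

/-- The divergence theorem for the weighted divergence on a complete self-shrinker. -/
theorem integral_wdiv_eq_zero [T2Space M] [SecondCountableTopology M]
    (hF : IsSmoothImmersion n F) (hc : IsCompleteSurface n F) (hs : IsSelfShrinker n F x₀ t₀)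
    (ht₀ : 0 < t₀) {W : M → 𝔼 N} (hW : Smooth n W)
    (hWi : Integrable (fun p => ‖tder n F F p (W p)‖ * gaussWeight n x₀ t₀ (F p))
      (inducedVolume n F))
    (hdi : Integrable (fun p => wdiv n F x₀ t₀ W p * gaussWeight n x₀ t₀ (F p))
      (inducedVolume n F)) :
    ∫ p, wdiv n F x₀ t₀ W p * gaussWeight n x₀ t₀ (F p) ∂(inducedVolume n F) = 0 := by
  have hPW : Smooth n fun q => tder n F F q (W q) := ContMDiff.clm_apply (smooth_tder_self hF) hW
  have hV : Smooth n fun q => gaussWeight n x₀ t₀ (F q) • tder n F F q (W q) :=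
    (smooth_gaussWeight hF.sm).smul hPW
  have hdiv : ∀ p, traceL (𝔼 N) (tder n F (fun q => gaussWeight n x₀ t₀ (F q) • tder n F F q (W q)) p)
      = wdiv n F x₀ t₀ W p * gaussWeight n x₀ t₀ (F p) := fun p => by
    rw [traceL_tder_gaussWeight_smul hF hPW (tder_tder_self hF F p _), wdiv_tder_self hF hs hW,
      mul_comm]
  have h := integral_divergence_eq_zero hF hc hV (fun p => by
    rw [map_smul, tder_tder_self hF]) ?_ ?_
  · simpa only [hdiv] using h
  · refine hWi.congr (Filter.Eventually.of_forall fun p => ?_)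
    simp only [norm_smul, Real.norm_of_nonneg (gaussWeight_pos n ht₀ x₀ (F p)).le, mul_comm]
  · simpa only [hdiv] using hdi

variable (hF : IsSmoothImmersion n F) (hs : IsSelfShrinker n F x₀ t₀) (ht₀ : 0 < t₀)
  (hg : HasPolynomialVolumeGrowth n F) {X Z : M → 𝔼 N} (hX : Smooth n X)
  (hn : IsNormalField n F X) (hZ : Smooth n Z)
  (hX2 : Integrable (fun p => ‖X p‖ ^ 2 * gaussWeight n x₀ t₀ (F p)) (inducedVolume n F))
  (hXL : Integrable (fun p => inner ℝ (X p) (jacobiOp n F x₀ t₀ X p) * gaussWeight n x₀ t₀ (F p))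
    (inducedVolume n F))

include hF hg ht₀

lemma integrable_const_mul_gaussWeight (a : ℝ) :
    Integrable (fun p => a * gaussWeight n x₀ t₀ (F p)) (inducedVolume n F) :=
  integrable_mul_gaussWeight hF.sm hg x₀ ht₀ continuous_const 0 (C := |a|) fun p => by simp

lemma integrable_normSq_mul_gaussWeight :
    Integrable (fun p => ‖F p - x₀‖ ^ 2 * gaussWeight n x₀ t₀ (F p)) (inducedVolume n F) := by
  refine integrable_mul_gaussWeight hF.sm hg x₀ ht₀
    ((hF.sm.continuous.sub continuous_const).norm.pow 2) 2 (C := (1 + ‖x₀‖) ^ 2) fun p => ?_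
  rw [abs_of_nonneg (by positivity), ← mul_pow]
  gcongr
  have := norm_sub_le (F p) x₀
  nlinarith [norm_nonneg (F p), norm_nonneg x₀, mul_nonneg (norm_nonneg (F p)) (norm_nonneg x₀)]

include hs

lemma integrable_centre_terms (y : 𝔼 N) (h : ℝ) :
    Integrable (fun p => (1 / (2 * t₀) * ‖norPart n F p y‖ ^ 2
      + 1 / t₀ * h ^ 2 * ‖meanCurv n F p‖ ^ 2) * gaussWeight n x₀ t₀ (F p)) (inducedVolume n F) := by
  have h1 : Integrable (fun p => (1 / (2 * t₀) * ‖y‖ ^ 2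
      + 1 / t₀ * h ^ 2 * (|1 / (2 * t₀)| ^ 2 * ‖F p - x₀‖ ^ 2)) * gaussWeight n x₀ t₀ (F p))
      (inducedVolume n F) := by
    refine ((integrable_const_mul_gaussWeight (x₀ := x₀) hF ht₀ hg (1 / (2 * t₀) * ‖y‖ ^ 2)).add
      ((integrable_normSq_mul_gaussWeight (x₀ := x₀) hF ht₀ hg).const_mul
        (1 / t₀ * h ^ 2 * |1 / (2 * t₀)| ^ 2))).congr (Filter.Eventually.of_forall fun p => ?_)
    simp only [Pi.add_apply]
    ring
  refine integrable_of_abs_le_mul_gaussWeight hF.sm ht₀ ?_ h1 fun p => ?_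
  · exact (continuous_const.mul ((continuous_norPart hF continuous_const).norm.pow 2)).add
      (continuous_const.mul ((hs.continuous_meanCurv hF).norm.pow 2))
  · rw [abs_of_nonneg (by positivity), ← mul_pow]
    gcongr
    · exact norm_norPart_le p y
    · exact hs.norm_meanCurv_le p

include hX hX2 hXL

lemma integrable_normal_terms (y : 𝔼 N) (h : ℝ) :
    Integrable (fun p => inner ℝ (X p) (jacobiOp n F x₀ t₀ X p - (1 / t₀) • y
        + (2 / t₀ * h) • meanCurv n F p) * gaussWeight n x₀ t₀ (F p)) (inducedVolume n F) := by
  have hy : Integrable (fun p => inner ℝ (X p) y * gaussWeight n x₀ t₀ (F p))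
      (inducedVolume n F) := by
    refine integrable_of_abs_le_mul_gaussWeight hF.sm ht₀ (hX.continuous.inner continuous_const)
      (b := fun p => ‖X p‖ ^ 2 + ‖y‖ ^ 2) ?_ fun p => ?_
    · refine (hX2.add (integrable_const_mul_gaussWeight (x₀ := x₀) hF ht₀ hg (‖y‖ ^ 2))).congr
        (Filter.Eventually.of_forall fun p => ?_)
      simp only [Pi.add_apply]; ring
    · refine (abs_real_inner_le_norm _ _).trans ?_
      nlinarith [sq_nonneg (‖X p‖ - ‖y‖), sq_nonneg ‖X p‖, sq_nonneg ‖y‖]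
  have hH : Integrable (fun p => inner ℝ (X p) (meanCurv n F p) * gaussWeight n x₀ t₀ (F p))
      (inducedVolume n F) := by
    refine integrable_of_abs_le_mul_gaussWeight hF.sm ht₀
      (hX.continuous.inner (hs.continuous_meanCurv hF))
      (b := fun p => ‖X p‖ ^ 2 + |1 / (2 * t₀)| ^ 2 * ‖F p - x₀‖ ^ 2) ?_ fun p => ?_
    · refine (hX2.add ((integrable_normSq_mul_gaussWeight (x₀ := x₀) hF ht₀ hg).const_mul
        (|1 / (2 * t₀)| ^ 2))).congr (Filter.Eventually.of_forall fun p => ?_)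
      simp only [Pi.add_apply]; ring
    · refine (abs_real_inner_le_norm _ _).trans ?_
      have h1 := hs.norm_meanCurv_le p
      have h2 : ‖meanCurv n F p‖ ^ 2 ≤ |1 / (2 * t₀)| ^ 2 * ‖F p - x₀‖ ^ 2 := by
        rw [← mul_pow]; gcongr
      nlinarith [sq_nonneg (‖X p‖ - ‖meanCurv n F p‖), sq_nonneg ‖X p‖, sq_nonneg ‖meanCurv n F p‖]
  refine ((hXL.sub (hy.const_mul (1 / t₀))).add (hH.const_mul (2 / t₀ * h))).congr
    (Filter.Eventually.of_forall fun p => ?_)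
  simp only [Pi.add_apply, Pi.sub_apply, inner_add_right, inner_sub_right, inner_smul_right]
  ring

lemma integrable_secondVariationDensity (y : 𝔼 N) (h : ℝ) :
    Integrable (fun p => secondVariationDensity n F x₀ t₀ X y h p * gaussWeight n x₀ t₀ (F p))
      (inducedVolume n F) := by
  refine ((integrable_normal_terms hF hs ht₀ hg hX hX2 hXL y h).neg.sub
    (integrable_centre_terms hF hs ht₀ hg y h)).congr (Filter.Eventually.of_forall fun p => ?_)
  simp only [Pi.sub_apply, Pi.neg_apply, secondVariationDensity]
  ring

omit hs hXL in
include hn hZ in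
-- The divergence theorem only sees the tangential part of the field: that of the acceleration is
-- integrable by assumption, the gradient is bounded by `|X|² + |∇X|²`, and the centre field grows
-- polynomially.
lemma integrable_tangential_part
    (hX1 : Integrable (fun p => normSqNormalConn n F X p * gaussWeight n x₀ t₀ (F p))
      (inducedVolume n F))
    (hZ1 : Integrable (fun p => ‖tder n F F p (Z p)‖ * gaussWeight n x₀ t₀ (F p))
      (inducedVolume n F)) (y y₂ : 𝔼 N) (h h₂ : ℝ) :
    Integrable (fun p => ‖tder n F F p (Z p + gradHalfSq n F X p
      + centreField n F x₀ t₀ y y₂ h h₂ p)‖ * gaussWeight n x₀ t₀ (F p)) (inducedVolume n F) := by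
  have hQ : Integrable (fun p => ‖centreField n F x₀ t₀ y y₂ h h₂ p‖ *
      gaussWeight n x₀ t₀ (F p)) (inducedVolume n F) := by
    obtain ⟨K, hK⟩ := exists_norm_centreField_le (n := n) F x₀ t₀ y y₂ h h₂
    exact integrable_mul_gaussWeight hF.sm hg x₀ ht₀
      (smooth_centreField hF.sm _ _ _ _).continuous.norm 3 (fun p => by
        rw [abs_norm]; exact hK p)
  refine integrable_of_abs_le_mul_gaussWeight hF.sm ht₀ ?_
    (b := fun p => ‖tder n F F p (Z p)‖ + (‖X p‖ ^ 2 + normSqNormalConn n F X p)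
      + ‖centreField n F x₀ t₀ y y₂ h h₂ p‖) ?_ fun p => ?_
  · exact ((smooth_tder_self hF).continuous.clm_apply ((hZ.continuous.add
      (smooth_gradHalfSq hF hX).continuous).add (smooth_centreField hF.sm _ _ _ _).continuous)).norm
  · refine ((hZ1.add (hX2.add hX1)).add hQ).congr (Filter.Eventually.of_forall fun p => ?_)
    simp only [Pi.add_apply]; ring
  · rw [abs_norm, map_add, map_add, tder_self_gradHalfSq hF]
    refine (norm_add₃_le).trans ?_
    gcongr
    · refine abs_le_of_sq_le_sq' (a := ‖gradHalfSq n F X p‖) ?_ ?_ |>.2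
      · have h1 := norm_gradHalfSq_sq_le hF hX hn p
        nlinarith [sq_nonneg (‖X p‖ ^ 2), normSqNormalConn_nonneg (n := n) F X p,
          sq_nonneg (normSqNormalConn n F X p), mul_nonneg (sq_nonneg ‖X p‖) (normSqNormalConn_nonneg (n := n) F X p)]
      · have := normSqNormalConn_nonneg (n := n) F X p
        positivity
    · exact norm_tder_self_le hF p _

end WeightedIntegrals

/-! ### Differentiating twice under the integral sign -/

section ParametricIntegral

open MeasureTheory Set

variable {α : Type*} [MeasurableSpace α] {μ : Measure α} {δ : ℝ} {W W₁ W₂ : ℝ → α → ℝ} {b : α → ℝ}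

/-- The derivative is a pointwise limit of a sequence of measurable difference quotients. -/
lemma aestronglyMeasurable_of_hasDerivAt {s : ℝ} {f : α → ℝ}
    (hm : ∀ᶠ r in 𝓝 s, AEStronglyMeasurable (W r) μ)
    (hd : ∀ p, HasDerivAt (fun r => W r p) (f p) s) : AEStronglyMeasurable f μ := by
  obtain ⟨η, hη, h⟩ := Metric.eventually_nhds_iff.1 hm
  -- With `k + 2` in the denominator the increment is nonzero and strictly below `η` from `k = 0`
  -- on.
  have hu : Filter.Tendsto (fun k : ℕ => s + η / (k + 2)) Filter.atTop (𝓝[≠] s) := by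
    refine tendsto_nhdsWithin_iff.2 ⟨?_, Filter.Eventually.of_forall fun k => ?_⟩
    · have h1 : Filter.Tendsto (fun k : ℕ => (k:ℝ) + 2) Filter.atTop Filter.atTop :=
        Filter.tendsto_atTop_add_const_right _ _ tendsto_natCast_atTop_atTop
      simpa using (h1.const_div_atTop η).const_add s
    · have : 0 < η / ((k:ℝ) + 2) := by positivity
      simp only [mem_compl_iff, mem_singleton_iff]
      linarith
  refine aestronglyMeasurable_of_tendsto_ae Filter.atTop
    (f := fun k : ℕ => fun p => slope (fun r => W r p) s (s + η / (k + 2))) (fun k => ?_)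
    (Filter.Eventually.of_forall fun p => (hasDerivAt_iff_tendsto_slope.1 (hd p)).comp hu)
  have hk : dist (s + η / ((k:ℝ) + 2)) s < η := by
    rw [dist_eq_norm, add_sub_cancel_left, Real.norm_of_nonneg (by positivity)]
    exact div_lt_self hη (by have := k.cast_nonneg (α := ℝ); linarith)
  simp only [slope_def_field]
  simp only [div_eq_mul_inv _ (s + _ - s)]
  exact ((h hk).sub (h (y := s) (by simpa using hη))).mul_const (s + η / ((k:ℝ) + 2) - s)⁻¹

/-- Two-fold differentiation under the integral sign. -/
theorem hasDerivAt_integral_of_dominated_twice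
    (hδ : 0 < δ) (hm : ∀ s, |s| < δ → AEStronglyMeasurable (W s) μ) (h0 : Integrable (W 0) μ)
    (hb : Integrable b μ) (h1 : ∀ s, |s| < δ → ∀ p, HasDerivAt (fun r => W r p) (W₁ s p) s)
    (h2 : ∀ s, |s| < δ → ∀ p, HasDerivAt (fun r => W₁ r p) (W₂ s p) s)
    (hb1 : ∀ s, |s| < δ → ∀ p, |W₁ s p| ≤ b p) (hb2 : ∀ s, |s| < δ → ∀ p, |W₂ s p| ≤ b p) :
    (∀ s, |s| < δ → Integrable (W s) μ ∧
      HasDerivAt (fun r => ∫ p, W r p ∂μ) (∫ p, W₁ s p ∂μ) s) ∧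
    Integrable (W₂ 0) μ ∧
    HasDerivAt (fun r => ∫ p, W₁ r p ∂μ) (∫ p, W₂ 0 p ∂μ) 0 := by
  have hnhds : ∀ s, |s| < δ → ∀ᶠ r in 𝓝 s, |r| < δ := fun s hs =>
    (isOpen_lt continuous_abs continuous_const).mem_nhds hs
  have hm1 : ∀ s, |s| < δ → AEStronglyMeasurable (W₁ s) μ := fun s hs =>
    aestronglyMeasurable_of_hasDerivAt ((hnhds s hs).mono hm) (h1 s hs)
  have hm2 : ∀ s, |s| < δ → AEStronglyMeasurable (W₂ s) μ := fun s hs =>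
    aestronglyMeasurable_of_hasDerivAt ((hnhds s hs).mono hm1) (h2 s hs)
  have hint : ∀ s, |s| < δ → Integrable (W s) μ := by
    intro s hs
    -- By the mean value inequality `|W s - W 0| ≤ b |s|`, so integrability at `0` spreads to all
    -- nearby parameters.
    have hdiff : Integrable (fun p => W s p - W 0 p) μ := by
      refine (hb.mul_const |s|).mono' ((hm s hs).sub h0.aestronglyMeasurable)
        (Filter.Eventually.of_forall fun p => ?_)
      have hconv : Convex ℝ {r : ℝ | |r| < δ} := by
        have : {r : ℝ | |r| < δ} = Metric.ball 0 δ := by ext r; simp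
        rw [this]; exact convex_ball _ _
      have := hconv.norm_image_sub_le_of_norm_hasDerivWithin_le (f := fun r => W r p)
        (f' := fun r => W₁ r p) (C := b p) (x := 0) (y := s)
        (fun r hr => (h1 r hr p).hasDerivWithinAt) (fun r hr => hb1 r hr p)
        (show |(0:ℝ)| < δ by simpa using hδ) hs
      simpa using this
    refine (hdiff.add h0).congr (Filter.Eventually.of_forall fun p => ?_)
    simp
  have hder : ∀ {V V₁ : ℝ → α → ℝ}, (∀ s, |s| < δ → AEStronglyMeasurable (V s) μ) →
      (∀ s, |s| < δ → AEStronglyMeasurable (V₁ s) μ) → (∀ s, |s| < δ → Integrable (V s) μ) →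
      (∀ s, |s| < δ → ∀ p, HasDerivAt (fun r => V r p) (V₁ s p) s) →
      (∀ s, |s| < δ → ∀ p, |V₁ s p| ≤ b p) → ∀ s, |s| < δ →
      HasDerivAt (fun r => ∫ p, V r p ∂μ) (∫ p, V₁ s p ∂μ) s := by
    intro V V₁ hV hV₁ hi hd hbd s hs
    exact (hasDerivAt_integral_of_dominated_loc_of_deriv_le (hnhds s hs) ((hnhds s hs).mono hV)
      (hi s hs) (hV₁ s hs) (Filter.Eventually.of_forall fun p r hr => hbd r hr p) hb
      (Filter.Eventually.of_forall fun p r hr => hd r hr p)).2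
  have h00 : |(0:ℝ)| < δ := by simpa using hδ
  refine ⟨fun s hs => ⟨hint s hs, hder hm hm1 hint h1 hb1 s hs⟩, ?_, ?_⟩
  · exact hb.mono' (hm2 0 h00) (Filter.Eventually.of_forall fun p => hb2 0 h00 p)
  · exact hder hm1 hm2 (fun s hs => hb.mono' (hm1 s hs)
      (Filter.Eventually.of_forall fun p => hb1 s hs p)) h2 hb2 0 h00

end ParametricIntegral

/-! ### Domination for compactly supported deformations -/

section Domination

open MeasureTheory Set

variable {n N : ℕ} {M : Type*} [TopologicalSpace M] [ChartedSpace (𝔼 n) M]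
  [IsManifold (𝓡 n) ∞ M] [MeasurableSpace M] [BorelSpace M]
  [SecondCountableTopology M] {F : M → 𝔼 N} {ε : ℝ}
  {Φ : ℝ → M → 𝔼 N} {xs : ℝ → 𝔼 N} {ts : ℝ → ℝ} {t₀ : ℝ}

lemma norm_sub_le_mul_one_add_norm {B : ℝ} {x z : 𝔼 N} (hx : ‖x‖ ≤ B) :
    ‖z - x‖ ≤ (1 + B) * (1 + ‖z‖) := by
  have h1 := norm_sub_le z x
  have h2 := mul_nonneg ((norm_nonneg x).trans hx) (norm_nonneg z)
  linarith

/-- Off the support of the deformation the point `z` is at rest and only centre and time move,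
whence the velocity `0 - x₁`. The bound is quadratic in `z`. -/
lemma exists_gaussRate_le (n : ℕ) {B c : ℝ} (hB : 0 ≤ B) (hc : 0 ≤ c) :
    ∃ A, 0 ≤ A ∧ ∀ (t t₁ : ℝ) (x x₁ z : 𝔼 N), 0 < t → t⁻¹ ≤ c → |t₁| ≤ B →
      ‖x‖ ≤ B → ‖x₁‖ ≤ B → |gaussRate n t t₁ (z - x) (0 - x₁)| ≤ A * (1 + ‖z‖) ^ 2 := by
  refine ⟨n / 2 * (B * c) + (1 + B) ^ 2 * B * c ^ 2 / 4 + (1 + B) * B * c / 2, by positivity,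
    fun t t₁ x x₁ z ht htc ht₁ hx hx₁ => ?_⟩
  have hR1 : 1 ≤ 1 + ‖z‖ := le_add_of_nonneg_right (norm_nonneg z)
  refine (abs_gaussRate_le ht htc ht₁ (norm_sub_le_mul_one_add_norm hx)
    (by simpa using hx₁)).trans ?_
  generalize 1 + ‖z‖ = R at hR1
  have hR12 : 1 ≤ R ^ 2 := one_le_pow₀ hR1
  have hRR : R ≤ R ^ 2 := le_self_pow₀ hR1 two_ne_zero
  rw [show ∀ a b d : ℝ, (a + b + d) * R ^ 2 = a * R ^ 2 + b * R ^ 2 + d * R ^ 2 by intros; ring]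
  refine add_le_add (add_le_add (le_mul_of_one_le_right (by positivity) hR12)
    (le_of_eq (by ring))) ?_
  calc (1 + B) * R * B * c / 2 = (1 + B) * B * c / 2 * R := by ring
    _ ≤ _ := by gcongr

lemma exists_gaussRateDeriv_le (n : ℕ) {B c : ℝ} (hB : 0 ≤ B) (hc : 0 ≤ c) :
    ∃ A, 0 ≤ A ∧ ∀ (t t₁ t₂ : ℝ) (x x₁ x₂ z : 𝔼 N), 0 < t → t⁻¹ ≤ c → |t₁| ≤ B → |t₂| ≤ B →
      ‖x‖ ≤ B → ‖x₁‖ ≤ B → ‖x₂‖ ≤ B →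
      |gaussRateDeriv n t t₁ t₂ (z - x) (0 - x₁) (0 - x₂)| ≤ A * (1 + ‖z‖) ^ 2 := by
  refine ⟨n * B * c / 2 + n * B ^ 2 * c ^ 2 / 2
      + (1 + B) ^ 2 * B * c ^ 2 / 4 + (1 + B) ^ 2 * B ^ 2 * c ^ 3 / 2 + (1 + B) * B * B * c ^ 2
      + B ^ 2 * c / 2 + (1 + B) * B * c / 2, by positivity,
    fun t t₁ t₂ x x₁ x₂ z ht htc ht₁ ht₂ hx hx₁ hx₂ => ?_⟩
  have hR1 : 1 ≤ 1 + ‖z‖ := le_add_of_nonneg_right (norm_nonneg z)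
  refine (abs_gaussRateDeriv_le ht htc ht₁ ht₂ (norm_sub_le_mul_one_add_norm hx)
    (by simpa using hx₁) (by simpa using hx₂)).trans ?_
  generalize 1 + ‖z‖ = R at hR1
  have hR12 : 1 ≤ R ^ 2 := one_le_pow₀ hR1
  have hRR : R ≤ R ^ 2 := le_self_pow₀ hR1 two_ne_zero
  simp only [add_mul _ _ (R ^ 2)]
  refine add_le_add (add_le_add (add_le_add (add_le_add (add_le_add (add_le_add
    (le_mul_of_one_le_right (by positivity) hR12) (le_mul_of_one_le_right (by positivity) hR12))
    (le_of_eq (by ring))) (le_of_eq (by ring))) ?_)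
    (le_mul_of_one_le_right (by positivity) hR12)) ?_
  · calc (1 + B) * R * B * B * c ^ 2 = (1 + B) * B * B * c ^ 2 * R := by ring
      _ ≤ _ := by gcongr
  · calc (1 + B) * R * B * c / 2 = (1 + B) * B * c / 2 * R := by ring
      _ ≤ _ := by gcongr

lemma eventually_norm_le {G : Type*} [NormedAddCommGroup G] {f : ℝ → G} {s : ℝ}
    (hf : ContinuousAt f s) : ∀ᶠ r in 𝓝 s, ‖f r‖ ≤ ‖f s‖ + 1 :=
  (hf.norm.eventually (Iio_mem_nhds (lt_add_one _))).mono fun _ h => h.le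

lemma hasDerivAt_gaussWeight_along (n : ℕ) (hxs : ContDiffOn ℝ 2 xs (Ioo (-ε) ε))
    (hts : ContDiffOn ℝ 2 ts (Ioo (-ε) ε)) {s : ℝ} (hs : s ∈ Ioo (-ε) ε) (hpos : 0 < ts s)
    (z : 𝔼 N) :
    HasDerivAt (fun r => gaussWeight n (xs r) (ts r) z) (gaussWeight n (xs s) (ts s) z *
        gaussRate n (ts s) (deriv ts s) (z - xs s) (0 - deriv xs s)) s :=
  hasDerivAt_gaussWeight
    ((hxs.contDiffAt (isOpen_Ioo.mem_nhds hs)).differentiableAt (by simp)).hasDerivAt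
    ((hts.contDiffAt (isOpen_Ioo.mem_nhds hs)).differentiableAt (by simp)).hasDerivAt
    (hasDerivAt_const s z) hpos

lemma iteratedDeriv_two_gaussWeight_along (n : ℕ) (hxs : ContDiffOn ℝ 2 xs (Ioo (-ε) ε))
    (hts : ContDiffOn ℝ 2 ts (Ioo (-ε) ε)) {s : ℝ} (hs : s ∈ Ioo (-ε) ε) (hpos : 0 < ts s)
    (z : 𝔼 N) :
    iteratedDeriv 2 (fun r => gaussWeight n (xs r) (ts r) z) s = gaussWeight n (xs s) (ts s) z *
        (gaussRate n (ts s) (deriv ts s) (z - xs s) (0 - deriv xs s) ^ 2 +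
          gaussRateDeriv n (ts s) (deriv ts s) (deriv (deriv ts) s) (z - xs s) (0 - deriv xs s)
            (0 - deriv (deriv xs) s)) := by
  have hsn : Ioo (-ε) ε ∈ 𝓝 s := isOpen_Ioo.mem_nhds hs
  have hx1 := hxs.deriv_of_isOpen (m := 1) isOpen_Ioo (by rw [one_add_one_eq_two])
  have ht1 := hts.deriv_of_isOpen (m := 1) isOpen_Ioo (by rw [one_add_one_eq_two])
  have dR : HasDerivAt (fun r => gaussRate n (ts r) (deriv ts r) (z - xs r) (0 - deriv xs r))
      (gaussRateDeriv n (ts s) (deriv ts s) (deriv (deriv ts) s) (z - xs s) (0 - deriv xs s)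
        (0 - deriv (deriv xs) s)) s := by
    have h1 := ((hxs.contDiffAt hsn).differentiableAt (by simp)).hasDerivAt
    have h2 := ((hx1.contDiffAt hsn).differentiableAt (by simp)).hasDerivAt
    have h3 := (hasDerivAt_const s z).sub h1
    exact hasDerivAt_gaussRate h3 ((hasDerivAt_const s (0 : 𝔼 N)).sub h2)
      ((hts.contDiffAt hsn).differentiableAt (by simp)).hasDerivAt
      ((ht1.contDiffAt hsn).differentiableAt (by simp)).hasDerivAt hpos
  have hev : deriv (fun r => gaussWeight n (xs r) (ts r) z) =ᶠ[𝓝 s] fun r =>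
      gaussWeight n (xs r) (ts r) z *
        gaussRate n (ts r) (deriv ts r) (z - xs r) (0 - deriv xs r) := by
    filter_upwards [hsn, (hts.continuousOn.continuousAt hsn).eventually (Ioi_mem_nhds hpos)]
      with r hr hr2
    exact (hasDerivAt_gaussWeight_along n hxs hts hr hr2 z).deriv
  rw [iteratedDeriv_succ, iteratedDeriv_one, hev.deriv_eq,
    ((hasDerivAt_gaussWeight_along n hxs hts hs hpos z).fun_mul dR).deriv]
  ring

/-- The first two derivatives of Gaussian weights along curves of centres and times decay
exponentially, uniformly in the parameter. -/
lemma exists_gaussWeight_deriv_le (n : ℕ) (hε : 0 < ε) (hxs : ContDiffOn ℝ 2 xs (Ioo (-ε) ε))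
    (hts : ContDiffOn ℝ 2 ts (Ioo (-ε) ε)) (hts₀ : ts 0 = t₀) (ht₀ : 0 < t₀) :
    ∃ C, ∀ᶠ s in 𝓝 (0:ℝ), ∀ z : 𝔼 N,
      |deriv (fun r => gaussWeight n (xs r) (ts r) z) s| ≤ C * Real.exp (-‖z‖) ∧
      |iteratedDeriv 2 (fun r => gaussWeight n (xs r) (ts r) z) s| ≤ C * Real.exp (-‖z‖) := by
  have h0 : Ioo (-ε) ε ∈ 𝓝 (0:ℝ) := isOpen_Ioo.mem_nhds (by simpa using hε)
  have hx1 := hxs.deriv_of_isOpen (m := 1) isOpen_Ioo (by rw [one_add_one_eq_two])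
  have ht1 := hts.deriv_of_isOpen (m := 1) isOpen_Ioo (by rw [one_add_one_eq_two])
  have hx2 := hx1.deriv_of_isOpen (m := 0) isOpen_Ioo (by simp)
  have ht2 := ht1.deriv_of_isOpen (m := 0) isOpen_Ioo (by simp)
  obtain ⟨B, hB0, hB⟩ : ∃ B, 0 ≤ B ∧ ∀ᶠ s in 𝓝 (0:ℝ), ‖xs s‖ ≤ B ∧ ‖deriv xs s‖ ≤ B ∧
      ‖deriv (deriv xs) s‖ ≤ B ∧ |deriv ts s| ≤ B ∧ |deriv (deriv ts) s| ≤ B := by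
    have hf : ContinuousAt (fun s => (xs s, deriv xs s, deriv (deriv xs) s, deriv ts s,
        deriv (deriv ts) s)) 0 :=
      (hxs.continuousOn.continuousAt h0).prodMk ((hx1.continuousOn.continuousAt h0).prodMk
        ((hx2.continuousOn.continuousAt h0).prodMk ((ht1.continuousOn.continuousAt h0).prodMk
          (ht2.continuousOn.continuousAt h0))))
    refine ⟨‖(xs 0, deriv xs 0, deriv (deriv xs) 0, deriv ts 0, deriv (deriv ts) 0)‖ + 1,
      by positivity,
      (eventually_norm_le hf).mono fun s hs => ?_⟩
    simpa only [norm_prod_le_iff, Real.norm_eq_abs] using hs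
  -- The power is `4` because the second derivative contains the square of a rate of quadratic
  -- growth.
  obtain ⟨C₀, hC₀, hG⟩ := exists_gaussWeight_le (N := N) n 4 ht₀ B
  have hc0 : 0 ≤ (t₀ / 2)⁻¹ := by positivity
  obtain ⟨A₁, hA₁, h₁⟩ := exists_gaussRate_le (N := N) n hB0 hc0
  obtain ⟨A₂, hA₂, h₂⟩ := exists_gaussRateDeriv_le (N := N) n hB0 hc0
  have htl : ∀ᶠ s in 𝓝 (0:ℝ), t₀ / 2 < ts s ∧ ts s < 2 * t₀ := by
    have h := hts.continuousOn.continuousAt h0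
    exact (h.eventually (Ioi_mem_nhds (by rw [hts₀]; linarith))).and
      (h.eventually (Iio_mem_nhds (by rw [hts₀]; linarith)))
  refine ⟨(A₁ + A₁ ^ 2 + A₂) * C₀, ?_⟩
  filter_upwards [hB, htl, h0] with s b b6 hs z
  have hpos : 0 < ts s := lt_trans (by positivity) b6.1
  have hct : (ts s)⁻¹ ≤ (t₀ / 2)⁻¹ := inv_anti₀ (by positivity) b6.1.le
  have r1 := h₁ _ _ _ _ z hpos hct b.2.2.2.1 b.1 b.2.1
  have r2 := h₂ _ _ _ _ _ _ z hpos hct b.2.2.2.1 b.2.2.2.2 b.1 b.2.1 b.2.2.1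
  have hGz := hG (xs s) z (ts s) b6.1.le b6.2.le b.1
  have hGp := (gaussWeight_pos n hpos (xs s) z).le
  have hR1 : 1 ≤ 1 + ‖z‖ := le_add_of_nonneg_right (norm_nonneg z)
  have hR24 : (1 + ‖z‖) ^ 2 ≤ (1 + ‖z‖) ^ 4 := pow_le_pow_right₀ hR1 (by norm_num)
  have fin : ∀ a, |a| ≤ (A₁ + A₁ ^ 2 + A₂) * (1 + ‖z‖) ^ 4 →
      |gaussWeight n (xs s) (ts s) z * a| ≤ (A₁ + A₁ ^ 2 + A₂) * C₀ * Real.exp (-‖z‖) := by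
    intro a ha
    rw [abs_mul, abs_of_nonneg hGp]
    calc _ ≤ gaussWeight n (xs s) (ts s) z * ((A₁ + A₁ ^ 2 + A₂) * (1 + ‖z‖) ^ 4) := by gcongr
      _ = (A₁ + A₁ ^ 2 + A₂) * ((1 + ‖z‖) ^ 4 * gaussWeight n (xs s) (ts s) z) := by ring
      _ ≤ (A₁ + A₁ ^ 2 + A₂) * (C₀ * Real.exp (-‖z‖)) := by gcongr
      _ = _ := by ring
  constructor
  · rw [(hasDerivAt_gaussWeight_along n hxs hts hs hpos z).deriv]
    refine fin _ (r1.trans (mul_le_mul ?_ hR24 (by positivity) (by positivity)))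
    rw [add_assoc]
    exact le_add_of_nonneg_right (by positivity)
  · rw [iteratedDeriv_two_gaussWeight_along n hxs hts hs hpos z]
    refine fin _ ((abs_add_le _ _).trans ?_)
    rw [abs_pow]
    calc _ ≤ (A₁ * (1 + ‖z‖) ^ 2) ^ 2 + A₂ * (1 + ‖z‖) ^ 2 := by gcongr
      _ ≤ A₁ ^ 2 * (1 + ‖z‖) ^ 4 + A₂ * (1 + ‖z‖) ^ 4 := by
        rw [mul_pow, ← pow_mul]; gcongr
      _ = (A₁ ^ 2 + A₂) * (1 + ‖z‖) ^ 4 := by ring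
      _ ≤ _ := by
        gcongr
        exact le_add_of_nonneg_left hA₁

/-- The complement of the compact set is open, so `Φ s` agrees with `F` near `p`. The differentials
agree as well, and the area ratio is `1`. -/
lemma weightedDensity_eq_of_notMem [T2Space M] (hF : IsSmoothImmersion n F) {K : Set M} (hK : IsCompact K)
    (hKΦ : ∀ s ∈ Ioo (-ε) ε, ∀ p ∉ K, Φ s p = F p)
    (hΦ : ∀ s ∈ Ioo (-ε) ε, Smooth n (Φ s)) {p : M} (hp : p ∉ K) {s : ℝ} (hs : s ∈ Ioo (-ε) ε) :
    weightedDensity n F Φ xs ts p s = gaussWeight n (xs s) (ts s) (F p) := by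
  have h1 : mder n (Φ s) p = mder n F p := by
    refine Filter.EventuallyEq.fderiv_eq ?_
    have h2 := (chartAt (𝔼 n) p).continuousAt_symm (mem_chart_target (𝔼 n) p)
    have h3 := h2.eventually (by
      rw [chart_symm_self]; exact hK.isClosed.isOpen_compl.mem_nhds hp)
    filter_upwards [h3] with u hu
    exact hKΦ s hs _ hu
  rw [weightedDensity_eq hF.sm (hΦ s hs), areaRatio, h1, hKΦ s hs p hp,
    div_self (areaFactor_pos (hF.mder_injective p)).ne', mul_one]

/-- Compactly supported deformations satisfy the domination hypothesis. -/
lemma exists_dominating_of_compact [T2Space M] (hF : IsSmoothImmersion n F)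
    (hg : HasPolynomialVolumeGrowth n F) (hε : 0 < ε) (hxs : ContDiffOn ℝ 2 xs (Ioo (-ε) ε))
    (hts : ContDiffOn ℝ 2 ts (Ioo (-ε) ε)) (hts₀ : ts 0 = t₀) (ht₀ : 0 < t₀)
    (hΦ : ∀ s ∈ Ioo (-ε) ε, Smooth n (Φ s))
    {ε' : ℝ} (hε' : 0 < ε') (hfam : IsFamily n 2 ε' (fun s p => weightedDensity n F Φ xs ts p s))
    (hcs : IsCompactlySupported F Φ ε) :
    ∃ b : M → ℝ, Integrable b (inducedVolume n F) ∧ ∀ᶠ s in 𝓝 (0 : ℝ), ∀ p,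
      |deriv (weightedDensity n F Φ xs ts p) s| ≤ b p ∧
      |iteratedDeriv 2 (weightedDensity n F Φ xs ts p) s| ≤ b p := by
  obtain ⟨K, hK, hKΦ⟩ := hcs
  obtain ⟨C, hC⟩ := exists_gaussWeight_deriv_le (N := N) n hε hxs hts hts₀ ht₀
  have f1 : IsFamily n 1 ε' (dparam fun s p => weightedDensity n F Φ xs ts p s) :=
    hfam.dparam (by rw [one_add_one_eq_two])
  have f2 : IsFamily n 0 ε' (dparam (dparam fun s p => weightedDensity n F Φ xs ts p s)) :=
    f1.dparam (by simp)
  obtain ⟨C₁, δ₁, hδ₁, h₁⟩ := IsFamily.exists_bound (n := n)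
    (fun c => (f1 c).of_le zero_le_one) hε' hK
  obtain ⟨C₂, δ₂, hδ₂, h₂⟩ := f2.exists_bound hε' hK
  have he := integrable_exp_neg_norm hF.sm hg
  -- The first summand bounds the derivatives on `K`, where they are jointly continuous in parameter
  -- and point. The second bounds the Gaussians off `K` and is integrable by polynomial volume
  -- growth.
  refine ⟨fun p => K.indicator (fun _ => max C₁ C₂) p + |C| * Real.exp (-‖F p‖), ?_, ?_⟩
  · exact ((integrable_indicator_iff hK.isClosed.measurableSet).2
      (integrableOn_const (hs := (inducedVolume_lt_top_of_isCompact hF.sm hK).ne))).add (he.const_mul _)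
  · have hs1 : ∀ᶠ s in 𝓝 (0:ℝ), |s| < δ₁ ∧ |s| < δ₂ ∧ s ∈ Ioo (-ε) ε := by
      have h : ∀ δ : ℝ, 0 < δ → ∀ᶠ s in 𝓝 (0:ℝ), |s| < δ := fun δ hδ =>
        (isOpen_lt continuous_abs continuous_const).mem_nhds (by simpa using hδ)
      exact (h _ hδ₁).and ((h _ hδ₂).and (isOpen_Ioo.mem_nhds (by simpa using hε)))
    filter_upwards [hC, hs1] with s hCs hs p
    have hCC : C * Real.exp (-‖F p‖) ≤ |C| * Real.exp (-‖F p‖) := by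
      gcongr; exact le_abs_self C
    by_cases hp : p ∈ K
    · rw [indicator_of_mem hp]
      have hpos : 0 ≤ |C| * Real.exp (-‖F p‖) := by positivity
      have k1 := h₁ s hs.1 p hp
      have k2 := h₂ s hs.2.1 p hp
      rw [Real.norm_eq_abs] at k1 k2
      constructor
      · exact k1.trans ((le_max_left _ _).trans (le_add_of_nonneg_right hpos))
      · rw [iteratedDeriv_succ, iteratedDeriv_one]
        exact k2.trans ((le_max_right _ _).trans (le_add_of_nonneg_right hpos))
    · rw [indicator_of_notMem hp, zero_add]
      have hev : weightedDensity n F Φ xs ts p =ᶠ[𝓝 s]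
          fun r => gaussWeight n (xs r) (ts r) (F p) := by
        filter_upwards [isOpen_Ioo.mem_nhds hs.2.2] with r hr
        exact weightedDensity_eq_of_notMem hF hK hKΦ hΦ hp hr
      rw [hev.deriv_eq, hev.iteratedDeriv_eq 2]
      exact ⟨(hCs (F p)).1.trans hCC, (hCs (F p)).2.trans hCC⟩

end Domination

/-! ### Assembling the second variation formula -/

section SecondVariation

open MeasureTheory Set

lemma IsFamily.mono {n : ℕ} {M E : Type*} [NormedAddCommGroup E] [NormedSpace ℝ E]
    [TopologicalSpace M] [ChartedSpace (𝔼 n) M] {k : WithTop ℕ∞} {ε ε' : ℝ} {Φ : ℝ → M → E}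
    (hΦ : IsFamily n k ε Φ) (h : Ioo (-ε') ε' ⊆ Ioo (-ε) ε) :
    IsFamily n k ε' Φ := fun c => (hΦ c).mono (prod_mono h subset_rfl)

variable {n N : ℕ} {M : Type*} [TopologicalSpace M] [T2Space M] [ChartedSpace (𝔼 n) M]
  [IsManifold (𝓡 n) ∞ M] [MeasurableSpace M] [BorelSpace M]
  [SecondCountableTopology M] {F : M → 𝔼 N} {x₀ : 𝔼 N} {t₀ : ℝ}

lemma integrable_inducedVolume_iff (hF : IsSmoothImmersion n F) {F' : M → 𝔼 N}
    (hF' : Smooth n F') (g : M → ℝ) :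
    Integrable g (inducedVolume n F') ↔
      Integrable (fun p => g p * areaRatio n F F' p) (inducedVolume n F) := by
  rw [inducedVolume_eq_withDensity hF hF', integrable_withDensity_iff_integrable_smul']
  · refine integrable_congr (Filter.Eventually.of_forall fun p => ?_)
    simp only [smul_eq_mul, ENNReal.toReal_ofReal (areaRatio_nonneg F F' p), mul_comm]
  · exact (continuous_areaRatio hF hF').measurable.ennreal_ofReal
  · exact Filter.Eventually.of_forall fun p => ENNReal.ofReal_lt_top

lemma integral_inducedVolume (hF : IsSmoothImmersion n F) {F' : M → 𝔼 N}
    (hF' : Smooth n F') (g : M → ℝ) :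
    ∫ p, g p ∂(inducedVolume n F') = ∫ p, g p * areaRatio n F F' p ∂(inducedVolume n F) := by
  rw [inducedVolume_eq_withDensity hF hF', integral_withDensity_eq_integral_toReal_smul]
  · refine integral_congr_ae (Filter.Eventually.of_forall fun p => ?_)
    simp only [smul_eq_mul, ENNReal.toReal_ofReal (areaRatio_nonneg F F' p), mul_comm]
  · exact (continuous_areaRatio hF hF').measurable.ennreal_ofReal
  · exact Filter.Eventually.of_forall fun p => ENNReal.ofReal_lt_top

lemma isNormalField_of_mem_orthogonal (hF : IsSmoothImmersion n F) {X : M → 𝔼 N}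
    (h : ∀ p, X p ∈ (tangentPlane n F p)ᗮ) : IsNormalField n F X := fun p => by
  rw [tder_self hF]
  exact (Submodule.starProjection_apply_eq_zero_iff _).2 (h p)

/-- Continuous compactly supported functions are integrable for the induced volume. -/
lemma integrable_of_eq_zero_off_compact (hF : Smooth n F) {K : Set M} (hK : IsCompact K)
    {g : M → ℝ} (hg : Continuous g) (h0 : ∀ p ∉ K, g p = 0) :
    Integrable g (inducedVolume n F) := by
  have := isFiniteMeasureOnCompacts_inducedVolume hF
  exact hg.integrable_of_hasCompactSupport (HasCompactSupport.intro hK h0)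

lemma mder_eq_zero_of_eqOn_open {u : M → 𝔼 N} {U : Set M} (hU : IsOpen U)
    (h : ∀ p ∈ U, u p = 0) {p : M} (hp : p ∈ U) : mder n u p = 0 := by
  have h2 := (chartAt (𝔼 n) p).continuousAt_symm (mem_chart_target (𝔼 n) p)
  have h3 := h2.eventually (by rw [chart_symm_self]; exact hU.mem_nhds hp)
  have h4 : (u ∘ (chartAt (𝔼 n) p).symm) =ᶠ[𝓝 (chartAt (𝔼 n) p p)] fun _ => 0 :=
    h3.mono fun q hq => h _ hq
  exact h4.fderiv_eq.trans (fderiv_const_apply _)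

/-- The integrability hypotheses on the variation hold for compactly supported fields. -/
lemma integrable_variation_of_compact (hF : IsSmoothImmersion n F) {X Z : M → 𝔼 N}
    (hX : Smooth n X) (hn : IsNormalField n F X) (hZ : Smooth n Z) {K : Set M} (hK : IsCompact K)
    (hXK : ∀ p ∉ K, X p = 0) (hZK : ∀ p ∉ K, Z p = 0) (x₀ : 𝔼 N) (t₀ : ℝ) :
    Integrable (fun p => ‖X p‖ ^ 2 * gaussWeight n x₀ t₀ (F p)) (inducedVolume n F) ∧
    Integrable (fun p => inner ℝ (X p) (jacobiOp n F x₀ t₀ X p) * gaussWeight n x₀ t₀ (F p))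
      (inducedVolume n F) ∧
    Integrable (fun p => normSqNormalConn n F X p * gaussWeight n x₀ t₀ (F p))
      (inducedVolume n F) ∧
    Integrable (fun p => ‖tder n F F p (Z p)‖ * gaussWeight n x₀ t₀ (F p)) (inducedVolume n F) := by
  have hG : Continuous fun p => gaussWeight n x₀ t₀ (F p) :=
    (continuous_gaussWeight n x₀ t₀).comp hF.sm.continuous
  refine ⟨integrable_of_eq_zero_off_compact hF.sm hK ((hX.continuous.norm.pow 2).mul hG)
      fun p hp => ?_,
    integrable_of_eq_zero_off_compact hF.sm hK ((continuous_inner_jacobiOp hF hX hn).mul hG)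
      fun p hp => ?_,
    integrable_of_eq_zero_off_compact hF.sm hK ((continuous_normSqNormalConn hF hX).mul hG)
      fun p hp => ?_,
    integrable_of_eq_zero_off_compact hF.sm hK
      (((smooth_tder_self hF).continuous.clm_apply hZ.continuous).norm.mul hG) fun p hp => ?_⟩
  · simp [hXK p hp]
  · simp [hXK p hp]
  · have h0 : tder n F X p = 0 := by
      rw [tder, mder_eq_zero_of_eqOn_open hK.isClosed.isOpen_compl hXK hp,
        ContinuousLinearMap.zero_comp]
    simp [normSqNormalConn_eq hF hX, h0]
  · simp [hZK p hp]

section Deformation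

variable {ε : ℝ} {Φ : ℝ → M → 𝔼 N} {xs : ℝ → 𝔼 N} {ts : ℝ → ℝ}

lemma areaRatio_self (hF : IsSmoothImmersion n F) (p : M) : areaRatio n F F p = 1 :=
  div_self (areaFactor_pos (hF.mder_injective p)).ne'

lemma continuous_weightedDensity (hF : IsSmoothImmersion n F) {s : ℝ} (hs : Smooth n (Φ s)) :
    Continuous fun p => weightedDensity n F Φ xs ts p s := by
  simp only [weightedDensity_eq hF.sm hs]
  exact ((continuous_gaussWeight n _ _).comp hs.continuous).mul (continuous_areaRatio hF hs)

lemma Ffunctional_eq_integral_weightedDensity (hF : IsSmoothImmersion n F) {s : ℝ}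
    (hs : Smooth n (Φ s)) :
    Ffunctional n (xs s) (ts s) (Φ s) =
      ∫ p, weightedDensity n F Φ xs ts p s ∂(inducedVolume n F) := by
  simp only [weightedDensity_eq hF.sm hs]
  exact integral_inducedVolume hF hs _

/-- The second derivative of the weighted density at the initial time. -/
lemma hasDerivAt_deriv_weightedDensity (hF : IsSmoothImmersion n F)
    (hsh : IsSelfShrinker n F (xs 0) (ts 0)) (hε : 0 < ε) (hΦ : IsFamily n ∞ ε Φ)
    (himm : ∀ s ∈ Ioo (-ε) ε, IsSmoothImmersion n (Φ s)) (h0 : Φ 0 = F)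
    (hxs : ContDiffOn ℝ 2 xs (Ioo (-ε) ε)) (hts : ContDiffOn ℝ 2 ts (Ioo (-ε) ε))
    (hpos : ∀ s ∈ Ioo (-ε) ε, 0 < ts s) (hX : Smooth n (dparam Φ 0))
    (hn : IsNormalField n F (dparam Φ 0)) (hZ : Smooth n (dparam (dparam Φ) 0)) (p : M) :
    HasDerivAt (deriv (weightedDensity n F Φ xs ts p))
      ((secondVariationDensity n F (xs 0) (ts 0) (dparam Φ 0) (deriv xs 0) (deriv ts 0) p +
        wdiv n F (xs 0) (ts 0) (fun q => dparam (dparam Φ) 0 q + gradHalfSq n F (dparam Φ 0) q +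
          centreField n F (xs 0) (ts 0) (deriv xs 0) (deriv (deriv xs) 0) (deriv ts 0)
            (deriv (deriv ts) 0) q) p) * gaussWeight n (xs 0) (ts 0) (F p)) 0 := by
  have hs : (0:ℝ) ∈ Ioo (-ε) ε := by simpa using hε
  have hev : deriv (weightedDensity n F Φ xs ts p) =ᶠ[𝓝 0] fun s =>
      weightedDensity n F Φ xs ts p s * densityRate n Φ xs ts s p := by
    filter_upwards [isOpen_Ioo.mem_nhds hs] with s hs
    exact (hasDerivAt_weightedDensity hF hΦ himm hxs hts hpos hs p).deriv
  refine (((hasDerivAt_weightedDensity hF hΦ himm hxs hts hpos hs p).fun_mul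
    (hasDerivAt_densityRate hΦ himm hxs hts hpos hs p)).congr_of_eventuallyEq hev).congr_deriv ?_
  have hrate : densityRate n Φ xs ts 0 p = gaussRate n (ts 0) (deriv ts 0) (F p - xs 0)
      (dparam Φ 0 p - deriv xs 0) + traceL (𝔼 N) (tder n F (dparam Φ 0) p) := by
    rw [densityRate, h0, tder, traceL_comp_comm]
  rw [← second_variation_pointwise hF hsh (hpos 0 hs).ne' hX hn hZ, hrate,
    weightedDensity_eq hF.sm (himm 0 hs).sm, h0, areaRatio_self hF]
  ring

lemma weightedDensity_zero (hF : IsSmoothImmersion n F) (h0 : Φ 0 = F) (p : M) :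
    weightedDensity n F Φ xs ts p 0 = gaussWeight n (xs 0) (ts 0) (F p) := by
  rw [weightedDensity_eq hF.sm (by rw [h0]; exact hF.sm), h0, areaRatio_self hF, mul_one]

/-- The second variation formula, under domination and integrability hypotheses. -/
theorem second_variation_of_dominated (hF : IsSmoothImmersion n F) (hc : IsCompleteSurface n F)
    (hsh : IsSelfShrinker n F (xs 0) (ts 0)) (hg : HasPolynomialVolumeGrowth n F)
    (hε : 0 < ε) (hΦ : IsFamily n ∞ ε Φ)
    (himm : ∀ s ∈ Ioo (-ε) ε, IsSmoothImmersion n (Φ s)) (h0 : Φ 0 = F)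
    (hxs : ContDiffOn ℝ 2 xs (Ioo (-ε) ε)) (hts : ContDiffOn ℝ 2 ts (Ioo (-ε) ε))
    (hpos : ∀ s ∈ Ioo (-ε) ε, 0 < ts s) (hX : Smooth n (dparam Φ 0))
    (hn : IsNormalField n F (dparam Φ 0)) (hZ : Smooth n (dparam (dparam Φ) 0))
    (hdom : ∃ b : M → ℝ, Integrable b (inducedVolume n F) ∧ ∀ᶠ s in 𝓝 (0 : ℝ), ∀ p,
      |deriv (weightedDensity n F Φ xs ts p) s| ≤ b p ∧
      |iteratedDeriv 2 (weightedDensity n F Φ xs ts p) s| ≤ b p)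
    (hX2 : Integrable (fun p => ‖dparam Φ 0 p‖ ^ 2 * gaussWeight n (xs 0) (ts 0) (F p))
      (inducedVolume n F))
    (hXL : Integrable (fun p => inner ℝ (dparam Φ 0 p)
      (jacobiOp n F (xs 0) (ts 0) (dparam Φ 0) p) * gaussWeight n (xs 0) (ts 0) (F p))
      (inducedVolume n F))
    (hX1 : Integrable (fun p => normSqNormalConn n F (dparam Φ 0) p *
      gaussWeight n (xs 0) (ts 0) (F p)) (inducedVolume n F))
    (hZ1 : Integrable (fun p => ‖tder n F F p (dparam (dparam Φ) 0 p)‖ *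
      gaussWeight n (xs 0) (ts 0) (F p)) (inducedVolume n F)) :
    (∀ᶠ s in 𝓝 (0 : ℝ),
      Integrable (fun p => gaussWeight n (xs s) (ts s) (Φ s p)) (inducedVolume n (Φ s)) ∧
      DifferentiableAt ℝ (fun s => Ffunctional n (xs s) (ts s) (Φ s)) s) ∧
    HasDerivAt (deriv fun s => Ffunctional n (xs s) (ts s) (Φ s))
      (∫ p, secondVariationDensity n F (xs 0) (ts 0) (dparam Φ 0) (deriv xs 0) (deriv ts 0) p *
        gaussWeight n (xs 0) (ts 0) (F p) ∂(inducedVolume n F)) 0 := by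
  have hs0 : (0:ℝ) ∈ Ioo (-ε) ε := by simpa using hε
  have ht₀ := hpos 0 hs0
  obtain ⟨b, hb, hbd⟩ := hdom
  obtain ⟨δ, hδ, hball⟩ := Metric.eventually_nhds_iff.1 (hbd.and (isOpen_Ioo.mem_nhds hs0))
  have hδs : ∀ s, |s| < δ → _ := fun s hs => hball (y := s) (by simpa using hs)
  have hfam := isFamily_weightedDensity hF hΦ himm hxs hts hpos
  have hfam1 : IsFamily n 1 ε (dparam fun s p => weightedDensity n F Φ xs ts p s) :=
    hfam.dparam (by rw [one_add_one_eq_two])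
  -- At `s = 0` the density is the Gaussian itself, integrable by volume growth; this starts the
  -- differentiation under the integral.
  obtain ⟨hW, hW2, hW1⟩ := hasDerivAt_integral_of_dominated_twice (μ := inducedVolume n F)
    (W := fun s p => weightedDensity n F Φ xs ts p s)
    (W₁ := fun s p => deriv (weightedDensity n F Φ xs ts p) s)
    (W₂ := fun s p => iteratedDeriv 2 (weightedDensity n F Φ xs ts p) s) hδ
    (fun s hs => (continuous_weightedDensity hF (himm s (hδs s hs).2).sm).aestronglyMeasurable)
    ((integrable_const_mul_gaussWeight (x₀ := xs 0) hF ht₀ hg 1).congr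
      (Filter.Eventually.of_forall fun p => by
        simp only [one_mul, weightedDensity_zero hF h0])) hb
    (fun s hs p => hfam.hasDerivAt (by simp) (hδs s hs).2 p)
    (fun s hs p => by
      have := hfam1.hasDerivAt (by simp) (hδs s hs).2 p
      rw [iteratedDeriv_succ, iteratedDeriv_one]
      exact this)
    (fun s hs p => ((hδs s hs).1 p).1) (fun s hs p => ((hδs s hs).1 p).2)
  have hnear : ∀ᶠ s in 𝓝 (0:ℝ), |s| < δ :=
    (isOpen_lt continuous_abs continuous_const).mem_nhds (by simpa using hδ)
  have hFW : ∀ s, |s| < δ → HasDerivAt (fun s => Ffunctional n (xs s) (ts s) (Φ s))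
      (∫ p, deriv (weightedDensity n F Φ xs ts p) s ∂(inducedVolume n F)) s := fun s hs =>
    (hW s hs).2.congr_of_eventuallyEq <| by
      filter_upwards [isOpen_Ioo.mem_nhds (hδs s hs).2] with r hr
      exact Ffunctional_eq_integral_weightedDensity hF (himm r hr).sm
  refine ⟨hnear.mono fun s hs => ⟨?_, (hFW s hs).differentiableAt⟩, ?_⟩
  · rw [integrable_inducedVolume_iff hF (himm s (hδs s hs).2).sm]
    simpa only [weightedDensity_eq hF.sm (himm s (hδs s hs).2).sm] using (hW s hs).1
  have hD := hasDerivAt_deriv_weightedDensity hF hsh hε hΦ himm h0 hxs hts hpos hX hn hZ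
  have hval := fun p => (show iteratedDeriv 2 (weightedDensity n F Φ xs ts p) 0 =
    deriv (deriv (weightedDensity n F Φ xs ts p)) 0 by
      rw [iteratedDeriv_succ, iteratedDeriv_one]).trans (hD p).deriv
  have hsv := integrable_secondVariationDensity hF hsh ht₀ hg hX hX2 hXL (deriv xs 0) (deriv ts 0)
  have htan := integrable_tangential_part hF ht₀ hg hX hn hZ hX2 hX1 hZ1 (deriv xs 0)
    (deriv (deriv xs) 0) (deriv ts 0) (deriv (deriv ts) 0)
  have hY : Smooth n fun q => dparam (dparam Φ) 0 q + gradHalfSq n F (dparam Φ 0) q +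
      centreField n F (xs 0) (ts 0) (deriv xs 0) (deriv (deriv xs) 0) (deriv ts 0)
        (deriv (deriv ts) 0) q :=
    (hZ.add (smooth_gradHalfSq hF hX)).add (smooth_centreField hF.sm _ _ _ _)
  simp only [hval, add_mul] at hW2 hW1
  -- The weighted divergence is the dominated second derivative of the density minus the integrand
  -- of the formula. Its integrability, and with it the divergence theorem, comes without an
  -- estimate of the divergence itself.
  have hdi := (hW2.sub hsv).congr (Filter.Eventually.of_forall fun p => add_sub_cancel_left _ _)
  rw [integral_add hsv hdi, integral_wdiv_eq_zero hF hc hsh ht₀ hY htan hdi, add_zero] at hW1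
  exact hW1.congr_of_eventuallyEq (hnear.mono fun s hs => (hFW s hs).deriv)

end Deformation

end SecondVariation

/-! ### Integrability of the variation in the two admissible cases -/

section VariationHypotheses

open MeasureTheory Set

variable {n N : ℕ} {M : Type*} [TopologicalSpace M] [T2Space M] [ChartedSpace (𝔼 n) M]
  [IsManifold (𝓡 n) ∞ M] [MeasurableSpace M] [BorelSpace M]
  [SecondCountableTopology M] {F : M → 𝔼 N} {ε : ℝ} {Φ : ℝ → M → 𝔼 N} {xs : ℝ → 𝔼 N} {ts : ℝ → ℝ}

lemma dparam_eq_zero_of_const {v : 𝔼 N} {p : M} (h : ∀ s ∈ Ioo (-ε) ε, Φ s p = v) {s : ℝ}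
    (hs : s ∈ Ioo (-ε) ε) : dparam Φ s p = 0 := by
  have hev : (fun r => Φ r p) =ᶠ[𝓝 s] fun _ => v := by
    filter_upwards [isOpen_Ioo.mem_nhds hs] with r hr using h r hr
  exact hev.deriv_eq.trans (deriv_const s v)

lemma IsDeformation.smooth_dparam (hΦ : IsDeformation n F Φ ε) : Smooth n (dparam Φ 0) :=
  (hΦ.isFamily.dparam (by simp)).smooth (by simpa using hΦ.pos)

lemma IsDeformation.smooth_dparam_dparam (hΦ : IsDeformation n F Φ ε) :
    Smooth n (dparam (dparam Φ) 0) :=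
  IsFamily.smooth (ε := ε) (IsFamily.dparam (k := ∞) (hΦ.isFamily.dparam (by simp)) (by simp))
    (by simpa using hΦ.pos)

lemma IsCompactlySupported.integrable_variation (hF : IsSmoothImmersion n F)
    (hΦ : IsDeformation n F Φ ε) (hcs : IsCompactlySupported F Φ ε)
    (hn : IsNormalField n F (dparam Φ 0)) (x₀ : 𝔼 N) (t₀ : ℝ) :
    Integrable (fun p => ‖dparam Φ 0 p‖ ^ 2 * gaussWeight n x₀ t₀ (F p)) (inducedVolume n F) ∧
    Integrable (fun p => inner ℝ (dparam Φ 0 p) (jacobiOp n F x₀ t₀ (dparam Φ 0) p) *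
      gaussWeight n x₀ t₀ (F p)) (inducedVolume n F) ∧
    Integrable (fun p => normSqNormalConn n F (dparam Φ 0) p * gaussWeight n x₀ t₀ (F p))
      (inducedVolume n F) ∧
    Integrable (fun p => ‖tder n F F p (dparam (dparam Φ) 0 p)‖ * gaussWeight n x₀ t₀ (F p))
      (inducedVolume n F) := by
  obtain ⟨K, hK, hKΦ⟩ := hcs
  have h0 : (0:ℝ) ∈ Ioo (-ε) ε := by simpa using hΦ.pos
  have hd : ∀ s ∈ Ioo (-ε) ε, ∀ p ∉ K, dparam Φ s p = 0 := fun s hs p hp =>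
    dparam_eq_zero_of_const (fun r hr => hKΦ r hr p hp) hs
  exact integrable_variation_of_compact hF hΦ.smooth_dparam hn hΦ.smooth_dparam_dparam hK (hd 0 h0)
    (fun p hp => dparam_eq_zero_of_const (fun r hr => hd r hr p hp) h0) x₀ t₀

/-- The pairing with the Jacobi operator is bounded by `|X|² + |LX|²`, and its measurability comes
from continuity of the pairing rather than of `LX`. -/
lemma IsAdmissible.integrable_variation (hF : IsSmoothImmersion n F)
    (hΦ : IsDeformation n F Φ ε) (ht₀ : 0 < ts 0) (hadm : IsAdmissible n F Φ xs ts (dparam Φ 0))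
    (hn : IsNormalField n F (dparam Φ 0)) :
    Integrable (fun p => inner ℝ (dparam Φ 0 p) (jacobiOp n F (xs 0) (ts 0) (dparam Φ 0) p) *
      gaussWeight n (xs 0) (ts 0) (F p)) (inducedVolume n F) ∧
    Integrable (fun p => ‖tder n F F p (dparam (dparam Φ) 0 p)‖ *
      gaussWeight n (xs 0) (ts 0) (F p)) (inducedVolume n F) := by
  constructor
  · refine integrable_of_abs_le_mul_gaussWeight hF.sm ht₀
      (continuous_inner_jacobiOp hF hΦ.smooth_dparam hn)
      (b := fun p => ‖dparam Φ 0 p‖ ^ 2 + ‖jacobiOp n F (xs 0) (ts 0) (dparam Φ 0) p‖ ^ 2)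
      ((hadm.sq_integrable.add hadm.jacobi_sq_integrable).congr
        (Filter.Eventually.of_forall fun p => (add_mul _ _ _).symm)) fun p => ?_
    refine (abs_real_inner_le_norm _ _).trans ?_
    have := two_mul_le_add_sq ‖dparam Φ 0 p‖ ‖jacobiOp n F (xs 0) (ts 0) (dparam Φ 0) p‖
    have := mul_nonneg (norm_nonneg (dparam Φ 0 p))
      (norm_nonneg (jacobiOp n F (xs 0) (ts 0) (dparam Φ 0) p))
    linarith
  · refine hadm.acceleration.congr (Filter.Eventually.of_forall fun p => ?_)
    simp only [tanPart_eq hF, iteratedDeriv_succ, iteratedDeriv_zero]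
    rfl

end VariationHypotheses

end ImmersedSurface

end

theorem theorem2p3 {n N : ℕ} {M : Type*} [TopologicalSpace M] [T2Space M]
    [SecondCountableTopology M] [ChartedSpace (EuclideanSpace ℝ (Fin n)) M]
    [IsManifold (𝓡 n) ∞ M] [MeasurableSpace M] [BorelSpace M]
    (F : M → EuclideanSpace ℝ (Fin N)) (x₀ : EuclideanSpace ℝ (Fin N)) (t₀ : ℝ) (ht₀ : 0 < t₀)
    (hF : ImmersedSurface.IsSmoothImmersion n F)
    (hcomplete : ImmersedSurface.IsCompleteSurface n F)
    (hshrinker : ImmersedSurface.IsSelfShrinker n F x₀ t₀)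
    (hgrowth : ImmersedSurface.HasPolynomialVolumeGrowth n F)
    (ε : ℝ) (Φ : ℝ → M → EuclideanSpace ℝ (Fin N))
    (hΦ : ImmersedSurface.IsDeformation n F Φ ε)
    (X : M → EuclideanSpace ℝ (Fin N)) (hX : ∀ p, HasDerivAt (fun s => Φ s p) (X p) 0)
    (hXnormal : ∀ p, X p ∈ (ImmersedSurface.tangentPlane n F p)ᗮ)
    (xs : ℝ → EuclideanSpace ℝ (Fin N)) (hxs : ContDiffOn ℝ 2 xs (Set.Ioo (-ε) ε))
    (hxs₀ : xs 0 = x₀) (y : EuclideanSpace ℝ (Fin N)) (hy : HasDerivAt xs y 0)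
    (ts : ℝ → ℝ) (hts : ContDiffOn ℝ 2 ts (Set.Ioo (-ε) ε))
    (hts₀ : ts 0 = t₀) (h : ℝ) (hh : HasDerivAt ts h 0)
    (hadm : ImmersedSurface.IsCompactlySupported F Φ ε ∨
      ImmersedSurface.IsAdmissible n F Φ xs ts X) :
    (∀ᶠ s in 𝓝 (0 : ℝ),
      MeasureTheory.Integrable
        (fun p => ImmersedSurface.gaussWeight n (xs s) (ts s) (Φ s p))
        (ImmersedSurface.inducedVolume n (Φ s)) ∧
      DifferentiableAt ℝ (fun s => ImmersedSurface.Ffunctional n (xs s) (ts s) (Φ s)) s) ∧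
    MeasureTheory.Integrable
      (fun p => inner ℝ (X p) (ImmersedSurface.jacobiOp n F x₀ t₀ X p - (1 / t₀) • y
        + (2 / t₀ * h) • ImmersedSurface.meanCurv n F p)
        * ImmersedSurface.gaussWeight n x₀ t₀ (F p))
      (ImmersedSurface.inducedVolume n F) ∧
    MeasureTheory.Integrable
      (fun p => (1 / (2 * t₀) * ‖ImmersedSurface.norPart n F p y‖ ^ 2
        + 1 / t₀ * h ^ 2 * ‖ImmersedSurface.meanCurv n F p‖ ^ 2)
        * ImmersedSurface.gaussWeight n x₀ t₀ (F p))
      (ImmersedSurface.inducedVolume n F) ∧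
    HasDerivAt (deriv fun s => ImmersedSurface.Ffunctional n (xs s) (ts s) (Φ s))
      ((∫ p, -inner ℝ (X p) (ImmersedSurface.jacobiOp n F x₀ t₀ X p - (1 / t₀) • y
          + (2 / t₀ * h) • ImmersedSurface.meanCurv n F p)
          * ImmersedSurface.gaussWeight n x₀ t₀ (F p) ∂(ImmersedSurface.inducedVolume n F))
        - ∫ p, (1 / (2 * t₀) * ‖ImmersedSurface.norPart n F p y‖ ^ 2
          + 1 / t₀ * h ^ 2 * ‖ImmersedSurface.meanCurv n F p‖ ^ 2)
          * ImmersedSurface.gaussWeight n x₀ t₀ (F p) ∂(ImmersedSurface.inducedVolume n F))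
      0 := by
  open MeasureTheory Set ImmersedSurface in
  subst hxs₀ hts₀
  obtain rfl : dparam Φ 0 = X := funext fun p => (hX p).deriv
  obtain rfl := hy.deriv
  obtain rfl := hh.deriv
  have hε := hΦ.pos
  have h0 : (0:ℝ) ∈ Ioo (-ε) ε := by simpa using hε
  have hn := isNormalField_of_mem_orthogonal hF hXnormal
  -- Positivity of `ts` is only known at `0`; the parameter interval is shrunk so that the Gaussian
  -- weights stay nondegenerate.
  obtain ⟨ε', hε', hball⟩ := Metric.eventually_nhds_iff.1
    (((hts.continuousOn.continuousAt (isOpen_Ioo.mem_nhds h0)).eventually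
      (Ioi_mem_nhds ht₀)).and (isOpen_Ioo.mem_nhds h0))
  have hsmall : ∀ s ∈ Ioo (-ε') ε', 0 < ts s ∧ s ∈ Ioo (-ε) ε := fun s hs =>
    hball (by simpa [abs_lt] using hs)
  have hsub : Ioo (-ε') ε' ⊆ Ioo (-ε) ε := fun s hs => (hsmall s hs).2
  have hfam := hΦ.isFamily.mono hsub
  have himm : ∀ s ∈ Ioo (-ε') ε', IsSmoothImmersion n (Φ s) := fun s hs =>
    hΦ.immersion s (hsub hs)
  have hpos : ∀ s ∈ Ioo (-ε') ε', 0 < ts s := fun s hs => (hsmall s hs).1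
  -- Both alternatives for the deformation lead to the same five facts: domination of the density
  -- and four integrability statements on the variation.
  obtain ⟨hdom, hX2, hXL, hX1, hZ1⟩ := hadm.elim
    (fun hcs => And.intro (exists_dominating_of_compact hF hgrowth hε hxs hts rfl ht₀
      (fun s hs => (hΦ.immersion s hs).sm) hε' (isFamily_weightedDensity hF hfam himm
        (hxs.mono hsub) (hts.mono hsub) hpos) hcs)
      (hcs.integrable_variation hF hΦ hn (xs 0) (ts 0)))
    (fun hadm => have h := hadm.integrable_variation hF hΦ ht₀ hn
      ⟨hadm.dominated, hadm.sq_integrable, h.1, hadm.grad_sq_integrable, h.2⟩)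
  have h1 := integrable_normal_terms hF hshrinker ht₀ hgrowth hΦ.smooth_dparam hX2 hXL
    (deriv xs 0) (deriv ts 0)
  have h2 := integrable_centre_terms hF hshrinker ht₀ hgrowth (deriv xs 0) (deriv ts 0)
  obtain ⟨h3, h4⟩ := second_variation_of_dominated hF hcomplete hshrinker hgrowth hε' hfam himm
    hΦ.initial (hxs.mono hsub) (hts.mono hsub) hpos hΦ.smooth_dparam hn hΦ.smooth_dparam_dparam
    hdom hX2 hXL hX1 hZ1
  refine ⟨h3, h1, h2, ?_⟩
  simp only [neg_mul]
  rw [integral_neg, ← integral_neg', ← integral_sub h1.neg h2]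
  simpa only [secondVariationDensity, sub_mul, neg_mul, Pi.neg_apply] using h4
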